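/- All systems are finite-dimensional. Let $L$ be a logical system with Hermitian charge $X_L$, let $P=P_1\otimes\cdots\otimes P_N$ ($N\ge1$) be a physical system with $X_P=\sum_i X_{P_i}$, $X_{P_i}$ Hermitian, and let $\mathcal E_{\rm code}(\cdot)=V\cdot V^\dagger$, $V^\dagger V=1$, be an isometric code that is covariant: $\mathcal E_{\rm code}(e^{i\theta X_L}\,\cdot\,e^{-i\theta X_L})=e^{i\theta X_P}\mathcal E_{\rm code}(\cdot)e^{-i\theta X_P}$ for all real $\theta$. *Notation.* For a test ensemble $\{p_k,\rho_k\}$ (finitely many states $\rho_k$ on $L$ with probabilities $p_k$) and a channel (CPTP map) $\Phi:L\to P'$, put $$\epsilon(\Phi,\{p_k,\rho_k\})=\min_{\mathcal R}\sqrt{\sum_kp_kD_F(\rho_k,\mathcal R\circ\Phi(\rho_k))^2},\quad D_F=\sqrt{1-F^2},\quad F(\rho,\sigma)=\mathrm{Tr}\sqrt{\sqrt\rho\,\sigma\sqrt\rho},$$ where $\mathcal R$ runs over the channels $P'\to L$; for a noise channel $\mathcal N$ on $P$ write $\epsilon(\mathcal E_{\rm code},\mathcal N,\cdot)=\epsilon(\mathcal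 N\circ\mathcal E_{\rm code},\cdot)$. For a Hermitian $X_{P'}$ let $Y=X_L-\Phi^\dagger(X_{P'})$ and $\mathcal C=\big(\sum_{k\ne k'}p_kp_{k'}\mathrm{Tr}[(\rho_k-\rho_{k'})_+Y(\rho_k-\rho_{k'})_-Y]\big)^{1/2}$, where $(\cdot)_\pm$ are the positive and negative parts. A *symmetric realization* of $\Phi$ consists of systems $B,B'$, a unitary $U:L\otimes B\to P'\otimes B'$, Hermitian $X_B,X_{B'}$ and a state $\rho_B$ with $[\rho_B,X_B]=0$, $\Phi(\cdot)=\mathrm{Tr}_{B'}[U(\cdot\otimes\rho_B)U^\dagger]$ and $X_L+X_B=U^\dagger(X_{P'}+X_{B'})U$. For it let $$\Delta=\max_\rho\sqrt{\mathcal F_{\rho\otimes\rho_B}\big(X_L\otimes1-U^\dagger(X_{P'}\otimes1)U\big)},$$ over the states $\rho$ supported in the span of the supports of the $\rho_k$, where $\mathcal F_\sigma(X)=\mathrm{Tr}[\sigma\Lambda^2]$ is the SLD quantum Fisher information of $\{e^{-iXt}\sigma e^{iXt}\}_t$, $\Lambda$ being any Hermitian solution of $\tfrac12(\Lambda\sigma+\sigma\Lambda)=i[\sigma,X]$.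 $\Delta_W$ denotes the difference between the largest and the smallest eigenvalue of $W$. *Erasure noise with known location.* Given unit vectors $|\tau_i\rangle\in P_i$, $\mathcal N_\tau(\cdot)=\sum_i\frac1N|i\rangle\langle i|_M\otimes|\tau_i\rangle\langle\tau_i|_{P_i}\otimes\mathrm{Tr}_{P_i}[\cdot]$, a channel from $P$ to $P'=M\otimes P$. Take $X_{P'}=1_M\otimes X_P$, and let $\tilde{\mathcal N}$ be $\mathcal N_\tau$ with the $\tau_i$ replaced by normalized eigenvectors $0_i$ of $X_{P_i}$ for its smallest eigenvalue. *Claims.* 1. (Covariant noise.) Let $\mathcal N$ be any channel from $P$ to a system $P'$ that is covariant with respect to $X_P$ and a Hermitian $X_{P'}$. Then $\Phi=\mathcal N\circ\mathcal E_{\rm code}$ has a symmetric realization, and for every symmetric realization and every test ensemble, $$\epsilon(\mathcal E_{\rm code},\mathcal N,\{p_k,\rho_k\})\ge\frac{\mathcal C^2}{\Delta^2},$$ and, if $F(\rho_k,\rho_{k'})=0$ for all $k\neq k'$, $$\epsilon(\mathcal E_{\rm code},\mathcal N,\{p_k,\rho_k\})\ge\frac{\mathcal C}{\Delta}$$ (if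 $\Delta=0$ then $\mathcal C=0$, and the right-hand sides are read as $0$). 2. (Erasure noise.) The same holds for $\epsilon(\mathcal E_{\rm code},\mathcal N_\tau,\{p_k,\rho_k\})$ for arbitrary $\tau$, with $\mathcal C$, $\Delta$ and the symmetric realizations being those of $\Phi=\tilde{\mathcal N}\circ\mathcal E_{\rm code}$. 3. If $\Delta_{X_L}>0$, let $|j_*\rangle,|j'_*\rangle$ be normalized eigenvectors of $X_L$ for its largest and smallest eigenvalues. Then the ensemble of $\psi_\pm=(|j_*\rangle\pm|j'_*\rangle)/\sqrt2$ with probabilities $\tfrac12,\tfrac12$ is an orthogonal test ensemble and, for every $\tau$, $$\epsilon(\mathcal E_{\rm code},\mathcal N_\tau,\{\tfrac12,\psi_\pm\})\ge\frac{\Delta_{X_L}}{\Delta_{X_L}+4\sqrt2\,N\max_i\Delta_{X_{P_i}}}.$$ -/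

import Mathlib

open scoped Matrix Kronecker ComplexOrder
open Matrix

namespace CovCode

noncomputable section

/-! ### States, channels, fidelity -/

/-- Density matrices (states of the finite-dimensional system with basis `a`). -/
def IsState {a : Type*} [Fintype a] (ρ : Matrix a a ℂ) : Prop :=
  ρ.PosSemidef ∧ ρ.trace = 1

/-- Unit vectors. -/
def IsUnitVec {a : Type*} [Fintype a] (v : a → ℂ) : Prop :=
  star v ⬝ᵥ v = 1

/-- The operator `|v⟩⟨v|`. -/
def proj {a : Type*} (v : a → ℂ) : Matrix a a ℂ :=
  vecMulVec v (star v)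

/-- The amplification `id_k ⊗ Φ`, acting blockwise. -/
def amplify {a b : Type*} (Φ : Matrix a a ℂ →ₗ[ℂ] Matrix b b ℂ) (k : ℕ)
    (M : Matrix (Fin k × a) (Fin k × a) ℂ) : Matrix (Fin k × b) (Fin k × b) ℂ :=
  Matrix.of fun u v => Φ (Matrix.of fun x y => M (u.1, x) (v.1, y)) u.2 v.2

/-- Quantum channels: completely positive trace preserving linear maps. -/
structure IsChannel {a b : Type*} [Fintype a] [Fintype b]
    (Φ : Matrix a a ℂ →ₗ[ℂ] Matrix b b ℂ) : Prop where
  completelyPositive : ∀ (k : ℕ) (M : Matrix (Fin k × a) (Fin k × a) ℂ),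
    M.PosSemidef → (amplify Φ k M).PosSemidef
  tracePreserving : ∀ M : Matrix a a ℂ, (Φ M).trace = M.trace

/-- The dual (Heisenberg picture) map, see `trace_dual_mul`. -/
def dual {a b : Type*} [Fintype b] [DecidableEq a]
    (Φ : Matrix a a ℂ →ₗ[ℂ] Matrix b b ℂ) (W : Matrix b b ℂ) : Matrix a a ℂ :=
  Matrix.of fun i j => (W * Φ (Matrix.single j i 1)).trace

/-- The (root) fidelity `F(ρ, σ) = Tr √(√ρ σ √ρ)`. -/
def fidelity {a : Type*} [Fintype a] [DecidableEq a] (ρ σ : Matrix a a ℂ) : ℝ :=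
  (cfc Real.sqrt (cfc Real.sqrt ρ * σ * cfc Real.sqrt ρ)).trace.re

/-- The purified distance `D_F = √(1 - F²)`. -/
def purifiedDistance {a : Type*} [Fintype a] [DecidableEq a] (ρ σ : Matrix a a ℂ) : ℝ :=
  Real.sqrt (1 - fidelity ρ σ ^ 2)

/-! ### Test ensembles and recovery error -/

/-- A test ensemble `{p_k, ρ_k}`. -/
def IsTestEnsemble {K a : Type*} [Fintype K] [Fintype a]
    (p : K → ℝ) (ρ : K → Matrix a a ℂ) : Prop :=
  (∀ k, 0 ≤ p k) ∧ ∑ k, p k = 1 ∧ ∀ k, IsState (ρ k)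

/-- The test states are orthogonal to each other. -/
def IsOrthogonalEnsemble {K a : Type*} [Fintype a] [DecidableEq a]
    (ρ : K → Matrix a a ℂ) : Prop :=
  ∀ k k', k ≠ k' → fidelity (ρ k) (ρ k') = 0

/-- The recovery error of the channel `Φ` for the ensemble `{p_k, ρ_k}`:
the minimum over recovery channels `R` of `√(∑ p_k D_F(ρ_k, R(Φ(ρ_k)))²)`. -/
def recoveryError {K a b : Type*} [Fintype K] [Fintype a] [DecidableEq a] [Fintype b]
    (Φ : Matrix a a ℂ →ₗ[ℂ] Matrix b b ℂ) (p : K → ℝ) (ρ : K → Matrix a a ℂ) : ℝ :=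
  sInf {e : ℝ | ∃ R : Matrix b b ℂ →ₗ[ℂ] Matrix a a ℂ, IsChannel R ∧
    e = Real.sqrt (∑ k, p k * purifiedDistance (ρ k) (R (Φ (ρ k))) ^ 2)}

/-! ### The quantities `Y`, `𝒞`, the Fisher information and `Δ` -/

/-- `Y = X_A - Φ†(X_{A'})`. -/
def chargeChange {a b : Type*} [Fintype b] [DecidableEq a]
    (Φ : Matrix a a ℂ →ₗ[ℂ] Matrix b b ℂ) (XA : Matrix a a ℂ) (XA' : Matrix b b ℂ) :
    Matrix a a ℂ :=
  XA - dual Φ XA'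

/-- Positive part of a Hermitian matrix. -/
def pos {a : Type*} [Fintype a] [DecidableEq a] (A : Matrix a a ℂ) : Matrix a a ℂ :=
  cfc (fun x : ℝ => max x 0) A

/-- Negative part of a Hermitian matrix (a positive semidefinite matrix, `A = pos A - neg A`). -/
def neg {a : Type*} [Fintype a] [DecidableEq a] (A : Matrix a a ℂ) : Matrix a a ℂ :=
  cfc (fun x : ℝ => max (-x) 0) A

/-- `𝒞 = √(∑_{k ≠ k'} p_k p_k' Tr[(ρ_k - ρ_k')₊ Y (ρ_k - ρ_k')₋ Y])`. -/
def offDiag {K a : Type*} [Fintype K] [DecidableEq K] [Fintype a] [DecidableEq a]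
    (Y : Matrix a a ℂ) (p : K → ℝ) (ρ : K → Matrix a a ℂ) : ℝ :=
  Real.sqrt (∑ k, ∑ k' ∈ Finset.univ.filter (fun k' => k' ≠ k),
    p k * p k' * (pos (ρ k - ρ k') * Y * neg (ρ k - ρ k') * Y).trace.re)

/-- `L` is a symmetric logarithmic derivative at `t = 0` of the family
`ρ_t = e^{-iXt} ρ e^{iXt}`, whose derivative at `0` is `i(ρX - Xρ)`:
`(Lρ + ρL)/2 = i(ρX - Xρ)`. -/
def IsSLD {a : Type*} [Fintype a] (ρ X L : Matrix a a ℂ) : Prop :=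
  L.IsHermitian ∧ L * ρ + ρ * L = (2 * Complex.I) • (ρ * X - X * ρ)

/-- The SLD quantum Fisher information `ℱ_ρ(X) = Tr[ρ L²]` of the family `e^{-iXt} ρ e^{iXt}`.
The value does not depend on the choice of `L`, see `qfi_eq` and `exists_sld`. -/
def qfi {a : Type*} [Fintype a] (ρ X : Matrix a a ℂ) : ℝ :=
  sInf {f : ℝ | ∃ L : Matrix a a ℂ, IsSLD ρ X L ∧ f = (ρ * (L * L)).trace.re}

/-- The partial trace over the second factor. -/
def traceSnd {a b : Type*} [Fintype b] (M : Matrix (a × b) (a × b) ℂ) : Matrix a a ℂ :=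
  Matrix.of fun i j => ∑ k, M (i, k) (j, k)

/-- A realization `(U, ρ_B, X_B, X_{B'})` of the channel `Φ` from `A` to `A'` by a unitary
`U : A ⊗ B → A' ⊗ B'` with the conservation law `X_A + X_B = U†(X_{A'} + X_{B'})U`, whose
environment state `ρ_B` has no coherence with respect to `X_B`. -/
structure SymmetricRealization {a a' : Type*} [Fintype a] [DecidableEq a] [Fintype a']
    [DecidableEq a'] (Φ : Matrix a a ℂ →ₗ[ℂ] Matrix a' a' ℂ) (XA : Matrix a a ℂ)
    (XA' : Matrix a' a' ℂ) (b b' : Type*) [Fintype b] [DecidableEq b] [Fintype b']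
    [DecidableEq b'] where
  U : Matrix (a' × b') (a × b) ℂ
  ρB : Matrix b b ℂ
  XB : Matrix b b ℂ
  XB' : Matrix b' b' ℂ
  unitary_left : Uᴴ * U = 1
  unitary_right : U * Uᴴ = 1
  isState : IsState ρB
  hermitian_XB : XB.IsHermitian
  hermitian_XB' : XB'.IsHermitian
  realizes : ∀ M : Matrix a a ℂ, Φ M = traceSnd (U * (M ⊗ₖ ρB) * Uᴴ)
  conservation :
    XA ⊗ₖ (1 : Matrix b b ℂ) + (1 : Matrix a a ℂ) ⊗ₖ XB
      = Uᴴ * (XA' ⊗ₖ (1 : Matrix b' b' ℂ) + (1 : Matrix a' a' ℂ) ⊗ₖ XB') * U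
  incoherent : ρB * XB = XB * ρB

/-- `Δ`: the maximum of `√ℱ_{ρ ⊗ ρ_B}(X_A ⊗ 1 - U†(X_{A'} ⊗ 1)U)` over the states `ρ` supported
in the subspace spanned by the supports of the test states. -/
def coherenceBound {K a a' b b' : Type*} [Fintype a] [DecidableEq a] [Fintype a']
    [DecidableEq a'] [Fintype b] [DecidableEq b] [Fintype b'] [DecidableEq b']
    {Φ : Matrix a a ℂ →ₗ[ℂ] Matrix a' a' ℂ} {XA : Matrix a a ℂ} {XA' : Matrix a' a' ℂ}
    (I : SymmetricRealization Φ XA XA' b b') (ρ : K → Matrix a a ℂ) : ℝ :=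
  sSup {r : ℝ | ∃ σ : Matrix a a ℂ, IsState σ ∧
    LinearMap.range σ.mulVecLin ≤ (⨆ k, LinearMap.range (ρ k).mulVecLin) ∧
    r = Real.sqrt (qfi (σ ⊗ₖ I.ρB)
      (XA ⊗ₖ (1 : Matrix b b ℂ) - I.Uᴴ * (XA' ⊗ₖ (1 : Matrix b' b' ℂ)) * I.U))}

/-! ### Covariant codes and noise -/

/-- `Φ(e^{iθX_A} M e^{-iθX_A}) = e^{iθX_{A'}} Φ(M) e^{-iθX_{A'}}` for all `θ`. -/
def IsCovariant {a b : Type*} [Fintype a] [DecidableEq a] [Fintype b] [DecidableEq b]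
    (Φ : Matrix a a ℂ →ₗ[ℂ] Matrix b b ℂ) (XA : Matrix a a ℂ) (XA' : Matrix b b ℂ) : Prop :=
  ∀ (θ : ℝ) (M : Matrix a a ℂ),
    Φ (NormedSpace.exp ((θ * Complex.I) • XA) * M * NormedSpace.exp (-(θ * Complex.I) • XA))
      = NormedSpace.exp ((θ * Complex.I) • XA') * Φ M *
          NormedSpace.exp (-(θ * Complex.I) • XA')

/-- The isometric encoding `M ↦ V M V†`. -/
def encode {l q : Type*} [Fintype l] (V : Matrix q l ℂ) :
    Matrix l l ℂ →ₗ[ℂ] Matrix q q ℂ where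
  toFun M := V * M * Vᴴ
  map_add' M M' := by rw [Matrix.mul_add, Matrix.add_mul]
  map_smul' c M := by simp

/-- The operator on `⨂ P_j` that acts as `A` on `P_i` and trivially on the other subsystems. -/
def localOp {ι : Type*} [Fintype ι] [DecidableEq ι] {p : ι → Type*} [∀ i, DecidableEq (p i)]
    (i : ι) (A : Matrix (p i) (p i) ℂ) : Matrix (∀ j, p j) (∀ j, p j) ℂ :=
  Matrix.of fun x y => if ∀ j, j ≠ i → x j = y j then A (x i) (y i) else 0

/-- `X_P = ∑ᵢ X_{P_i}`. -/
def totalCharge {ι : Type*} [Fintype ι] [DecidableEq ι] {p : ι → Type*}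
    [∀ i, DecidableEq (p i)] (X : ∀ i, Matrix (p i) (p i) ℂ) :
    Matrix (∀ j, p j) (∀ j, p j) ℂ :=
  ∑ i, localOp i (X i)

/-- Erasure noise with known location: with probability `1/N` the subsystem `P_i` is lost and
replaced by `τ_i`, and the location `i` is recorded in a memory `M`:
`ρ ↦ ∑ᵢ (1/N) |i⟩⟨i|_M ⊗ |τ_i⟩⟨τ_i|_{P_i} ⊗ Tr_{P_i} ρ`. -/
def erasure {N : ℕ} {p : Fin N → Type*} [∀ i, Fintype (p i)] (τ : ∀ i, p i → ℂ) :
    Matrix (∀ j, p j) (∀ j, p j) ℂ →ₗ[ℂ]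
      Matrix (Fin N × (∀ j, p j)) (Fin N × (∀ j, p j)) ℂ where
  toFun M := Matrix.of fun u v => if u.1 = v.1 then
      (1 / (N : ℂ)) * (τ u.1 (u.2 u.1) * star (τ u.1 (v.2 u.1))) *
        ∑ z : p u.1, M (Function.update u.2 u.1 z) (Function.update v.2 u.1 z)
    else 0
  map_add' M M' := by
    ext u v
    by_cases h : u.1 = v.1 <;> simp [h, Finset.sum_add_distrib, mul_add]
  map_smul' c M := by
    ext u v
    by_cases h : u.1 = v.1 <;> simp [h, ← Finset.mul_sum, mul_left_comm]

/-- The largest eigenvalue of a Hermitian matrix. -/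
def maxEig {a : Type*} [Fintype a] [DecidableEq a] (W : Matrix a a ℂ) : ℝ :=
  sSup (spectrum ℝ W)

/-- The smallest eigenvalue of a Hermitian matrix. -/
def minEig {a : Type*} [Fintype a] [DecidableEq a] (W : Matrix a a ℂ) : ℝ :=
  sInf (spectrum ℝ W)

/-- `Δ_W`: the difference between the largest and the smallest eigenvalue of `W`. -/
def spread {a : Type*} [Fintype a] [DecidableEq a] (W : Matrix a a ℂ) : ℝ :=
  maxEig W - minEig W

/-- `v` is a normalized eigenvector of `W` with eigenvalue `x`. -/
def IsUnitEigenvec {a : Type*} [Fintype a] (W : Matrix a a ℂ) (x : ℝ) (v : a → ℂ) : Prop :=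
  IsUnitVec v ∧ W *ᵥ v = (x : ℂ) • v

/-! ### The definitions of the dual map and of the Fisher information are the intended ones -/

theorem trace_dual_mul {a b : Type*} [Fintype a] [DecidableEq a] [Fintype b]
    (Φ : Matrix a a ℂ →ₗ[ℂ] Matrix b b ℂ) (W : Matrix b b ℂ) (ρ : Matrix a a ℂ) :
    (dual Φ W * ρ).trace = (W * Φ ρ).trace := by
  conv_rhs => rw [Matrix.matrix_eq_sum_single ρ]
  simp only [map_sum, Matrix.mul_sum, Matrix.trace_sum]
  rw [Matrix.trace]
  simp only [Matrix.diag_apply, Matrix.mul_apply, dual, Matrix.of_apply]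
  rw [Finset.sum_comm]
  refine Finset.sum_congr rfl fun i _ => Finset.sum_congr rfl fun j _ => ?_
  have h : (Matrix.single i j (ρ i j) : Matrix a a ℂ) = ρ i j • Matrix.single i j 1 := by
    rw [Matrix.smul_single, smul_eq_mul, mul_one]
  rw [h, map_smul, Matrix.mul_smul, Matrix.trace_smul, smul_eq_mul, mul_comm]

theorem exists_sld {a : Type*} [Fintype a] [DecidableEq a] {ρ X : Matrix a a ℂ}
    (hρ : ρ.PosSemidef) (hX : X.IsHermitian) : ∃ L, IsSLD ρ X L := by
  have hH := hρ.isHermitian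
  set ev := hH.eigenvalues with hev
  have hev0 : ∀ i, 0 ≤ ev i := fun i => hρ.eigenvalues_nonneg i
  set U : Matrix a a ℂ := (hH.eigenvectorUnitary : Matrix a a ℂ) with hU
  have hUU : Uᴴ * U = 1 := Unitary.coe_star_mul_self hH.eigenvectorUnitary
  have hUU' : U * Uᴴ = 1 := Unitary.coe_mul_star_self hH.eigenvectorUnitary
  set D : Matrix a a ℂ := diagonal fun i => (ev i : ℂ) with hD
  have hspec : ρ = U * D * Uᴴ := by
    have := hH.spectral_theorem
    rw [Unitary.conjStarAlgAut_apply] at this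
    exact this
  set W : Matrix a a ℂ := Uᴴ * X * U with hW
  have hWH : W.IsHermitian := by
    rw [hW]; exact isHermitian_conjTranspose_mul_mul U hX
  have hXW : X = U * W * Uᴴ := by
    calc X = (U * Uᴴ) * X * (U * Uᴴ) := by rw [hUU']; simp
      _ = U * W * Uᴴ := by rw [hW]; simp only [Matrix.mul_assoc]
  have hcomp : ∀ A B : Matrix a a ℂ, (U * A * Uᴴ) * (U * B * Uᴴ) = U * (A * B) * Uᴴ := by
    intro A B
    calc (U * A * Uᴴ) * (U * B * Uᴴ) = U * A * (Uᴴ * U) * B * Uᴴ := by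
          simp only [Matrix.mul_assoc]
      _ = U * (A * B) * Uᴴ := by rw [hUU]; simp only [Matrix.mul_one, Matrix.mul_assoc]
  let L' : Matrix a a ℂ := Matrix.of fun i j =>
    2 * Complex.I * ((ev i - ev j) / (ev i + ev j)) * W i j
  have hL'H : L'.IsHermitian := by
    ext i j
    have hw : star (W j i) = W i j := hWH.apply i j
    simp only [L', Matrix.conjTranspose_apply, Matrix.of_apply, star_mul', hw]
    simp only [Complex.star_def, map_div₀, map_sub, map_add, Complex.conj_ofReal, Complex.conj_I,
      map_ofNat]
    rw [add_comm (ev j : ℂ) (ev i : ℂ)]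
    ring
  have hL'D : L' * D + D * L' = (2 * Complex.I) • (D * W - W * D) := by
    ext i j
    simp only [hD, Matrix.add_apply, Matrix.mul_diagonal, Matrix.diagonal_mul, Matrix.smul_apply,
      Matrix.sub_apply, smul_eq_mul, L', Matrix.of_apply]
    by_cases h : ev i + ev j = 0
    · have hi : ev i = 0 := by linarith [hev0 i, hev0 j]
      have hj : ev j = 0 := by linarith [hev0 i, hev0 j]
      simp [hi, hj]
    · have h' : (ev i + ev j : ℂ) ≠ 0 := by exact_mod_cast h
      field_simp
      ring
  refine ⟨U * L' * Uᴴ, isHermitian_mul_mul_conjTranspose U hL'H, ?_⟩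
  rw [hXW, hspec, hcomp, hcomp, hcomp, hcomp, ← Matrix.add_mul, ← Matrix.mul_add, hL'D,
    ← Matrix.sub_mul, ← Matrix.mul_sub, Matrix.mul_smul, Matrix.smul_mul]

theorem qfi_eq {a : Type*} [Fintype a] {ρ X L : Matrix a a ℂ}
    (hL : IsSLD ρ X L) : qfi ρ X = (ρ * (L * L)).trace.re := by
  have key : ∀ L', IsSLD ρ X L' → (ρ * (L' * L')).trace = (ρ * (L * L)).trace := by
    intro L' hL'
    have e : (L' - L) * ρ + ρ * (L' - L) = 0 := by
      have := hL'.2.trans hL.2.symm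
      rw [Matrix.sub_mul, Matrix.mul_sub]
      rw [← sub_eq_zero.2 this]
      abel
    have h1 : (((L' - L) * ρ + ρ * (L' - L)) * (L' + L)).trace = 0 := by simp [e]
    simp only [Matrix.sub_mul, Matrix.mul_sub, Matrix.add_mul, Matrix.mul_add, Matrix.trace_add,
      Matrix.trace_sub, Matrix.mul_assoc] at h1
    have c1 : (L' * (ρ * L')).trace = (ρ * (L' * L')).trace := by
      rw [Matrix.trace_mul_comm, Matrix.mul_assoc]
    have c2 : (L * (ρ * L)).trace = (ρ * (L * L)).trace := by
      rw [Matrix.trace_mul_comm, Matrix.mul_assoc]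
    have c3 : (L' * (ρ * L)).trace = (ρ * (L * L')).trace := by
      rw [Matrix.trace_mul_comm, Matrix.mul_assoc]
    have c4 : (L * (ρ * L')).trace = (ρ * (L' * L)).trace := by
      rw [Matrix.trace_mul_comm, Matrix.mul_assoc]
    rw [c1, c2, c3, c4] at h1
    linear_combination h1 / 2
  have hs : {f : ℝ | ∃ L : Matrix a a ℂ, IsSLD ρ X L ∧ f = (ρ * (L * L)).trace.re}
      = {(ρ * (L * L)).trace.re} := by
    ext f
    constructor
    · rintro ⟨L', hL', rfl⟩
      rw [Set.mem_singleton_iff, key L' hL']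
    · rintro rfl
      exact ⟨L, hL, rfl⟩
  rw [qfi, hs, csInf_singleton]

end

end CovCode

open CovCode

open scoped Matrix Kronecker ComplexOrder
open Matrix
open CovCode

namespace CovCode

noncomputable section

set_option linter.unusedSectionVars false

/-! ### Traces of products -/

/-! The engine is an uncertainty relation with Fisher information in place of the variance: |Tr
ρ[X,D]|² ≤ F_ρ(X) Tr ρD² (`sq_norm_trace_commutator_le`). It is applied to the loss X_A ⊗ 1 -
U†(X_{A'} ⊗ 1)U of system charge and to D = U†(O ⊗ 1)U - P ⊗ 1, the disturbance of a projection P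
that is read out as O at the output. By the conservation law the loss is the gain of bath charge. It
therefore has vanishing mean commutator with U†(O ⊗ 1)U in the state σ ⊗ ρ_B: the X_{B'} part
commutes with O, the X_B part with ρ_B. Only the P term survives, and |Tr Y[P,σ]|² is at most F
times the mean square disturbance.

For unit vectors u, v with Pu = u, Pv = 0, using σ on the superpositions (u ± cv)/√2 with a suitable
phase c turns the left side into |⟨v|Y|u⟩|². With O the Heisenberg-picture image of P under a
recovery map, the disturbance at u and v is at most the probability that the recovery gives the
wrong answer (`sq_norm_chargeChange_le`, `meanSqDisturbance_le`). Summing over eigenvectors of the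
positive and negative parts of ρ_k - ρ_k' produces the trace in 𝒞². The wrong-answer probabilities
are controlled by D_F in general and by D_F² for orthogonal states, which gives the two powers;
averaging over pairs gives `tradeoff`.

For erasure, resetting the lost site to τ after it was reset to an eigenvector gives the erasure
with τ. A recovery for the latter thus yields one for the former with the same error, and the bound
for the covariant noise transfers.

Realizations exist because covariance, once differentiated, says that the Choi matrix commutes with
-X_Aᵀ ⊗ 1 + 1 ⊗ X_{A'}. Its square root then commutes too, and the columns of the root are Kraus
operators obeying a charge balance (`exists_symmetricKraus`). Such a family is dilated by a
reflection that exchanges two orthogonal charge-intertwining isometries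
(`SymmetricKraus.realization`).

For the explicit bound, the natural Kraus family of the erasure gives Y = X_L/N + const, hence 𝒞 =
Δ_{X_L}/(2√2 N) on the two-state ensemble. In its dilation the loss acts on the initial states as
the charge carried off by the environment, so Δ ≤ 2 max Δ_{X_{P_i}}. -/

theorem exists_eq_mul_conjTranspose {n : Type*} [Fintype n] [DecidableEq n] {A : Matrix n n ℂ}
    (hA : A.PosSemidef) : ∃ B : Matrix n n ℂ, A = B * Bᴴ := by
  open scoped MatrixOrder Matrix.Norms.L2Operator in
  obtain ⟨B, hB⟩ := CStarAlgebra.nonneg_iff_eq_mul_star_self.1 hA.nonneg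
  exact ⟨B, hB⟩

theorem trace_mul_nonneg {n : Type*} [Fintype n] [DecidableEq n] {A B : Matrix n n ℂ}
    (hA : A.PosSemidef) (hB : B.PosSemidef) : 0 ≤ (A * B).trace.re := by
  obtain ⟨C, rfl⟩ := exists_eq_mul_conjTranspose hA
  rw [Matrix.mul_assoc, Matrix.trace_mul_comm]
  exact (Complex.le_def.1 (hB.conjTranspose_mul_mul_same C).trace_nonneg).1

theorem trace_mul_mono {n : Type*} [Fintype n] [DecidableEq n] {A B B' : Matrix n n ℂ}
    (hA : A.PosSemidef) (hB : (B' - B).PosSemidef) :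
    (A * B).trace.re ≤ (A * B').trace.re := by
  have := trace_mul_nonneg hA hB
  rw [Matrix.mul_sub, trace_sub, Complex.sub_re] at this
  linarith

theorem re_trace_conjTranspose_mul_self {m n : Type*} [Fintype m] [Fintype n]
    (X : Matrix m n ℂ) : (Xᴴ * X).trace.re = ∑ i, ∑ j, ‖X j i‖ ^ 2 := by
  simp only [Matrix.trace, Matrix.diag_apply, Matrix.mul_apply, Matrix.conjTranspose_apply,
    Complex.re_sum]
  refine Finset.sum_congr rfl fun i _ => Finset.sum_congr rfl fun j _ => ?_
  rw [Complex.star_def, ← Complex.normSq_eq_conj_mul_self, Complex.ofReal_re,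
    Complex.normSq_eq_norm_sq]

theorem re_trace_conjTranspose_mul_self_nonneg {m n : Type*} [Fintype m] [Fintype n]
    (X : Matrix m n ℂ) : 0 ≤ (Xᴴ * X).trace.re := by
  rw [re_trace_conjTranspose_mul_self]
  positivity

/-- The Cauchy–Schwarz inequality for the Hilbert–Schmidt inner product. -/
theorem sq_norm_trace_conjTranspose_mul_le {m n : Type*} [Fintype m] [Fintype n]
    (X Y : Matrix m n ℂ) :
    ‖(Xᴴ * Y).trace‖ ^ 2 ≤ (Xᴴ * X).trace.re * (Yᴴ * Y).trace.re := by
  rw [re_trace_conjTranspose_mul_self, re_trace_conjTranspose_mul_self]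
  simp only [Matrix.trace, Matrix.diag_apply, Matrix.mul_apply, Matrix.conjTranspose_apply]
  rw [← Fintype.sum_prod_type' (f := fun i j => star (X j i) * Y j i),
    ← Fintype.sum_prod_type' (f := fun i j => ‖X j i‖ ^ 2),
    ← Fintype.sum_prod_type' (f := fun i j => ‖Y j i‖ ^ 2)]
  refine le_trans ?_ (Finset.sum_mul_sq_le_sq_mul_sq _ _ _)
  gcongr
  refine (norm_sum_le _ _).trans (le_of_eq ?_)
  simp

/-- Writing ρ = CC† turns this into Cauchy–Schwarz for AC and BC. -/
theorem sq_norm_trace_mul_le {n : Type*} [Fintype n] [DecidableEq n] {ρ : Matrix n n ℂ}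
    (hρ : ρ.PosSemidef) (A B : Matrix n n ℂ) :
    ‖(ρ * (Aᴴ * B)).trace‖ ^ 2
      ≤ (ρ * (Aᴴ * A)).trace.re * (ρ * (Bᴴ * B)).trace.re := by
  obtain ⟨C, rfl⟩ := exists_eq_mul_conjTranspose hρ
  have h : ∀ A B : Matrix n n ℂ,
      (C * Cᴴ * (Aᴴ * B)).trace = ((A * C)ᴴ * (B * C)).trace := by
    intro A B
    rw [Matrix.mul_assoc, Matrix.trace_mul_comm, conjTranspose_mul]
    simp only [Matrix.mul_assoc]
  rw [h, h, h]
  exact sq_norm_trace_conjTranspose_mul_le _ _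

theorem trace_mul_sq_nonneg {n : Type*} [Fintype n] [DecidableEq n] {ρ A : Matrix n n ℂ}
    (hρ : ρ.PosSemidef) (hA : A.IsHermitian) : 0 ≤ (ρ * (A * A)).trace.re := by
  refine trace_mul_nonneg hρ ?_
  nth_rw 1 [← hA.eq]
  exact posSemidef_conjTranspose_mul_self A

theorem norm_trace_mul_le {n : Type*} [Fintype n] [DecidableEq n] {ρ A B : Matrix n n ℂ}
    (hρ : ρ.PosSemidef) (hA : A.IsHermitian) (hB : B.IsHermitian) :
    ‖(ρ * (A * B)).trace‖
      ≤ √((ρ * (A * A)).trace.re * (ρ * (B * B)).trace.re) := by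
  refine Real.le_sqrt_of_sq_le ?_
  have := sq_norm_trace_mul_le hρ A B
  rwa [hA.eq, hB.eq] at this

/-! ### The quantum Fisher information -/

/-- This is the defining equation of the logarithmic derivative, multiplied by D and traced. -/
theorem trace_commutator_eq {n : Type*} [Fintype n] {ρ X L D : Matrix n n ℂ}
    (hL : IsSLD ρ X L) :
    (2 * Complex.I) * (ρ * (X * D - D * X)).trace
      = (ρ * (D * L)).trace + (ρ * (L * D)).trace := by
  have h := congrArg (fun M => (M * D).trace) hL.2
  simp only [Matrix.add_mul, Matrix.sub_mul, Matrix.smul_mul, trace_add, trace_sub, trace_smul,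
    smul_eq_mul, Matrix.mul_assoc] at h
  rw [Matrix.trace_mul_comm L, Matrix.trace_mul_comm X] at h
  simp only [Matrix.mul_assoc] at h
  rw [h, Matrix.mul_sub, trace_sub]

/-- A Robertson-type relation: the factor 2 in front of the commutator is absorbed by the two terms
Tr ρDL and Tr ρLD, each bounded by Cauchy–Schwarz. -/
theorem sq_norm_trace_commutator_le {n : Type*} [Fintype n] [DecidableEq n]
    {ρ X D : Matrix n n ℂ} (hρ : ρ.PosSemidef) (hX : X.IsHermitian) (hD : D.IsHermitian) :
    ‖(ρ * (X * D - D * X)).trace‖ ^ 2 ≤ qfi ρ X * (ρ * (D * D)).trace.re := by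
  obtain ⟨L, hL⟩ := exists_sld hρ hX
  have h := congrArg norm (trace_commutator_eq (D := D) hL)
  have h1 := norm_trace_mul_le hρ hL.1 hD
  have h2 := norm_trace_mul_le hρ hD hL.1
  have h3 := norm_add_le (ρ * (D * L)).trace (ρ * (L * D)).trace
  rw [← h, mul_comm (ρ * (D * D)).trace.re] at *
  simp only [norm_mul, Complex.norm_ofNat, Complex.norm_I, mul_one] at h3
  rw [qfi_eq hL]
  have h4 : ‖(ρ * (X * D - D * X)).trace‖
      ≤ √((ρ * (L * L)).trace.re * (ρ * (D * D)).trace.re) := by linarith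
  refine (pow_le_pow_left₀ (norm_nonneg _) h4 2).trans (le_of_eq (Real.sq_sqrt ?_))
  exact mul_nonneg (trace_mul_sq_nonneg hρ hL.1) (trace_mul_sq_nonneg hρ hD)

theorem qfi_nonneg {n : Type*} [Fintype n] [DecidableEq n] {ρ X : Matrix n n ℂ}
    (hρ : ρ.PosSemidef) (hX : X.IsHermitian) : 0 ≤ qfi ρ X := by
  obtain ⟨L, hL⟩ := exists_sld hρ hX
  rw [qfi_eq hL]
  exact trace_mul_sq_nonneg hρ hL.1

/-- The Fisher information is at most four times the second moment about any point. -/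
theorem qfi_le {n : Type*} [Fintype n] [DecidableEq n] {ρ X : Matrix n n ℂ}
    (hρ : ρ.PosSemidef) (hX : X.IsHermitian) (c : ℝ) :
    qfi ρ X ≤ 4 * (ρ * ((X - (c : ℂ) • 1) * (X - (c : ℂ) • 1))).trace.re := by
  obtain ⟨L, hL⟩ := exists_sld hρ hX
  rw [qfi_eq hL]
  set X' := X - (c : ℂ) • (1 : Matrix n n ℂ) with hX'
  have hX'H : X'.IsHermitian := hX.sub (by
    rw [IsHermitian, conjTranspose_smul, conjTranspose_one, Complex.star_def, Complex.conj_ofReal])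
  -- The logarithmic derivative depends on X only through its commutator with ρ, so a scalar shift
  -- is harmless.
  have hL' : IsSLD ρ X' L := by
    refine ⟨hL.1, hL.2.trans ?_⟩
    congr 1
    rw [hX', Matrix.mul_sub, Matrix.sub_mul]
    simp
  set f := (ρ * (L * L)).trace.re
  set v := (ρ * (X' * X')).trace.re
  have hf : 0 ≤ f := trace_mul_sq_nonneg hρ hL.1
  have hv : 0 ≤ v := trace_mul_sq_nonneg hρ hX'H
  have h := congrArg norm (trace_commutator_eq (D := L) hL')
  have h1 := norm_trace_mul_le hρ hL.1 hX'H
  have h2 := norm_trace_mul_le hρ hX'H hL.1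
  have h3 := norm_sub_le (ρ * (X' * L)).trace (ρ * (L * X')).trace
  rw [← trace_sub, ← Matrix.mul_sub] at h3
  have h4 : 2 * f ≤ ‖(ρ * (L * L)).trace + (ρ * (L * L)).trace‖ := by
    refine le_trans (le_of_eq ?_) (Complex.re_le_norm _)
    rw [Complex.add_re]; ring
  rw [← h] at h4
  simp only [norm_mul, Complex.norm_ofNat, Complex.norm_I, mul_one] at h4
  change _ ≤ √(f * v) at h1
  change _ ≤ √(v * f) at h2
  rw [mul_comm v f] at h2
  have h5 : f ≤ 2 * √(f * v) := by linarith
  have h6 : f ^ 2 ≤ (2 * √(f * v)) ^ 2 := pow_le_pow_left₀ hf h5 2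
  rw [mul_pow, Real.sq_sqrt (mul_nonneg hf hv)] at h6
  -- From f² ≤ 4fv one may cancel f only when it is nonzero.
  rcases hf.eq_or_lt with h0 | h0
  · rw [← h0]; positivity
  · nlinarith

/-! ### Functional calculus of matrices -/

theorem posSemidef_of_idempotent {n : Type*} [Fintype n] {P : Matrix n n ℂ}
    (hP : P.IsHermitian) (hPP : P * P = P) :
    P.PosSemidef := by
  rw [← hPP]
  nth_rw 1 [← hP.eq]
  exact posSemidef_conjTranspose_mul_self P

theorem isHermitian_one_sub {n : Type*} [DecidableEq n] {P : Matrix n n ℂ}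
    (hP : P.IsHermitian) : (1 - P).IsHermitian :=
  isHermitian_one.sub hP

section Calculus

variable {n : Type*} [Fintype n] [DecidableEq n]

/-- The spectrum is finite, so discontinuous functions such as indicators are admissible in the
functional calculus below. -/
theorem continuousOn_spectrum (A : Matrix n n ℂ) (f : ℝ → ℝ) :
    ContinuousOn f (spectrum ℝ A) :=
  A.finite_real_spectrum.continuousOn f

theorem cfc_mul_cfc (A : Matrix n n ℂ) (f g : ℝ → ℝ) :
    cfc f A * cfc g A = cfc (fun x => f x * g x) A :=
  (cfc_mul f g A (continuousOn_spectrum A f) (continuousOn_spectrum A g)).symm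

theorem isHermitian_cfc (A : Matrix n n ℂ) (f : ℝ → ℝ) : (cfc f A).IsHermitian :=
  cfc_predicate f A

theorem posSemidef_cfc (A : Matrix n n ℂ) {f : ℝ → ℝ} (hf : ∀ x ∈ spectrum ℝ A, 0 ≤ f x) :
    (cfc f A).PosSemidef := by
  open scoped MatrixOrder in
  exact (cfc_nonneg hf).posSemidef

theorem cfc_self {A : Matrix n n ℂ} (hA : A.IsHermitian) : cfc (fun x : ℝ => x) A = A :=
  cfc_id' ℝ A hA

theorem PosSemidef.spectrum_nonneg {A : Matrix n n ℂ} (hA : A.PosSemidef) :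
    ∀ x ∈ spectrum ℝ A, 0 ≤ x := by
  intro x hx
  rw [hA.1.spectrum_real_eq_range_eigenvalues] at hx
  obtain ⟨i, rfl⟩ := hx
  exact hA.eigenvalues_nonneg i

theorem cfc_sqrt_mul_self {A : Matrix n n ℂ} (hA : A.PosSemidef) :
    cfc Real.sqrt A * cfc Real.sqrt A = A := by
  rw [cfc_mul_cfc, cfc_congr (g := fun x => x)
    (fun x hx => Real.mul_self_sqrt (PosSemidef.spectrum_nonneg hA x hx))]
  exact cfc_self hA.1

theorem one_sub_mul_self {P : Matrix n n ℂ} (hPP : P * P = P) :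
    (1 - P) * (1 - P) = 1 - P := by
  simp [Matrix.sub_mul, Matrix.mul_sub, hPP]

end Calculus

/-! ### The fidelity and binary measurements -/

section Fidelity

variable {n : Type*} [Fintype n] [DecidableEq n]

/-- The partial isometry of the polar decomposition. -/
theorem exists_polar (A : Matrix n n ℂ) :
    ∃ W : Matrix n n ℂ, W * A = cfc Real.sqrt (Aᴴ * A) ∧ (1 - Wᴴ * W).PosSemidef := by
  have hH : (Aᴴ * A).PosSemidef := posSemidef_conjTranspose_mul_self A
  set H := Aᴴ * A with hHdef
  -- The inverse square root on the support of A†A and zero on its kernel; g(A†A)A† is then a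
  -- partial isometry even for singular A.
  set g : ℝ → ℝ := fun x => if 0 < x then (√x)⁻¹ else 0 with hg
  have hid : cfc (fun x : ℝ => x) H = H := cfc_self hH.1
  have hG : (cfc g H)ᴴ = cfc g H := (isHermitian_cfc H g).eq
  refine ⟨cfc g H * Aᴴ, ?_, ?_⟩
  · rw [Matrix.mul_assoc, ← hHdef]
    nth_rw 2 [← hid]
    rw [cfc_mul_cfc]
    refine cfc_congr fun x hx => ?_
    have hx0 : 0 ≤ x := PosSemidef.spectrum_nonneg hH x hx
    rcases hx0.eq_or_lt with h | h
    · simp [hg, ← h]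
    · simp only [hg, h, if_true]
      rw [inv_mul_eq_div, Real.div_sqrt]
  · have hE : cfc g H * H * cfc g H * cfc g H = cfc g H := by
      nth_rw 2 [← hid]
      rw [cfc_mul_cfc, cfc_mul_cfc, cfc_mul_cfc]
      refine cfc_congr fun x _ => ?_
      by_cases h : 0 < x
      · simp only [hg, h, if_true]
        have h' : √x ≠ 0 := (Real.sqrt_pos.2 h).ne'
        field_simp
        exact (Real.sq_sqrt h.le).symm
      · simp [hg, h]
    have hW : (cfc g H * Aᴴ)ᴴ = A * cfc g H := by
      rw [conjTranspose_mul, conjTranspose_conjTranspose, hG]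
    rw [hW]
    refine posSemidef_of_idempotent (isHermitian_one_sub ?_) (one_sub_mul_self ?_)
    · rw [IsHermitian, conjTranspose_mul, conjTranspose_mul, conjTranspose_mul,
        conjTranspose_conjTranspose, hG]
    · calc A * cfc g H * (cfc g H * Aᴴ) * (A * cfc g H * (cfc g H * Aᴴ))
          = A * cfc g H * (cfc g H * H * cfc g H * cfc g H) * Aᴴ := by
            rw [hHdef]; simp only [Matrix.mul_assoc]
        _ = A * cfc g H * (cfc g H * Aᴴ) := by rw [hE]; simp only [Matrix.mul_assoc]

theorem fidelity_nonneg (ρ σ : Matrix n n ℂ) : 0 ≤ fidelity ρ σ :=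
  (Complex.le_def.1 (posSemidef_cfc _ fun x _ => Real.sqrt_nonneg x).trace_nonneg).1

/-- Monotonicity of the fidelity under a two-outcome measurement. By polar decomposition F = Tr
W√σ√ρ with a contraction W; inserting 1 = P + (1 - P) between the roots and applying Cauchy–Schwarz
to each term gives the classical fidelity of the outcomes. -/
theorem fidelity_le {ρ σ P : Matrix n n ℂ} (hρ : ρ.PosSemidef) (hσ : σ.PosSemidef)
    (hP : P.IsHermitian) (hPP : P * P = P) :
    fidelity ρ σ ≤ √((P * σ).trace.re * (P * ρ).trace.re)
      + √(((1 - P) * σ).trace.re * ((1 - P) * ρ).trace.re) := by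
  set r := cfc Real.sqrt ρ with hr
  set s := cfc Real.sqrt σ with hs
  have hrr : r * r = ρ := cfc_sqrt_mul_self hρ
  have hss : s * s = σ := cfc_sqrt_mul_self hσ
  have hrH : rᴴ = r := (isHermitian_cfc _ _).eq
  have hsH : sᴴ = s := (isHermitian_cfc _ _).eq
  obtain ⟨W, hWA, hW⟩ := exists_polar (s * r)
  have hH : (s * r)ᴴ * (s * r) = r * σ * r := by
    rw [conjTranspose_mul, hrH, hsH, ← hss]; simp only [Matrix.mul_assoc]
  have hF : fidelity ρ σ = (W * (s * r)).trace.re := by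
    rw [hWA, hH, fidelity]
  have key : ∀ Q : Matrix n n ℂ, Q.IsHermitian → Q * Q = Q →
      (W * (s * Q * r)).trace.re ≤ √((Q * σ).trace.re * (Q * ρ).trace.re) := by
    intro Q hQ hQQ
    refine (Complex.re_le_norm _).trans (Real.le_sqrt_of_sq_le ?_)
    have h := sq_norm_trace_conjTranspose_mul_le (Q * s * Wᴴ) (Q * r)
    have e1 : (Q * s * Wᴴ)ᴴ * (Q * r) = W * (s * Q * r) := by
      rw [conjTranspose_mul, conjTranspose_mul, conjTranspose_conjTranspose, hsH, hQ.eq]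
      calc W * (s * Q) * (Q * r) = W * (s * (Q * Q) * r) := by simp only [Matrix.mul_assoc]
        _ = _ := by rw [hQQ]
    have e2 : ((Q * r)ᴴ * (Q * r)).trace = (Q * ρ).trace := by
      rw [conjTranspose_mul, hrH, hQ.eq, ← hrr, Matrix.mul_assoc, Matrix.trace_mul_comm]
      calc (Q * (Q * r) * r).trace = ((Q * Q) * (r * r)).trace := by simp only [Matrix.mul_assoc]
        _ = _ := by rw [hQQ]
    have e3 : ((Q * s * Wᴴ)ᴴ * (Q * s * Wᴴ)).trace = (((Q * s)ᴴ * (Q * s)) * (Wᴴ * W)).trace := by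
      rw [conjTranspose_mul, conjTranspose_conjTranspose, Matrix.mul_assoc, Matrix.trace_mul_comm]
      simp only [Matrix.mul_assoc]
    have e4 : (((Q * s)ᴴ * (Q * s)) * (1 : Matrix n n ℂ)).trace = (Q * σ).trace := by
      rw [Matrix.mul_one, conjTranspose_mul, hsH, hQ.eq, ← hss, Matrix.mul_assoc,
        Matrix.trace_mul_comm]
      calc (Q * (Q * s) * s).trace = ((Q * Q) * (s * s)).trace := by simp only [Matrix.mul_assoc]
        _ = _ := by rw [hQQ]
    rw [e1, e2, e3] at h
    refine h.trans (mul_le_mul_of_nonneg_right ?_ ?_)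
    · rw [← e4]
      exact trace_mul_mono (posSemidef_conjTranspose_mul_self _) hW
    · rw [← e2]
      exact re_trace_conjTranspose_mul_self_nonneg _
  have hsplit : W * (s * r) = W * (s * P * r) + W * (s * (1 - P) * r) := by
    rw [← Matrix.mul_add, ← Matrix.add_mul, ← Matrix.mul_add]
    simp
  rw [hF, hsplit, trace_add, Complex.add_re]
  exact add_le_add (key P hP hPP) (key _ (isHermitian_one_sub hP) (one_sub_mul_self hPP))

theorem trace_projection_mem {ρ P : Matrix n n ℂ} (hρ : IsState ρ) (hP : P.IsHermitian)
    (hPP : P * P = P) :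
    0 ≤ (P * ρ).trace.re ∧ 0 ≤ 1 - (P * ρ).trace.re
      ∧ ((1 - P) * ρ).trace.re = 1 - (P * ρ).trace.re := by
  have h : ((1 - P) * ρ).trace.re = 1 - (P * ρ).trace.re := by
    rw [Matrix.sub_mul, Matrix.one_mul, trace_sub, hρ.2, Complex.sub_re, Complex.one_re]
  refine ⟨trace_mul_nonneg (posSemidef_of_idempotent hP hPP) hρ.1, ?_, h⟩
  rw [← h]
  exact trace_mul_nonneg (posSemidef_of_idempotent (isHermitian_one_sub hP)
    (one_sub_mul_self hPP)) hρ.1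

/-- The real square root is truncated at 0, so this direction needs no proof that F ≤ 1. -/
theorem one_sub_fidelity_sq_le (ρ σ : Matrix n n ℂ) :
    1 - fidelity ρ σ ^ 2 ≤ purifiedDistance ρ σ ^ 2 := by
  rw [purifiedDistance, Real.sq_sqrt']
  exact le_max_left _ _

/-- One of the Fuchs–van de Graaf inequalities. -/
theorem trace_projection_sub_le {ρ σ P : Matrix n n ℂ} (hρ : IsState ρ) (hσ : IsState σ)
    (hP : P.IsHermitian) (hPP : P * P = P) :
    (P * (ρ - σ)).trace.re ≤ purifiedDistance ρ σ := by
  obtain ⟨a0, a1, ha⟩ := trace_projection_mem hρ hP hPP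
  obtain ⟨b0, b1, hb⟩ := trace_projection_mem hσ hP hPP
  have hF := fidelity_le hρ.1 hσ.1 hP hPP
  rw [ha, hb] at hF
  rw [Matrix.mul_sub, trace_sub, Complex.sub_re, purifiedDistance]
  set a := (P * ρ).trace.re
  set b := (P * σ).trace.re
  refine Real.le_sqrt_of_sq_le ?_
  have hF2 := pow_le_pow_left₀ (fidelity_nonneg ρ σ) hF 2
  rw [Real.sqrt_mul b0, Real.sqrt_mul b1] at hF2
  have sa := Real.sq_sqrt a0
  have sb := Real.sq_sqrt b0
  have sa' := Real.sq_sqrt a1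
  have sb' := Real.sq_sqrt b1
  set u := √a
  set v := √b
  set u' := √(1 - a)
  set v' := √(1 - b)
  have h0 : 0 ≤ (u * u' - v * v') ^ 2 := sq_nonneg _
  -- For two-point distributions the gap in the Fuchs–van de Graaf inequality is a perfect square.
  have e : (u * u' - v * v') ^ 2 = 1 - (a - b) ^ 2 - (v * u + v' * u') ^ 2 := by
    have h1 : (u * u' - v * v') ^ 2
        = u ^ 2 * u' ^ 2 + v ^ 2 * v' ^ 2 - 2 * (u * u' * v * v') := by ring
    have h2 : (v * u + v' * u') ^ 2
        = v ^ 2 * u ^ 2 + v' ^ 2 * u' ^ 2 + 2 * (u * u' * v * v') := by ring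
    rw [h1, h2, sa, sb, sa', sb']
    ring
  linarith

/-- When ρ gives the outcome P with certainty, only one term of `fidelity_le` remains and F² ≤ Tr
Pσ. The resulting bound is quadratic in D_F, which is what improves the orthogonal case. -/
theorem one_sub_trace_projection_le {ρ σ P : Matrix n n ℂ} (hρ : IsState ρ) (hσ : IsState σ)
    (hP : P.IsHermitian) (hPP : P * P = P) (hPρ : P * ρ = ρ) :
    1 - (P * σ).trace.re ≤ purifiedDistance ρ σ ^ 2 := by
  obtain ⟨b0, b1, hb⟩ := trace_projection_mem hσ hP hPP
  have hF := fidelity_le hρ.1 hσ.1 hP hPP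
  rw [Matrix.sub_mul 1 P ρ, hPρ, hρ.2, Matrix.one_mul, sub_self] at hF
  simp only [Complex.one_re, mul_one, trace_zero, Complex.zero_re, mul_zero, Real.sqrt_zero,
    add_zero] at hF
  have hF2 := pow_le_pow_left₀ (fidelity_nonneg ρ σ) hF 2
  rw [Real.sq_sqrt b0] at hF2
  linarith [one_sub_fidelity_sq_le ρ σ]

theorem trace_projection_le {ρ σ P : Matrix n n ℂ} (hρ : IsState ρ) (hσ : IsState σ)
    (hP : P.IsHermitian) (hPP : P * P = P) (hPρ : P * ρ = 0) :
    (P * σ).trace.re ≤ purifiedDistance ρ σ ^ 2 := by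
  have h := one_sub_trace_projection_le hρ hσ (isHermitian_one_sub hP) (one_sub_mul_self hPP)
    (by rw [Matrix.sub_mul, hPρ, Matrix.one_mul, sub_zero])
  rw [(trace_projection_mem hσ hP hPP).2.2] at h
  linarith

/-- States with vanishing fidelity have a vanishing product. -/
theorem mul_eq_zero_of_fidelity {ρ σ : Matrix n n ℂ} (hρ : ρ.PosSemidef) (hσ : σ.PosSemidef)
    (h : fidelity ρ σ = 0) : ρ * σ = 0 := by
  set r := cfc Real.sqrt ρ with hr
  set s := cfc Real.sqrt σ with hs
  have hrr : r * r = ρ := cfc_sqrt_mul_self hρ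
  have hss : s * s = σ := cfc_sqrt_mul_self hσ
  have hrH : rᴴ = r := (isHermitian_cfc _ _).eq
  have hsH : sᴴ = s := (isHermitian_cfc _ _).eq
  have hH : (s * r)ᴴ * (s * r) = r * σ * r := by
    rw [conjTranspose_mul, hrH, hsH, ← hss]; simp only [Matrix.mul_assoc]
  have hK : (r * σ * r).PosSemidef := hH ▸ posSemidef_conjTranspose_mul_self _
  have hT : (cfc Real.sqrt (r * σ * r)).PosSemidef :=
    posSemidef_cfc _ fun x _ => Real.sqrt_nonneg x
  have h0 : cfc Real.sqrt (r * σ * r) = 0 := by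
    rw [← hT.trace_eq_zero_iff]
    refine Complex.ext h ?_
    exact (Complex.le_def.1 hT.trace_nonneg).2.symm
  have h1 : (s * r)ᴴ * (s * r) = 0 := by
    rw [hH, ← cfc_sqrt_mul_self hK, h0, Matrix.mul_zero]
  have h2 : s * r = 0 := conjTranspose_mul_self_eq_zero.1 h1
  have h3 : r * s = 0 := by
    rw [← hrH, ← hsH, ← conjTranspose_mul, h2, conjTranspose_zero]
  calc ρ * σ = r * (r * s) * s := by rw [← hrr, ← hss]; simp only [Matrix.mul_assoc]
    _ = 0 := by simp [h3]

/-- The support projection of ρ distinguishes the two operators perfectly, so both terms of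
`fidelity_le` vanish. -/
theorem fidelity_eq_zero_of_mul {ρ σ : Matrix n n ℂ} (hρ : ρ.PosSemidef) (hσ : σ.PosSemidef)
    (h : ρ * σ = 0) : fidelity ρ σ = 0 := by
  have hP : ∃ P : Matrix n n ℂ, P.IsHermitian ∧ P * P = P ∧ P * ρ = ρ ∧ P * σ = 0 := by
    set g : ℝ → ℝ := fun x => if x = 0 then 0 else 1
    refine ⟨cfc g ρ, isHermitian_cfc _ _, ?_, ?_, ?_⟩
    · rw [cfc_mul_cfc]
      exact cfc_congr fun x _ => by by_cases h : x = 0 <;> simp [g, h]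
    · nth_rw 2 3 [← cfc_self hρ.1]
      rw [cfc_mul_cfc]
      exact cfc_congr fun x _ => by by_cases h : x = 0 <;> simp [g, h]
    · have : cfc g ρ = cfc (fun x : ℝ => x⁻¹) ρ * ρ := by
        nth_rw 3 [← cfc_self hρ.1]
        rw [cfc_mul_cfc]
        exact cfc_congr fun x _ => by by_cases h : x = 0 <;> simp [g, h]
      rw [this, Matrix.mul_assoc, h, Matrix.mul_zero]
  obtain ⟨P, hP, hPP, h1, h2⟩ := hP
  have := fidelity_le hρ hσ hP hPP
  rw [Matrix.sub_mul 1 P ρ, h1, h2] at this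
  simp at this
  exact le_antisymm this (fidelity_nonneg _ _)

end Fidelity

/-! ### Positive and negative parts -/

section Parts

variable {n : Type*} [Fintype n] [DecidableEq n]

theorem posSemidef_pos (A : Matrix n n ℂ) : (pos A).PosSemidef :=
  posSemidef_cfc _ fun _ _ => le_max_right _ _

theorem posSemidef_neg (A : Matrix n n ℂ) : (neg A).PosSemidef :=
  posSemidef_cfc _ fun _ _ => le_max_right _ _

theorem pos_sub_neg {A : Matrix n n ℂ} (hA : A.IsHermitian) : pos A - neg A = A := by
  rw [pos, neg, ← cfc_sub _ _ A (continuousOn_spectrum _ _) (continuousOn_spectrum _ _)]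
  nth_rw 2 [← cfc_self hA]
  refine cfc_congr fun x _ => ?_
  rcases le_total x 0 with h | h <;> simp [h]

/-- The left factor A keeps the range of the positive part inside the range of A, hence inside the
span of the supports of the test states. The negative part is treated likewise. -/
theorem pos_eq_mul {A : Matrix n n ℂ} (hA : A.IsHermitian) : ∃ B, pos A = A * B := by
  refine ⟨cfc (fun x : ℝ => if 0 < x then 1 else 0) A, ?_⟩
  nth_rw 2 [← cfc_self hA]
  rw [cfc_mul_cfc, pos]
  refine cfc_congr fun x _ => ?_
  by_cases h : 0 < x
  · simp [h, h.le]
  · simp [h, not_lt.1 h]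

theorem neg_eq_mul {A : Matrix n n ℂ} (hA : A.IsHermitian) : ∃ B, neg A = A * B := by
  refine ⟨cfc (fun x : ℝ => if x < 0 then -1 else 0) A, ?_⟩
  nth_rw 2 [← cfc_self hA]
  rw [cfc_mul_cfc, neg]
  refine cfc_congr fun x _ => ?_
  by_cases h : x < 0
  · simp [h, h.le]
  · simp [h, not_lt.1 h]

theorem exists_projection_pos (A : Matrix n n ℂ) :
    ∃ P : Matrix n n ℂ, P.IsHermitian ∧ P * P = P ∧ P * pos A = pos A ∧ P * neg A = 0 := by
  refine ⟨cfc (fun x : ℝ => if 0 < x then 1 else 0) A, isHermitian_cfc _ _, ?_, ?_, ?_⟩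
  · rw [cfc_mul_cfc]
    exact cfc_congr fun x _ => by by_cases h : 0 < x <;> simp [h]
  · rw [pos, cfc_mul_cfc]
    refine cfc_congr fun x _ => ?_
    by_cases h : 0 < x
    · simp [h]
    · simp [h, not_lt.1 h]
  · rw [neg, cfc_mul_cfc, ← cfc_zero ℝ A]
    refine cfc_congr fun x _ => ?_
    by_cases h : 0 < x
    · simp [h.le]
    · simp [h]

/-- Uniqueness of the Jordan decomposition. For orthogonal test states the parts of the difference
are therefore the states themselves. -/
theorem pos_neg_of_mul_eq_zero {B C : Matrix n n ℂ} (hB : B.PosSemidef) (hC : C.PosSemidef)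
    (h : B * C = 0) : pos (B - C) = B ∧ neg (B - C) = C := by
  open scoped MatrixOrder Matrix.Norms.L2Operator in
  obtain ⟨h1, h2⟩ := CFC.posPart_negPart_unique (a := B - C) rfl h hB.nonneg hC.nonneg
  have hfin : ∀ A : Matrix n n ℂ, (quasispectrum ℝ A).Finite := fun A => by
    rw [quasispectrum_eq_spectrum_union_zero]
    exact A.finite_real_spectrum.union (Set.finite_singleton 0)
  refine ⟨?_, ?_⟩
  · nth_rw 2 [← h1]
    rw [CFC.posPart_def, cfcₙ_eq_cfc (hf := (hfin _).continuousOn _) (hf0 := by simp)]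
    rfl
  · nth_rw 2 [← h2]
    rw [CFC.negPart_def, cfcₙ_eq_cfc (hf := (hfin _).continuousOn _) (hf0 := by simp)]
    rfl

end Parts

/-! ### Rank-one operators and spectral decompositions -/

section RankOne

variable {n : Type*} [Fintype n]

theorem posSemidef_proj (v : n → ℂ) : (proj v).PosSemidef := posSemidef_vecMulVec_self_star v

theorem mul_proj {m : Type*} (M : Matrix m n ℂ) (v : n → ℂ) :
    M * proj v = vecMulVec (M *ᵥ v) (star v) := mul_vecMulVec _ _ _

theorem proj_mul {m : Type*} (M : Matrix n m ℂ) (v : n → ℂ) :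
    proj v * M = vecMulVec v (star v ᵥ* M) := vecMulVec_mul _ _ _

theorem trace_proj (v : n → ℂ) : (proj v).trace = star v ⬝ᵥ v := by
  rw [proj, trace_vecMulVec, dotProduct_comm]

theorem trace_mul_vecMulVec (M : Matrix n n ℂ) (v w : n → ℂ) :
    (M * vecMulVec v w).trace = w ⬝ᵥ M *ᵥ v := by
  rw [mul_vecMulVec, trace_vecMulVec, dotProduct_comm]

theorem isState_proj {v : n → ℂ} (hv : IsUnitVec v) : IsState (proj v) :=
  ⟨posSemidef_proj v, (trace_proj v).trans hv⟩

theorem proj_mulVec (v w : n → ℂ) : proj v *ᵥ w = (star v ⬝ᵥ w) • v := by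
  rw [proj, vecMulVec_mulVec]
  ext i
  simp [mul_comm]

variable [DecidableEq n]

theorem isUnitVec_eigenvectorBasis {A : Matrix n n ℂ} (hA : A.IsHermitian) (i : n) :
    IsUnitVec (hA.eigenvectorBasis i).ofLp := by
  have h := hA.eigenvectorBasis.inner_eq_one i
  rw [EuclideanSpace.inner_eq_star_dotProduct, dotProduct_comm] at h
  exact h

theorem eq_sum_eigenvalues_smul_proj {A : Matrix n n ℂ} (hA : A.IsHermitian) :
    A = ∑ i, (hA.eigenvalues i : ℂ) • proj (hA.eigenvectorBasis i).ofLp := by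
  conv_lhs => rw [hA.spectral_theorem, Unitary.conjStarAlgAut_apply]
  ext x y
  rw [Matrix.mul_apply, Matrix.sum_apply]
  refine Finset.sum_congr rfl fun i _ => ?_
  rw [Matrix.mul_diagonal, Matrix.star_apply, hA.eigenvectorUnitary_apply,
    hA.eigenvectorUnitary_apply]
  simp only [Function.comp_apply, Matrix.smul_apply, proj, vecMulVec_apply, Pi.star_apply,
    smul_eq_mul]
  change _ * (hA.eigenvalues i : ℂ) * _ = _
  ring

theorem mulVec_eigenvectorBasis' {A : Matrix n n ℂ} (hA : A.IsHermitian) (i : n) :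
    A *ᵥ (hA.eigenvectorBasis i).ofLp
      = (hA.eigenvalues i : ℂ) • (hA.eigenvectorBasis i).ofLp := by
  rw [hA.mulVec_eigenvectorBasis]
  ext x
  simp

theorem posSemidef_of_forall_nonneg {M : Matrix n n ℂ}
    (h : ∀ v : n → ℂ, 0 ≤ star v ⬝ᵥ M *ᵥ v) : M.PosSemidef := by
  rw [← isPositive_toEuclideanLin_iff, LinearMap.isPositive_iff_complex]
  intro v
  have h1 : inner ℂ (toEuclideanLin M v) v = star (star v.ofLp ⬝ᵥ M *ᵥ v.ofLp) := by
    rw [EuclideanSpace.inner_eq_star_dotProduct]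
    simp only [toLpLin_apply]
    rw [star_dotProduct, star_star, dotProduct_comm]
  have h2 := h v.ofLp
  rw [Complex.le_def] at h2
  rw [h1]
  refine ⟨Complex.ext (by simp) ?_, by simpa using h2.1⟩
  simp only [Complex.ofReal_im, Complex.star_def, Complex.conj_im]
  rw [← h2.2]; simp

theorem trace_mul_nonneg' {A B : Matrix n n ℂ} (hA : A.PosSemidef) (hB : B.PosSemidef) :
    0 ≤ (A * B).trace := by
  obtain ⟨C, rfl⟩ := exists_eq_mul_conjTranspose hA
  rw [Matrix.mul_assoc, Matrix.trace_mul_comm]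
  exact (hB.conjTranspose_mul_mul_same C).trace_nonneg

/-- The eigenvalues are nonnegative with sum 1, so none exceeds 1. -/
theorem IsState.one_sub_posSemidef {ρ : Matrix n n ℂ} (hρ : IsState ρ) :
    (1 - ρ).PosSemidef := by
  have hH := hρ.1.1
  have hone : cfc (fun _ : ℝ => (1 : ℝ)) ρ = 1 := cfc_const_one ℝ ρ hH
  have h : 1 - ρ = cfc (fun x : ℝ => 1 - x) ρ := by
    rw [cfc_sub (fun _ : ℝ => (1 : ℝ)) (fun x => x) ρ (continuousOn_spectrum _ _)
      (continuousOn_spectrum _ _), cfc_self hH, hone]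
  rw [h]
  refine posSemidef_cfc _ fun x hx => ?_
  rw [hH.spectrum_real_eq_range_eigenvalues] at hx
  obtain ⟨i, rfl⟩ := hx
  have h1 : ∑ j, hH.eigenvalues j = 1 := by
    have := congrArg Complex.re (hH.trace_eq_sum_eigenvalues.symm.trans hρ.2)
    simpa using this
  have h2 := Finset.single_le_sum (f := hH.eigenvalues) (fun j _ => hρ.1.eigenvalues_nonneg j)
    (Finset.mem_univ i)
  linarith

end RankOne

/-! ### Positive trace preserving maps -/

/-- Positive and trace preserving maps. -/
def IsPTP {a b : Type*} [Fintype a] [Fintype b] (R : Matrix a a ℂ →ₗ[ℂ] Matrix b b ℂ) : Prop :=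
  (∀ M, M.PosSemidef → (R M).PosSemidef) ∧ ∀ M, (R M).trace = M.trace

/-- The trade-off never uses complete positivity of the recovery; one-dimensional amplification
gives the positivity that it does use. -/
theorem IsChannel.isPTP {a b : Type*} [Fintype a] [Fintype b]
    {R : Matrix a a ℂ →ₗ[ℂ] Matrix b b ℂ} (hR : IsChannel R) : IsPTP R := by
  refine ⟨fun M hM => ?_, hR.tracePreserving⟩
  have h := hR.completelyPositive 1 (M.submatrix Prod.snd Prod.snd) (hM.submatrix _)
  exact h.submatrix fun x => ((0 : Fin 1), x)

theorem IsPTP.comp {a b c : Type*} [Fintype a] [Fintype b] [Fintype c]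
    {R : Matrix b b ℂ →ₗ[ℂ] Matrix c c ℂ} {S : Matrix a a ℂ →ₗ[ℂ] Matrix b b ℂ}
    (hR : IsPTP R) (hS : IsPTP S) : IsPTP (R ∘ₗ S) :=
  ⟨fun M hM => hR.1 _ (hS.1 M hM), fun M => (hR.2 _).trans (hS.2 M)⟩

theorem IsPTP.isState {a b : Type*} [Fintype a] [Fintype b]
    {R : Matrix a a ℂ →ₗ[ℂ] Matrix b b ℂ} (hR : IsPTP R) {ρ : Matrix a a ℂ} (hρ : IsState ρ) :
    IsState (R ρ) :=
  ⟨hR.1 _ hρ.1, (hR.2 _).trans hρ.2⟩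

theorem posSemidef_dual {a b : Type*} [Fintype a] [DecidableEq a] [Fintype b] [DecidableEq b]
    {R : Matrix a a ℂ →ₗ[ℂ] Matrix b b ℂ} (hR : IsPTP R) {W : Matrix b b ℂ}
    (hW : W.PosSemidef) : (dual R W).PosSemidef := by
  refine posSemidef_of_forall_nonneg fun v => ?_
  rw [← trace_mul_vecMulVec]
  exact (trace_mul_nonneg' hW (hR.1 _ (posSemidef_proj v))).trans_eq (trace_dual_mul R W _).symm

theorem dual_one {a b : Type*} [Fintype a] [DecidableEq a] [Fintype b] [DecidableEq b]
    {R : Matrix a a ℂ →ₗ[ℂ] Matrix b b ℂ} (hR : IsPTP R) : dual R 1 = 1 := by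
  ext i j
  simp only [dual, Matrix.of_apply, Matrix.one_mul, hR.2, Matrix.one_apply]
  rcases eq_or_ne i j with h | h
  · subst h; simp [Matrix.trace_single_eq_same]
  · rw [Matrix.trace_single_eq_of_ne _ _ _ h.symm, if_neg h]

theorem dual_sub {a b : Type*} [DecidableEq a] [Fintype b]
    (R : Matrix a a ℂ →ₗ[ℂ] Matrix b b ℂ) (W W' : Matrix b b ℂ) :
    dual R (W - W') = dual R W - dual R W' := by
  ext i j
  simp [dual, Matrix.sub_mul, trace_sub]

/-- An effect `Q` satisfies `Q² ≤ Q`. -/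
theorem posSemidef_sub_sq {n : Type*} [Fintype n] [DecidableEq n] {Q : Matrix n n ℂ}
    (h0 : Q.PosSemidef) (h1 : (1 - Q).PosSemidef) : (Q - Q * Q).PosSemidef := by
  have e : Q - Q * Q = Q * (1 - Q) * Qᴴ + (1 - Q) * Q * (1 - Q)ᴴ := by
    rw [h0.1.eq, h1.1.eq]
    noncomm_ring
  rw [e]
  exact (h1.mul_mul_conjTranspose_same Q).add (h0.mul_mul_conjTranspose_same (1 - Q))

/-! ### Partial trace -/

section PartialTrace

variable {a b : Type*} [Fintype a] [Fintype b]

theorem trace_mul_traceSnd [DecidableEq b] (X : Matrix a a ℂ) (M : Matrix (a × b) (a × b) ℂ) :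
    (X * traceSnd M).trace = ((X ⊗ₖ (1 : Matrix b b ℂ)) * M).trace := by
  simp only [Matrix.trace, Matrix.diag_apply, Matrix.mul_apply, traceSnd, Matrix.of_apply,
    Finset.mul_sum, kronecker_apply, Matrix.one_apply, Fintype.sum_prod_type, mul_ite, mul_one,
    mul_zero, ite_mul, zero_mul, Finset.sum_ite_eq, Finset.mem_univ, if_true]
  exact Finset.sum_congr rfl fun i _ => Finset.sum_comm

end PartialTrace

theorem isHermitian_kronecker {m n : Type*} {A : Matrix m m ℂ} {B : Matrix n n ℂ}
    (hA : A.IsHermitian) (hB : B.IsHermitian) : (A ⊗ₖ B).IsHermitian := by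
  rw [IsHermitian, conjTranspose_kronecker, hA.eq, hB.eq]

theorem traceSnd_conjTranspose {a b : Type*} [Fintype b] (M : Matrix (a × b) (a × b) ℂ) :
    traceSnd Mᴴ = (traceSnd M)ᴴ := by
  ext i j; simp [traceSnd]

/-- The probability of the outcome `P` after the recovery `R`. -/
def outcome {a a' : Type*} [Fintype a] (R : Matrix a' a' ℂ →ₗ[ℂ] Matrix a a ℂ)
    (Φ : Matrix a a ℂ →ₗ[ℂ] Matrix a' a' ℂ) (P M : Matrix a a ℂ) : ℝ :=
  (P * R (Φ M)).trace.re

theorem outcome_sub {a a' : Type*} [Fintype a] (R : Matrix a' a' ℂ →ₗ[ℂ] Matrix a a ℂ)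
    (Φ : Matrix a a ℂ →ₗ[ℂ] Matrix a' a' ℂ) (P M M' : Matrix a a ℂ) :
    outcome R Φ P (M - M') = outcome R Φ P M - outcome R Φ P M' := by
  simp [outcome, Matrix.mul_sub, trace_sub]

theorem outcome_sum_smul {ι a a' : Type*} [Fintype ι] [Fintype a]
    (R : Matrix a' a' ℂ →ₗ[ℂ] Matrix a a ℂ) (Φ : Matrix a a ℂ →ₗ[ℂ] Matrix a' a' ℂ)
    (P : Matrix a a ℂ) (r : ι → ℝ) (M : ι → Matrix a a ℂ) :
    outcome R Φ P (∑ i, (r i : ℂ) • M i) = ∑ i, r i * outcome R Φ P (M i) := by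
  simp [outcome, Matrix.mul_sum, trace_sum]

theorem trace_proj_mul_proj_mul {a : Type*} [Fintype a] {Y : Matrix a a ℂ}
    (hY : Y.IsHermitian) (u v : a → ℂ) :
    (proj u * Y * proj v * Y).trace = ((‖star v ⬝ᵥ Y *ᵥ u‖ ^ 2 : ℝ) : ℂ) := by
  have h1 : star u ⬝ᵥ Y *ᵥ v = star (star v ⬝ᵥ Y *ᵥ u) := by
    rw [star_dotProduct, star_mulVec, hY.eq, dotProduct_mulVec]
  rw [Matrix.mul_assoc, proj_mul Y u, proj_mul Y v, vecMulVec_mul_vecMulVec]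
  rw [trace_vecMulVec, dotProduct_smul, ← dotProduct_mulVec, smul_eq_mul, dotProduct_comm u,
    ← dotProduct_mulVec, h1, Complex.star_def, Complex.conj_mul']
  push_cast
  rfl

/-! ### Uncertainty relation between charge loss and disturbance -/

namespace SymmetricRealization

variable {a a' b b' : Type*} [Fintype a] [DecidableEq a] [Fintype a'] [DecidableEq a']
  [Fintype b] [DecidableEq b] [Fintype b'] [DecidableEq b']
  {Φ : Matrix a a ℂ →ₗ[ℂ] Matrix a' a' ℂ} {XA : Matrix a a ℂ} {XA' : Matrix a' a' ℂ}
  (I : SymmetricRealization Φ XA XA' b b')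

/-- The loss of system charge `X_A ⊗ 1 - U†(X_{A'} ⊗ 1)U`. -/
def loss : Matrix (a × b) (a × b) ℂ :=
  XA ⊗ₖ (1 : Matrix b b ℂ) - I.Uᴴ * (XA' ⊗ₖ (1 : Matrix b' b' ℂ)) * I.U

/-- The Heisenberg picture `U†(O ⊗ 1)U` of an observable of the output system. -/
def pullback (O : Matrix a' a' ℂ) : Matrix (a × b) (a × b) ℂ :=
  I.Uᴴ * (O ⊗ₖ (1 : Matrix b' b' ℂ)) * I.U

theorem isHermitian_pullback {O : Matrix a' a' ℂ} (hO : O.IsHermitian) :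
    (I.pullback O).IsHermitian :=
  isHermitian_conjTranspose_mul_mul _ (isHermitian_kronecker hO isHermitian_one)

theorem isHermitian_loss (hXA : XA.IsHermitian) (hXA' : XA'.IsHermitian) :
    I.loss.IsHermitian :=
  (isHermitian_kronecker hXA isHermitian_one).sub (I.isHermitian_pullback hXA')

/-- The conservation law trades the lost system charge for the gained bath charge. This form makes
its commutators with output observables tractable. -/
theorem loss_eq :
    I.loss = I.Uᴴ * ((1 : Matrix a' a' ℂ) ⊗ₖ I.XB') * I.U - (1 : Matrix a a ℂ) ⊗ₖ I.XB := by
  have h := I.conservation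
  rw [Matrix.mul_add, Matrix.add_mul] at h
  rw [loss, sub_eq_sub_iff_add_eq_add, h, add_comm]

theorem pullback_one : I.pullback 1 = 1 := by
  rw [pullback, one_kronecker_one, Matrix.mul_one, I.unitary_left]

theorem pullback_sub (O O' : Matrix a' a' ℂ) :
    I.pullback (O - O') = I.pullback O - I.pullback O' := by
  have h : (O - O') ⊗ₖ (1 : Matrix b' b' ℂ) = O ⊗ₖ 1 - O' ⊗ₖ 1 := by
    ext i j; simp [sub_mul]
  rw [pullback, h, Matrix.mul_sub, Matrix.sub_mul, pullback, pullback]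

theorem posSemidef_pullback {O : Matrix a' a' ℂ} (hO : O.PosSemidef) :
    (I.pullback O).PosSemidef :=
  (hO.kronecker PosSemidef.one).conjTranspose_mul_mul_same _

theorem trace_mul_apply (X : Matrix a' a' ℂ) (M : Matrix a a ℂ) :
    (X * Φ M).trace = (I.pullback X * (M ⊗ₖ I.ρB)).trace := by
  rw [I.realizes, trace_mul_traceSnd, pullback]
  rw [Matrix.mul_assoc I.Uᴴ, Matrix.mul_assoc I.Uᴴ, Matrix.trace_mul_comm I.Uᴴ]
  simp only [Matrix.mul_assoc]

theorem trace_kronecker_one_mul (X M : Matrix a a ℂ) :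
    ((X ⊗ₖ (1 : Matrix b b ℂ)) * (M ⊗ₖ I.ρB)).trace = (X * M).trace := by
  rw [← mul_kronecker_mul, trace_kronecker, Matrix.one_mul, I.isState.2, mul_one]

/-- In other words, Y is the loss averaged over the bath state. -/
theorem trace_chargeChange_mul (M : Matrix a a ℂ) :
    (chargeChange Φ XA XA' * M).trace = (I.loss * (M ⊗ₖ I.ρB)).trace := by
  rw [chargeChange, Matrix.sub_mul, trace_sub, trace_dual_mul, I.trace_mul_apply, loss,
    Matrix.sub_mul, trace_sub, trace_kronecker_one_mul, pullback]

/-- The charge of the bath is conserved by observables of the output system. -/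
theorem trace_commutator_pullback (σ : Matrix a a ℂ) (O : Matrix a' a' ℂ) :
    ((σ ⊗ₖ I.ρB) * (I.loss * I.pullback O - I.pullback O * I.loss)).trace = 0 := by
  have hU := I.unitary_right
  -- The final bath charge and O act on different output factors, so their Heisenberg pictures
  -- commute; the initial bath charge is handled by its commuting with ρ_B.
  have h1 : I.Uᴴ * ((1 : Matrix a' a' ℂ) ⊗ₖ I.XB') * I.U * I.pullback O
      = I.pullback O * (I.Uᴴ * ((1 : Matrix a' a' ℂ) ⊗ₖ I.XB') * I.U) := by
    have e : ((1 : Matrix a' a' ℂ) ⊗ₖ I.XB') * (O ⊗ₖ (1 : Matrix b' b' ℂ))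
        = (O ⊗ₖ (1 : Matrix b' b' ℂ)) * ((1 : Matrix a' a' ℂ) ⊗ₖ I.XB') := by
      rw [← mul_kronecker_mul, ← mul_kronecker_mul]; simp
    calc _ = I.Uᴴ * (((1 : Matrix a' a' ℂ) ⊗ₖ I.XB') * (I.U * I.Uᴴ) *
          (O ⊗ₖ (1 : Matrix b' b' ℂ))) * I.U := by
          rw [pullback]; simp only [Matrix.mul_assoc]
      _ = I.Uᴴ * ((O ⊗ₖ (1 : Matrix b' b' ℂ)) * (I.U * I.Uᴴ) *
          ((1 : Matrix a' a' ℂ) ⊗ₖ I.XB')) * I.U := by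
          rw [hU, Matrix.mul_one, Matrix.mul_one, e]
      _ = _ := by rw [pullback]; simp only [Matrix.mul_assoc]
  have h2 : (σ ⊗ₖ I.ρB) * ((1 : Matrix a a ℂ) ⊗ₖ I.XB)
      = ((1 : Matrix a a ℂ) ⊗ₖ I.XB) * (σ ⊗ₖ I.ρB) := by
    rw [← mul_kronecker_mul, ← mul_kronecker_mul, I.incoherent]; simp
  have h3 : I.loss * I.pullback O - I.pullback O * I.loss
      = I.pullback O * ((1 : Matrix a a ℂ) ⊗ₖ I.XB)
        - ((1 : Matrix a a ℂ) ⊗ₖ I.XB) * I.pullback O := by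
    rw [loss_eq, Matrix.sub_mul, Matrix.mul_sub, h1]
    abel
  rw [h3, Matrix.mul_sub, trace_sub, ← Matrix.mul_assoc (σ ⊗ₖ I.ρB) ((1 : Matrix a a ℂ) ⊗ₖ I.XB),
    h2, Matrix.mul_assoc, Matrix.trace_mul_comm ((1 : Matrix a a ℂ) ⊗ₖ I.XB), ← Matrix.mul_assoc,
    sub_self]

/-- The disturbance of the observable `P` when it is read out as `O` at the output. -/
def disturbance (O : Matrix a' a' ℂ) (P : Matrix a a ℂ) : Matrix (a × b) (a × b) ℂ :=
  I.pullback O - P ⊗ₖ (1 : Matrix b b ℂ)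

theorem isHermitian_disturbance {O : Matrix a' a' ℂ} {P : Matrix a a ℂ} (hO : O.IsHermitian)
    (hP : P.IsHermitian) : (I.disturbance O P).IsHermitian :=
  (I.isHermitian_pullback hO).sub (isHermitian_kronecker hP isHermitian_one)

/-- The mean square disturbance. -/
def meanSqDisturbance (O : Matrix a' a' ℂ) (P σ : Matrix a a ℂ) : ℝ :=
  ((σ ⊗ₖ I.ρB) * (I.disturbance O P * I.disturbance O P)).trace.re

/-- In the mean commutator of loss and disturbance the O part drops out by
`trace_commutator_pullback`. The P part sees only the bath average of the loss, which is Y. -/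
theorem sq_norm_trace_chargeChange_commutator_le (hXA : XA.IsHermitian) (hXA' : XA'.IsHermitian)
    {σ : Matrix a a ℂ} (hσ : σ.PosSemidef) {O : Matrix a' a' ℂ} {P : Matrix a a ℂ}
    (hO : O.IsHermitian) (hP : P.IsHermitian) :
    ‖(chargeChange Φ XA XA' * (P * σ - σ * P)).trace‖ ^ 2
      ≤ qfi (σ ⊗ₖ I.ρB) I.loss * I.meanSqDisturbance O P σ := by
  have h := sq_norm_trace_commutator_le (hσ.kronecker I.isState.1) (I.isHermitian_loss hXA hXA')
    (I.isHermitian_disturbance hO hP)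
  refine le_trans (le_of_eq ?_) h
  have e1 : I.loss * I.disturbance O P - I.disturbance O P * I.loss
      = (I.loss * I.pullback O - I.pullback O * I.loss)
        - (I.loss * (P ⊗ₖ (1 : Matrix b b ℂ)) - (P ⊗ₖ (1 : Matrix b b ℂ)) * I.loss) := by
    rw [disturbance]; noncomm_ring
  have e2 : (P * σ - σ * P) ⊗ₖ I.ρB
      = (P ⊗ₖ (1 : Matrix b b ℂ)) * (σ ⊗ₖ I.ρB) - (σ ⊗ₖ I.ρB) * (P ⊗ₖ (1 : Matrix b b ℂ)) := by
    rw [← mul_kronecker_mul, ← mul_kronecker_mul, Matrix.one_mul, Matrix.mul_one]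
    ext i j; simp [sub_mul]
  have e3 : ((σ ⊗ₖ I.ρB) *
        (I.loss * (P ⊗ₖ (1 : Matrix b b ℂ)) - (P ⊗ₖ (1 : Matrix b b ℂ)) * I.loss)).trace
      = (I.loss * ((P ⊗ₖ (1 : Matrix b b ℂ)) * (σ ⊗ₖ I.ρB)
        - (σ ⊗ₖ I.ρB) * (P ⊗ₖ (1 : Matrix b b ℂ)))).trace := by
    rw [Matrix.mul_sub, Matrix.mul_sub, trace_sub, trace_sub, Matrix.trace_mul_comm (σ ⊗ₖ I.ρB),
      ← Matrix.mul_assoc (σ ⊗ₖ I.ρB), Matrix.trace_mul_comm _ I.loss]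
    simp only [Matrix.mul_assoc]
  rw [e1, Matrix.mul_sub (σ ⊗ₖ I.ρB), trace_sub, I.trace_commutator_pullback, zero_sub, norm_neg,
    e3, ← e2, I.trace_chargeChange_mul]

/-- `δ²` bounds the Fisher information of the loss over all states supported in `S`. -/
def FisherBound (S : Submodule ℂ (a → ℂ)) (δ : ℝ) : Prop :=
  ∀ σ : Matrix a a ℂ, IsState σ → LinearMap.range σ.mulVecLin ≤ S →
    qfi (σ ⊗ₖ I.ρB) I.loss ≤ δ ^ 2

/-- A crude state-independent bound, needed only so that the supremum defining Δ is over a bounded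
set. -/
theorem qfi_le_of_isState (hXA : XA.IsHermitian) (hXA' : XA'.IsHermitian) {σ : Matrix a a ℂ}
    (hσ : IsState σ) :
    qfi (σ ⊗ₖ I.ρB) I.loss ≤ 4 * (I.loss * I.loss).trace.re := by
  have hN := I.isHermitian_loss hXA hXA'
  have hs : IsState (σ ⊗ₖ I.ρB) := ⟨hσ.1.kronecker I.isState.1, by
    rw [trace_kronecker, hσ.2, I.isState.2, one_mul]⟩
  refine (qfi_le hs.1 hN 0).trans ?_
  simp only [Complex.ofReal_zero, zero_smul, sub_zero]
  have hNN : (I.loss * I.loss).PosSemidef := by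
    nth_rw 1 [← hN.eq]; exact posSemidef_conjTranspose_mul_self _
  have h := trace_mul_mono hNN hs.one_sub_posSemidef
  rw [Matrix.mul_one, Matrix.trace_mul_comm] at h
  linarith

theorem fisherBound_coherenceBound {K : Type*} (hXA : XA.IsHermitian) (hXA' : XA'.IsHermitian)
    (ρ : K → Matrix a a ℂ) :
    I.FisherBound (⨆ k, LinearMap.range (ρ k).mulVecLin) (coherenceBound I ρ) := by
  intro σ hσ hr
  have h0 := qfi_nonneg (hσ.1.kronecker I.isState.1) (I.isHermitian_loss hXA hXA')
  have h : √(qfi (σ ⊗ₖ I.ρB) I.loss) ≤ coherenceBound I ρ := by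
    refine le_csSup ⟨√(4 * (I.loss * I.loss).trace.re), ?_⟩ ⟨σ, hσ, hr, rfl⟩
    rintro _ ⟨τ, hτ, -, rfl⟩
    exact Real.sqrt_le_sqrt (I.qfi_le_of_isState hXA hXA' hτ)
  calc _ = √(qfi (σ ⊗ₖ I.ρB) I.loss) ^ 2 := (Real.sq_sqrt h0).symm
    _ ≤ _ := pow_le_pow_left₀ (Real.sqrt_nonneg _) h 2

theorem coherenceBound_nonneg {K : Type*} (ρ : K → Matrix a a ℂ) : 0 ≤ coherenceBound I ρ := by
  refine Real.sSup_nonneg ?_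
  rintro _ ⟨σ, -, -, rfl⟩
  exact Real.sqrt_nonneg _

theorem meanSqDisturbance_add (O : Matrix a' a' ℂ) (P σ τ : Matrix a a ℂ) :
    I.meanSqDisturbance O P (σ + τ) = I.meanSqDisturbance O P σ + I.meanSqDisturbance O P τ := by
  simp [meanSqDisturbance, add_kronecker, Matrix.add_mul, trace_add]

theorem meanSqDisturbance_nonneg {O : Matrix a' a' ℂ} {P σ : Matrix a a ℂ} (hσ : σ.PosSemidef)
    (hO : O.IsHermitian) (hP : P.IsHermitian) : 0 ≤ I.meanSqDisturbance O P σ :=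
  trace_mul_sq_nonneg (hσ.kronecker I.isState.1) (I.isHermitian_disturbance hO hP)

/-- The coherence created between two orthogonal vectors is bounded by the disturbance. -/
theorem sq_norm_chargeChange_le (hXA : XA.IsHermitian) (hXA' : XA'.IsHermitian)
    {S : Submodule ℂ (a → ℂ)} {δ : ℝ} (hδ : I.FisherBound S δ)
    {O : Matrix a' a' ℂ} {P : Matrix a a ℂ} (hO : O.IsHermitian) (hP : P.IsHermitian)
    {u v : a → ℂ} (hu : IsUnitVec u) (hv : IsUnitVec v) (huS : u ∈ S) (hvS : v ∈ S)
    (hPu : P *ᵥ u = u) (hPv : P *ᵥ v = 0)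
    (hY : (chargeChange Φ XA XA').IsHermitian) :
    ‖star v ⬝ᵥ chargeChange Φ XA XA' *ᵥ u‖ ^ 2
      ≤ δ ^ 2 * ((I.meanSqDisturbance O P (proj u) + I.meanSqDisturbance O P (proj v)) / 2) := by
  set Y := chargeChange Φ XA XA' with hYdef
  set z := star v ⬝ᵥ Y *ᵥ u with hz
  have hz' : star u ⬝ᵥ Y *ᵥ v = star z := by
    rw [hz, star_dotProduct, star_mulVec, hY.eq, dotProduct_mulVec]
  have huv : star v ⬝ᵥ u = 0 := by
    rw [← hPu, dotProduct_mulVec]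
    have : star v ᵥ* P = star (P *ᵥ v) := by rw [star_mulVec, hP.eq]
    rw [this, hPv]; simp
  have hvu : star u ⬝ᵥ v = 0 := by
    rw [star_dotProduct, huv, star_zero]
  have huu : star u ⬝ᵥ u = 1 := hu
  have hvv : star v ⬝ᵥ v = 1 := hv
  -- The relation is tested on the superposition (u + cv)/√2, for which P maps the unnormalised
  -- vector to u.
  have key : ∀ c : ℂ, star c * c = 1 →
      ‖(1 / 2 : ℂ) * (star c * z - c * star z)‖ ^ 2
        ≤ δ ^ 2 * I.meanSqDisturbance O P (((1 / 2 : ℝ) : ℂ) • proj (u + c • v)) := by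
    intro c hc
    set w := u + c • v with hw
    have hPw : P *ᵥ w = u := by rw [hw, mulVec_add, mulVec_smul, hPu, hPv, smul_zero, add_zero]
    have hps : (((1 / 2 : ℝ) : ℂ) • proj w).PosSemidef := by
      refine (posSemidef_proj w).smul ?_
      rw [Complex.zero_le_real]; norm_num
    have hst : IsState (((1 / 2 : ℝ) : ℂ) • proj w) := by
      refine ⟨hps, ?_⟩
      rw [trace_smul, trace_proj, hw, star_add, star_smul]
      simp only [add_dotProduct, dotProduct_add, smul_dotProduct, dotProduct_smul, huv, hvu,
        huu, hvv, smul_eq_mul]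
      push_cast
      linear_combination (1 / 2 : ℂ) * hc
    have hr : LinearMap.range (((1 / 2 : ℝ) : ℂ) • proj w).mulVecLin ≤ S := by
      rintro _ ⟨x, rfl⟩
      rw [mulVecLin_apply, smul_mulVec, proj_mulVec]
      exact S.smul_mem _ (S.smul_mem _ (S.add_mem huS (S.smul_mem _ hvS)))
    have h := I.sq_norm_trace_chargeChange_commutator_le hXA hXA' hps hO hP
    have e : (Y * (P * (((1 / 2 : ℝ) : ℂ) • proj w) - (((1 / 2 : ℝ) : ℂ) • proj w) * P)).trace
        = (1 / 2 : ℂ) * (star c * z - c * star z) := by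
      have e1 : star w ᵥ* P = star u := by rw [← hPw, star_mulVec, hP.eq]
      rw [Matrix.mul_smul, Matrix.smul_mul, ← smul_sub, Matrix.mul_smul, trace_smul, mul_proj,
        proj_mul, hPw, e1, Matrix.mul_sub, trace_sub, trace_mul_vecMulVec, trace_mul_vecMulVec, hw,
        star_add, star_smul, mulVec_add, mulVec_smul]
      simp only [add_dotProduct, dotProduct_add, smul_dotProduct, dotProduct_smul, smul_eq_mul,
        hz', ← hz]
      push_cast
      ring
    rw [← hYdef, e] at h
    exact h.trans (mul_le_mul_of_nonneg_right (hδ _ hst hr) (I.meanSqDisturbance_nonneg hps hO hP))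
  rcases eq_or_ne z 0 with h0 | h0
  · rw [h0, norm_zero, zero_pow two_ne_zero]
    have h1 := I.meanSqDisturbance_nonneg (posSemidef_proj u) hO hP
    have h2 := I.meanSqDisturbance_nonneg (posSemidef_proj v) hO hP
    positivity
  · have hn : (‖z‖ : ℂ) ≠ 0 := by exact_mod_cast norm_ne_zero_iff.2 h0
    have hzz : star z * z = (‖z‖ : ℂ) ^ 2 := by
      rw [Complex.star_def, Complex.conj_mul']
    -- This phase makes c̄z - cz̄ = -2i|z|, the largest possible modulus.
    set c : ℂ := Complex.I * z / ‖z‖ with hc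
    have hsc : star c = -Complex.I * star z / ‖z‖ := by
      simp [hc]
    have hcc : star c * c = 1 := by
      rw [hsc, hc]
      field_simp
      linear_combination hzz * (-(Complex.I ^ 2)) - ((‖z‖ : ℂ) ^ 2) * Complex.I_sq
    have hcz : star c * z - c * star z = -2 * Complex.I * ‖z‖ := by
      rw [hsc, hc]
      field_simp
      linear_combination (-2) * hzz
    have k1 := key c hcc
    have k2 := key (-c) (by rw [star_neg, neg_mul_neg, hcc])
    have n1 : ‖(1 / 2 : ℂ) * (star c * z - c * star z)‖ = ‖z‖ := by
      rw [hcz]; simp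
    have n2 : ‖(1 / 2 : ℂ) * (star (-c) * z - (-c) * star z)‖ = ‖z‖ := by
      rw [show star (-c) * z - (-c) * star z = -(star c * z - c * star z) by
        rw [star_neg]; ring, mul_neg, norm_neg, n1]
    rw [n1] at k1
    rw [n2] at k2
    -- Averaging over ±c removes the cross terms, so only the disturbances at u and at v enter.
    have hsum : ((1 / 2 : ℝ) : ℂ) • proj (u + c • v) + ((1 / 2 : ℝ) : ℂ) • proj (u + (-c) • v)
        = proj u + proj v := by
      ext i j
      have hcc' : c * star c = 1 := by rw [mul_comm, hcc]
      simp only [proj, Matrix.add_apply, Matrix.smul_apply, vecMulVec_apply, Pi.star_apply,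
        Pi.add_apply, Pi.smul_apply, smul_eq_mul, star_add, star_mul', star_neg]
      push_cast
      linear_combination (v i * star (v j)) * hcc'
    have hs := congrArg (I.meanSqDisturbance O P) hsum
    rw [meanSqDisturbance_add, meanSqDisturbance_add] at hs
    rw [← hs]
    linarith

theorem apply_conjTranspose (I : SymmetricRealization Φ XA XA' b b') (M : Matrix a a ℂ) :
    Φ Mᴴ = (Φ M)ᴴ := by
  rw [I.realizes, I.realizes, ← traceSnd_conjTranspose, conjTranspose_mul, conjTranspose_mul,
    conjTranspose_conjTranspose, conjTranspose_kronecker, I.isState.1.1.eq, Matrix.mul_assoc]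

theorem isHermitian_chargeChange (I : SymmetricRealization Φ XA XA' b b')
    (hXA : XA.IsHermitian) (hXA' : XA'.IsHermitian) :
    (chargeChange Φ XA XA').IsHermitian := by
  refine hXA.sub ?_
  ext i j
  simp only [conjTranspose_apply, dual, Matrix.of_apply]
  rw [← trace_conjTranspose, conjTranspose_mul, hXA'.eq, ← I.apply_conjTranspose,
    conjTranspose_single, star_one, Matrix.trace_mul_comm]

/-- On an eigenvector of P the disturbance acts as Q - 1 or as Q, where Q is the effect measured
after recovery. The squares (1 - Q)² and Q² are dominated by 1 - Q and Q, whose means are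
wrong-answer probabilities. -/
theorem meanSqDisturbance_le {R : Matrix a' a' ℂ →ₗ[ℂ] Matrix a a ℂ} (hR : IsPTP R)
    {P : Matrix a a ℂ} (hP : P.IsHermitian) (hPP : P * P = P) {u : a → ℂ} (hu : IsUnitVec u) :
    (P *ᵥ u = u → I.meanSqDisturbance (dual R P) P (proj u) ≤ 1 - outcome R Φ P (proj u)) ∧
    (P *ᵥ u = 0 → I.meanSqDisturbance (dual R P) P (proj u) ≤ outcome R Φ P (proj u)) := by
  have hPpos := posSemidef_of_idempotent hP hPP
  have hPpos' := posSemidef_of_idempotent (isHermitian_one_sub hP) (one_sub_mul_self hPP)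
  set Q := I.pullback (dual R P) with hQ
  set ρ := proj u ⊗ₖ I.ρB with hρdef
  have hρ : ρ.PosSemidef := (posSemidef_proj u).kronecker I.isState.1
  have hρ1 : ρ.trace = 1 := by
    rw [hρdef, trace_kronecker, (isState_proj hu).2, I.isState.2, one_mul]
  have hQ0 : Q.PosSemidef := I.posSemidef_pullback (posSemidef_dual hR hPpos)
  have hQ1 : (1 - Q).PosSemidef := by
    have := I.posSemidef_pullback (posSemidef_dual hR hPpos')
    rwa [dual_sub, dual_one hR, I.pullback_sub, I.pullback_one] at this
  have hout : (ρ * Q).trace.re = outcome R Φ P (proj u) := by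
    rw [outcome, ← trace_dual_mul, I.trace_mul_apply, Matrix.trace_mul_comm]
  have hl : (P ⊗ₖ (1 : Matrix b b ℂ)) * ρ = (P * proj u) ⊗ₖ I.ρB := by
    rw [hρdef, ← mul_kronecker_mul, Matrix.one_mul]
  have hr : ρ * (P ⊗ₖ (1 : Matrix b b ℂ)) = (proj u * P) ⊗ₖ I.ρB := by
    rw [hρdef, ← mul_kronecker_mul, Matrix.mul_one]
  have huP : star u ᵥ* P = star (P *ᵥ u) := by rw [star_mulVec, hP.eq]
  rw [mul_proj] at hl
  rw [proj_mul, huP] at hr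
  refine ⟨fun h => ?_, fun h => ?_⟩
  · rw [h] at hl hr
    change _ = ρ at hl
    change _ = ρ at hr
    have e : (ρ * (I.disturbance (dual R P) P * I.disturbance (dual R P) P)).trace
        = (ρ * ((1 - Q) * (1 - Q))).trace := by
      have e1 : ρ * I.disturbance (dual R P) P = -(ρ * (1 - Q)) := by
        rw [disturbance, Matrix.mul_sub, hr, Matrix.mul_sub, Matrix.mul_one]; abel
      have e2 : I.disturbance (dual R P) P * ρ = -((1 - Q) * ρ) := by
        rw [disturbance, Matrix.sub_mul, hl, Matrix.sub_mul, Matrix.one_mul]; abel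
      rw [← Matrix.mul_assoc, e1, Matrix.trace_mul_comm, Matrix.mul_neg, ← Matrix.mul_assoc, e2,
        Matrix.neg_mul, neg_neg, Matrix.mul_assoc, Matrix.trace_mul_comm, Matrix.mul_assoc]
    have hle := trace_mul_mono hρ (posSemidef_sub_sq hQ1 (by simpa using hQ0))
    rw [meanSqDisturbance, e, ← hout]
    refine hle.trans (le_of_eq ?_)
    rw [Matrix.mul_sub, Matrix.mul_one, trace_sub, hρ1, Complex.sub_re, Complex.one_re]
  · rw [h] at hl hr
    rw [zero_vecMulVec, zero_kronecker] at hl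
    rw [star_zero, vecMulVec_zero, zero_kronecker] at hr
    have e : (ρ * (I.disturbance (dual R P) P * I.disturbance (dual R P) P)).trace
        = (ρ * (Q * Q)).trace := by
      have e1 : ρ * I.disturbance (dual R P) P = ρ * Q := by
        rw [disturbance, Matrix.mul_sub, hr, sub_zero]
      have e2 : I.disturbance (dual R P) P * ρ = Q * ρ := by
        rw [disturbance, Matrix.sub_mul, hl, sub_zero]
      rw [← Matrix.mul_assoc, e1, Matrix.trace_mul_comm, ← Matrix.mul_assoc, e2, Matrix.mul_assoc,
        Matrix.trace_mul_comm, Matrix.mul_assoc]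
    rw [meanSqDisturbance, e, ← hout]
    exact trace_mul_mono hρ (posSemidef_sub_sq hQ0 hQ1)

/-- The trade-off relation for two positive operators separated by a projection. -/
theorem trace_mul_chargeChange_le (hXA : XA.IsHermitian) (hXA' : XA'.IsHermitian)
    {S : Submodule ℂ (a → ℂ)} {δ : ℝ} (hδ : I.FisherBound S δ)
    {R : Matrix a' a' ℂ →ₗ[ℂ] Matrix a a ℂ} (hR : IsPTP R)
    {P A B : Matrix a a ℂ} (hP : P.IsHermitian) (hPP : P * P = P)
    (hA : A.PosSemidef) (hB : B.PosSemidef)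
    (hAS : LinearMap.range A.mulVecLin ≤ S) (hBS : LinearMap.range B.mulVecLin ≤ S)
    (hPA : P * A = A) (hPB : P * B = 0) :
    (A * chargeChange Φ XA XA' * B * chargeChange Φ XA XA').trace.re
      ≤ δ ^ 2 * ((B.trace.re * (A.trace.re - outcome R Φ P A)
        + A.trace.re * outcome R Φ P B) / 2) := by
  have hY := I.isHermitian_chargeChange hXA hXA'
  set Y := chargeChange Φ XA XA' with hYdef
  set r := hA.1.eigenvalues with hr
  set s := hB.1.eigenvalues with hs
  set u : a → a → ℂ := fun i => (hA.1.eigenvectorBasis i).ofLp with hu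
  set v : a → a → ℂ := fun i => (hB.1.eigenvectorBasis i).ofLp with hv
  have hAsum : A = ∑ i, (r i : ℂ) • proj (u i) := eq_sum_eigenvalues_smul_proj hA.1
  have hBsum : B = ∑ i, (s i : ℂ) • proj (v i) := eq_sum_eigenvalues_smul_proj hB.1
  have hr0 : ∀ i, 0 ≤ r i := hA.eigenvalues_nonneg
  have hs0 : ∀ i, 0 ≤ s i := hB.eigenvalues_nonneg
  have hu1 : ∀ i, IsUnitVec (u i) := isUnitVec_eigenvectorBasis hA.1
  have hv1 : ∀ i, IsUnitVec (v i) := isUnitVec_eigenvectorBasis hB.1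
  have hAu : ∀ i, A *ᵥ u i = (r i : ℂ) • u i := mulVec_eigenvectorBasis' hA.1
  have hBv : ∀ i, B *ᵥ v i = (s i : ℂ) • v i := mulVec_eigenvectorBasis' hB.1
  have hAtr : A.trace.re = ∑ i, r i := by
    rw [hA.1.trace_eq_sum_eigenvalues]; simp [hr]
  have hBtr : B.trace.re = ∑ i, s i := by
    rw [hB.1.trace_eq_sum_eigenvalues]; simp [hs]
  have hfA : outcome R Φ P A = ∑ i, r i * outcome R Φ P (proj (u i)) := by
    conv_lhs => rw [hAsum]
    exact outcome_sum_smul _ _ _ _ _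
  have hfB : outcome R Φ P B = ∑ i, s i * outcome R Φ P (proj (v i)) := by
    conv_lhs => rw [hBsum]
    exact outcome_sum_smul _ _ _ _ _
  have hlhs : (A * Y * B * Y).trace.re
      = ∑ i, ∑ j, r i * s j * ‖star (v j) ⬝ᵥ Y *ᵥ u i‖ ^ 2 := by
    conv_lhs => rw [hAsum, hBsum]
    simp only [Matrix.sum_mul, Matrix.mul_sum, trace_sum, Complex.re_sum, Matrix.smul_mul,
      Matrix.mul_smul, trace_smul, trace_proj_mul_proj_mul hY, smul_eq_mul]
    rw [Finset.sum_comm]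
    refine Finset.sum_congr rfl fun i _ => ?_
    rw [Finset.mul_sum, Complex.re_sum]
    refine Finset.sum_congr rfl fun j _ => ?_
    rw [← Complex.ofReal_mul, ← Complex.ofReal_mul, Complex.ofReal_re]
    ring
  have hterm : ∀ i j, r i * s j * ‖star (v j) ⬝ᵥ Y *ᵥ u i‖ ^ 2
      ≤ r i * s j * (δ ^ 2 * ((1 - outcome R Φ P (proj (u i))
        + outcome R Φ P (proj (v j))) / 2)) := by
    intro i j
    -- Only eigenvectors with nonzero eigenvalue are known to lie in S and to be fixed or killed by
    -- P; the other terms vanish through their weights.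
    rcases (hr0 i).eq_or_lt with hi | hi
    · rw [← hi]; simp
    rcases (hs0 j).eq_or_lt with hj | hj
    · rw [← hj]; simp
    have hi' : (r i : ℂ) ≠ 0 := by exact_mod_cast hi.ne'
    have hj' : (s j : ℂ) ≠ 0 := by exact_mod_cast hj.ne'
    have eu : u i = A *ᵥ ((r i : ℂ)⁻¹ • u i) := by
      rw [mulVec_smul, hAu, smul_smul, inv_mul_cancel₀ hi', one_smul]
    have ev : v j = B *ᵥ ((s j : ℂ)⁻¹ • v j) := by
      rw [mulVec_smul, hBv, smul_smul, inv_mul_cancel₀ hj', one_smul]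
    have hPu : P *ᵥ u i = u i := by
      rw [eu, mulVec_mulVec, hPA]
    have hPv : P *ᵥ v j = 0 := by
      rw [ev, mulVec_mulVec, hPB, zero_mulVec]
    have huS : u i ∈ S := hAS ⟨_, by rw [mulVecLin_apply]; exact eu.symm⟩
    have hvS : v j ∈ S := hBS ⟨_, by rw [mulVecLin_apply]; exact ev.symm⟩
    have hO := (posSemidef_dual hR (posSemidef_of_idempotent hP hPP)).1
    have h := I.sq_norm_chargeChange_le hXA hXA' hδ hO hP (hu1 i) (hv1 j) huS hvS hPu hPv hY
    have d1 := (I.meanSqDisturbance_le hR hP hPP (hu1 i)).1 hPu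
    have d2 := (I.meanSqDisturbance_le hR hP hPP (hv1 j)).2 hPv
    refine mul_le_mul_of_nonneg_left (h.trans ?_) (mul_nonneg hi.le hj.le)
    refine mul_le_mul_of_nonneg_left ?_ (sq_nonneg δ)
    linarith
  rw [hlhs]
  refine (Finset.sum_le_sum fun i _ => Finset.sum_le_sum fun j _ => hterm i j).trans (le_of_eq ?_)
  have hsplit : ∀ i j, r i * s j * (δ ^ 2 * ((1 - outcome R Φ P (proj (u i))
        + outcome R Φ P (proj (v j))) / 2))
      = δ ^ 2 / 2 * ((r i * s j - (r i * outcome R Φ P (proj (u i))) * s j)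
        + r i * (s j * outcome R Φ P (proj (v j)))) := fun i j => by ring
  simp only [hsplit, ← Finset.mul_sum, Finset.sum_add_distrib, Finset.sum_sub_distrib,
    ← Finset.sum_mul]
  rw [hAtr, hBtr, hfA, hfB]
  ring

end SymmetricRealization

/-! ### The trade-off relation for test ensembles -/

theorem purifiedDistance_nonneg {n : Type*} [Fintype n] [DecidableEq n] (ρ σ : Matrix n n ℂ) :
    0 ≤ purifiedDistance ρ σ := Real.sqrt_nonneg _

theorem trace_projection_sub_le' {n : Type*} [Fintype n] [DecidableEq n] {ρ σ P : Matrix n n ℂ}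
    (hρ : IsState ρ) (hσ : IsState σ) (hP : P.IsHermitian) (hPP : P * P = P) :
    (P * σ).trace.re - (P * ρ).trace.re ≤ purifiedDistance ρ σ := by
  have h := trace_projection_sub_le hρ hσ (isHermitian_one_sub hP) (one_sub_mul_self hPP)
  rw [Matrix.mul_sub, trace_sub, Complex.sub_re, (trace_projection_mem hρ hP hPP).2.2,
    (trace_projection_mem hσ hP hPP).2.2] at h
  linarith

theorem posSemidef_traceSnd {a b : Type*} [Fintype a] [Fintype b]
    {M : Matrix (a × b) (a × b) ℂ} (hM : M.PosSemidef) : (traceSnd M).PosSemidef := by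
  have h : traceSnd M = ∑ k : b, M.submatrix (fun i => (i, k)) fun i => (i, k) := by
    ext i j
    rw [Matrix.sum_apply]
    rfl
  rw [h]
  exact posSemidef_sum _ fun k _ => hM.submatrix _

theorem trace_traceSnd {a b : Type*} [Fintype a] [Fintype b] (M : Matrix (a × b) (a × b) ℂ) :
    (traceSnd M).trace = M.trace := by
  simp [Matrix.trace, traceSnd, Fintype.sum_prod_type]

/-- Averaging pairwise bounds over the ensemble. -/
theorem sum_pairs_le {K : Type*} [Fintype K] [DecidableEq K] {p x : K → ℝ} {t : K → K → ℝ}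
    {c : ℝ} (hc : 0 ≤ c) (hp : ∀ k, 0 ≤ p k) (hp1 : ∑ k, p k = 1) (hx : ∀ k, 0 ≤ x k)
    (ht : ∀ k k', k ≠ k' → t k k' ≤ c * ((x k + x k') / 2)) :
    ∑ k, ∑ k' ∈ Finset.univ.filter (fun k' => k' ≠ k), p k * p k' * t k k'
      ≤ c * ∑ k, p k * x k := by
  calc _ ≤ ∑ k, ∑ k' ∈ Finset.univ.filter (fun k' => k' ≠ k),
        p k * p k' * (c * ((x k + x k') / 2)) := by
        refine Finset.sum_le_sum fun k _ => Finset.sum_le_sum fun k' hk' => ?_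
        exact mul_le_mul_of_nonneg_left (ht k k' (Finset.mem_filter.1 hk').2.symm)
          (mul_nonneg (hp k) (hp k'))
    -- Including the nonnegative diagonal terms makes the double sum factor through the total
    -- probability 1.
    _ ≤ ∑ k, ∑ k', p k * p k' * (c * ((x k + x k') / 2)) := by
        refine Finset.sum_le_sum fun k _ =>
          Finset.sum_le_sum_of_subset_of_nonneg (Finset.filter_subset _ _) fun k' _ _ => ?_
        have := hp k; have := hp k'; have := hx k; have := hx k'
        positivity
    _ = c * ∑ k, p k * x k := by
        have h : ∀ k k', p k * p k' * (c * ((x k + x k') / 2))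
            = c / 2 * (p k * x k * p k' + p k * (p k' * x k')) := fun k k' => by ring
        simp only [h, ← Finset.mul_sum, Finset.sum_add_distrib, hp1, ← Finset.sum_mul]
        ring

/-- The recovery error of a fixed recovery map. -/
def errorOf {K a b : Type*} [Fintype K] [Fintype a] [DecidableEq a]
    (Φ : Matrix a a ℂ →ₗ[ℂ] Matrix b b ℂ) (p : K → ℝ) (ρ : K → Matrix a a ℂ)
    (R : Matrix b b ℂ →ₗ[ℂ] Matrix a a ℂ) : ℝ :=
  √(∑ k, p k * purifiedDistance (ρ k) (R (Φ (ρ k))) ^ 2)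

namespace SymmetricRealization

variable {a a' b b' : Type*} [Fintype a] [DecidableEq a] [Fintype a'] [DecidableEq a']
  [Fintype b] [DecidableEq b] [Fintype b'] [DecidableEq b']
  {Φ : Matrix a a ℂ →ₗ[ℂ] Matrix a' a' ℂ} {XA : Matrix a a ℂ} {XA' : Matrix a' a' ℂ}
  (I : SymmetricRealization Φ XA XA' b b')

theorem isPTP (I : SymmetricRealization Φ XA XA' b b') : IsPTP Φ := by
  refine ⟨fun M hM => ?_, fun M => ?_⟩
  · rw [I.realizes]
    exact posSemidef_traceSnd ((hM.kronecker I.isState.1).mul_mul_conjTranspose_same _)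
  · rw [I.realizes, trace_traceSnd, Matrix.trace_mul_comm, ← Matrix.mul_assoc, I.unitary_left,
      Matrix.one_mul, trace_kronecker, I.isState.2, mul_one]

section Pair

variable {S : Submodule ℂ (a → ℂ)} {δ : ℝ} {R : Matrix a' a' ℂ →ₗ[ℂ] Matrix a a ℂ}
  {ρ ρ' : Matrix a a ℂ}

/-- The positive and negative parts have equal trace t = Tr P(ρ - ρ') ≤ 1. The error term then
involves only the changes of the outcome probability of P on ρ and on ρ', and each is at most D_F by
Fuchs–van de Graaf. -/
theorem trace_pair_le (hXA : XA.IsHermitian) (hXA' : XA'.IsHermitian)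
    (hδ : I.FisherBound S δ) (hR : IsPTP R) (hρ : IsState ρ) (hρ' : IsState ρ')
    (hS : LinearMap.range ρ.mulVecLin ≤ S) (hS' : LinearMap.range ρ'.mulVecLin ≤ S) :
    (pos (ρ - ρ') * chargeChange Φ XA XA' * neg (ρ - ρ') * chargeChange Φ XA XA').trace.re
      ≤ δ ^ 2 * ((purifiedDistance ρ (R (Φ ρ)) + purifiedDistance ρ' (R (Φ ρ'))) / 2) := by
  have hH : (ρ - ρ').IsHermitian := hρ.1.1.sub hρ'.1.1
  obtain ⟨P, hP, hPP, hPpos, hPneg⟩ := exists_projection_pos (ρ - ρ')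
  have hrange : ∀ M B : Matrix a a ℂ, M = (ρ - ρ') * B → LinearMap.range M.mulVecLin ≤ S := by
    rintro M B rfl _ ⟨x, rfl⟩
    rw [mulVecLin_apply, ← mulVec_mulVec, sub_mulVec]
    exact S.sub_mem (hS ⟨_, rfl⟩) (hS' ⟨_, rfl⟩)
  obtain ⟨B, hB⟩ := pos_eq_mul hH
  obtain ⟨C, hC⟩ := neg_eq_mul hH
  refine (I.trace_mul_chargeChange_le hXA hXA' hδ hR hP hPP (posSemidef_pos _) (posSemidef_neg _)
    (hrange _ _ hB) (hrange _ _ hC) hPpos hPneg).trans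
      (mul_le_mul_of_nonneg_left ?_ (sq_nonneg δ))
  have hsub := pos_sub_neg hH
  have ht : (pos (ρ - ρ')).trace.re - (neg (ρ - ρ')).trace.re = 0 := by
    rw [← Complex.sub_re, ← trace_sub, hsub, trace_sub, hρ.2, hρ'.2]; simp
  have ht' : (pos (ρ - ρ')).trace.re = (P * ρ).trace.re - (P * ρ').trace.re := by
    rw [← Complex.sub_re, ← trace_sub, ← Matrix.mul_sub]
    conv_rhs => rw [← hsub]
    rw [Matrix.mul_sub, hPpos, hPneg, sub_zero]
  have hf : outcome R Φ P (pos (ρ - ρ')) - outcome R Φ P (neg (ρ - ρ'))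
      = outcome R Φ P ρ - outcome R Φ P ρ' := by
    rw [← outcome_sub, hsub, outcome_sub]
  have ht0 : 0 ≤ (pos (ρ - ρ')).trace.re :=
    (Complex.le_def.1 (posSemidef_pos _).trace_nonneg).1
  obtain ⟨-, h1, -⟩ := trace_projection_mem hρ hP hPP
  obtain ⟨h0, -, -⟩ := trace_projection_mem hρ' hP hPP
  have hτ := hR.isState (I.isPTP.isState hρ)
  have hτ' := hR.isState (I.isPTP.isState hρ')
  have d1 := trace_projection_sub_le hρ hτ hP hPP
  have d2 := trace_projection_sub_le' hρ' hτ' hP hPP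
  rw [Matrix.mul_sub, trace_sub, Complex.sub_re] at d1
  change (P * ρ).trace.re - outcome R Φ P ρ ≤ _ at d1
  change outcome R Φ P ρ' - _ ≤ _ at d2
  have x1 := purifiedDistance_nonneg ρ (R (Φ ρ))
  have x2 := purifiedDistance_nonneg ρ' (R (Φ ρ'))
  set t := (pos (ρ - ρ')).trace.re
  have hneg : (neg (ρ - ρ')).trace.re = t := by linarith
  rw [hneg]
  -- Outcomes are linear, so those of the two parts enter only through their difference, which
  -- equals that of ρ and ρ'.
  have e : (t * (t - outcome R Φ P (pos (ρ - ρ'))) + t * outcome R Φ P (neg (ρ - ρ'))) / 2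
      = t * ((((P * ρ).trace.re - outcome R Φ P ρ)
        + (outcome R Φ P ρ' - (P * ρ').trace.re)) / 2) := by
    rw [show outcome R Φ P (pos (ρ - ρ')) = outcome R Φ P (neg (ρ - ρ'))
      + (outcome R Φ P ρ - outcome R Φ P ρ') by linarith]
    nth_rw 2 [ht']
    ring
  rw [e]
  calc _ ≤ t * ((purifiedDistance ρ (R (Φ ρ)) + purifiedDistance ρ' (R (Φ ρ'))) / 2) :=
        mul_le_mul_of_nonneg_left (by linarith) ht0
    _ ≤ 1 * ((purifiedDistance ρ (R (Φ ρ)) + purifiedDistance ρ' (R (Φ ρ'))) / 2) :=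
        mul_le_mul_of_nonneg_right (by linarith) (by linarith)
    _ = _ := one_mul _

/-- Here P is certain on ρ and impossible on ρ', so both wrong-answer probabilities are bounded by
D_F² instead of D_F. -/
theorem trace_pair_le_of_orthogonal (hXA : XA.IsHermitian) (hXA' : XA'.IsHermitian)
    (hδ : I.FisherBound S δ) (hR : IsPTP R) (hρ : IsState ρ) (hρ' : IsState ρ')
    (hS : LinearMap.range ρ.mulVecLin ≤ S) (hS' : LinearMap.range ρ'.mulVecLin ≤ S)
    (hF : fidelity ρ ρ' = 0) :
    (pos (ρ - ρ') * chargeChange Φ XA XA' * neg (ρ - ρ') * chargeChange Φ XA XA').trace.re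
      ≤ δ ^ 2 * ((purifiedDistance ρ (R (Φ ρ)) ^ 2
        + purifiedDistance ρ' (R (Φ ρ')) ^ 2) / 2) := by
  obtain ⟨P, hP, hPP, hPpos, hPneg⟩ := exists_projection_pos (ρ - ρ')
  obtain ⟨hpos, hneg⟩ := pos_neg_of_mul_eq_zero hρ.1 hρ'.1 (mul_eq_zero_of_fidelity hρ.1 hρ'.1 hF)
  rw [hpos] at hPpos ⊢
  rw [hneg] at hPneg ⊢
  refine (I.trace_mul_chargeChange_le hXA hXA' hδ hR hP hPP hρ.1 hρ'.1 hS hS' hPpos hPneg).trans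
    (mul_le_mul_of_nonneg_left ?_ (sq_nonneg δ))
  have d1 := one_sub_trace_projection_le hρ (hR.isState (I.isPTP.isState hρ)) hP hPP hPpos
  have d2 := trace_projection_le hρ' (hR.isState (I.isPTP.isState hρ')) hP hPP hPneg
  rw [hρ.2, hρ'.2, Complex.one_re, one_mul, one_mul]
  change 1 - outcome R Φ P ρ ≤ _ at d1
  change outcome R Φ P ρ' ≤ _ at d2
  linarith

end Pair

/-- The trade-off between covariance, recovery error and coherence for a fixed recovery map. -/
theorem tradeoff {K : Type*} [Fintype K] [DecidableEq K]
    (hXA : XA.IsHermitian) (hXA' : XA'.IsHermitian)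
    {R : Matrix a' a' ℂ →ₗ[ℂ] Matrix a a ℂ} (hR : IsPTP R) {p : K → ℝ} {ρ : K → Matrix a a ℂ}
    (h : IsTestEnsemble p ρ) :
    (offDiag (chargeChange Φ XA XA') p ρ ^ 2 ≤ coherenceBound I ρ ^ 2 * errorOf Φ p ρ R) ∧
    (IsOrthogonalEnsemble ρ →
      offDiag (chargeChange Φ XA XA') p ρ ≤ coherenceBound I ρ * errorOf Φ p ρ R) := by
  obtain ⟨hp, hp1, hρ⟩ := h
  have hδ := I.fisherBound_coherenceBound hXA hXA' ρ
  set δ := coherenceBound I ρ with hδdef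
  have hδ0 : 0 ≤ δ := I.coherenceBound_nonneg ρ
  set x : K → ℝ := fun k => purifiedDistance (ρ k) (R (Φ (ρ k))) with hx
  have hx0 : ∀ k, 0 ≤ x k := fun k => purifiedDistance_nonneg _ _
  have hS : ∀ k, LinearMap.range (ρ k).mulVecLin ≤ ⨆ k, LinearMap.range (ρ k).mulVecLin :=
    fun k => le_iSup (fun k => LinearMap.range (ρ k).mulVecLin) k
  have herr : errorOf Φ p ρ R = √(∑ k, p k * x k ^ 2) := rfl
  have hsum0 : 0 ≤ ∑ k, p k * x k ^ 2 :=
    Finset.sum_nonneg fun k _ => mul_nonneg (hp k) (sq_nonneg _)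
  constructor
  · have h1 := sum_pairs_le (sq_nonneg δ) hp hp1 hx0 fun k k' _ =>
      I.trace_pair_le hXA hXA' hδ hR (hρ k) (hρ k') (hS k) (hS k')
    have h2 : ∑ k, p k * x k ≤ errorOf Φ p ρ R := by
      rw [herr]
      refine Real.le_sqrt_of_sq_le ?_
      -- The mean of the distances is at most their root mean square; this loses nothing but turns
      -- the linear bound into one by ε.
      have hcs := Finset.sum_mul_sq_le_sq_mul_sq Finset.univ (fun k => √(p k))
        (fun k => √(p k) * x k)
      have e1 : ∀ k, √(p k) * (√(p k) * x k) = p k * x k := fun k => by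
        rw [← mul_assoc, Real.mul_self_sqrt (hp k)]
      have e2 : ∀ k, (√(p k) * x k) ^ 2 = p k * x k ^ 2 := fun k => by
        rw [mul_pow, Real.sq_sqrt (hp k)]
      have e3 : ∀ k, √(p k) ^ 2 = p k := fun k => Real.sq_sqrt (hp k)
      simp only [e1, e2, e3, hp1, one_mul] at hcs
      exact hcs
    rw [offDiag, Real.sq_sqrt']
    refine max_le (h1.trans (mul_le_mul_of_nonneg_left h2 (sq_nonneg δ))) ?_
    exact mul_nonneg (sq_nonneg δ) (Real.sqrt_nonneg _)
  · intro horth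
    have h1 := sum_pairs_le (sq_nonneg δ) hp hp1 (fun k => sq_nonneg (x k)) fun k k' hk =>
      I.trace_pair_le_of_orthogonal hXA hXA' hδ hR (hρ k) (hρ k') (hS k) (hS k') (horth k k' hk)
    rw [offDiag, herr]
    refine Real.sqrt_le_iff.2 ⟨mul_nonneg hδ0 (Real.sqrt_nonneg _), ?_⟩
    rw [mul_pow, Real.sq_sqrt hsum0]
    exact h1

end SymmetricRealization

/-! ### Recovery channels -/

/-- The channel that discards its input and prepares a basis state. -/
def prepare {a b : Type*} [Fintype b] [DecidableEq a] (i : a) :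
    Matrix b b ℂ →ₗ[ℂ] Matrix a a ℂ where
  toFun M := M.trace • Matrix.single i i 1
  map_add' M M' := by rw [trace_add, add_smul]
  map_smul' c M := by rw [trace_smul, smul_assoc, RingHom.id_apply]

theorem isChannel_prepare {a b : Type*} [Fintype a] [Fintype b] [DecidableEq a] (i : a) :
    IsChannel (prepare (b := b) i) where
  completelyPositive k M hM := by
    have h : amplify (prepare (b := b) i) k M
        = traceSnd M ⊗ₖ Matrix.single i i (1 : ℂ) := by
      ext u v
      rfl
    rw [h]
    refine (posSemidef_traceSnd hM).kronecker ?_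
    have : Matrix.single i i (1 : ℂ) = (Matrix.single i i 1)ᴴ * Matrix.single i i 1 := by
      simp
    rw [this]
    exact posSemidef_conjTranspose_mul_self _
  tracePreserving M := by
    simp [prepare, Matrix.trace_single_eq_same]

/-- The preparation channel shows that the set of errors is nonempty; the real infimum of the empty
set would be 0. -/
theorem le_recoveryError {K a b : Type*} [Fintype K] [Fintype a] [DecidableEq a] [Nonempty a]
    [Fintype b] {Φ : Matrix a a ℂ →ₗ[ℂ] Matrix b b ℂ} {p : K → ℝ} {ρ : K → Matrix a a ℂ} {c : ℝ}
    (h : ∀ R : Matrix b b ℂ →ₗ[ℂ] Matrix a a ℂ, IsChannel R → c ≤ errorOf Φ p ρ R) :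
    c ≤ recoveryError Φ p ρ := by
  refine le_csInf ⟨_, prepare (Classical.arbitrary a), isChannel_prepare _, rfl⟩ ?_
  rintro _ ⟨R, hR, rfl⟩
  exact h R hR

/-- The trade-off for a channel `Ψ` that is obtained from `Φ` by a positive map `S`. -/
theorem SymmetricRealization.tradeoff_recoveryError {K a a' q b b' : Type*} [Fintype K]
    [DecidableEq K] [Fintype a] [DecidableEq a] [Nonempty a] [Fintype a'] [DecidableEq a']
    [Fintype q] [Fintype b] [DecidableEq b] [Fintype b'] [DecidableEq b']
    {Φ : Matrix a a ℂ →ₗ[ℂ] Matrix a' a' ℂ} {Ψ : Matrix a a ℂ →ₗ[ℂ] Matrix q q ℂ}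
    {XA : Matrix a a ℂ} {XA' : Matrix a' a' ℂ}
    (I : SymmetricRealization Φ XA XA' b b') (hXA : XA.IsHermitian) (hXA' : XA'.IsHermitian)
    {S : Matrix a' a' ℂ →ₗ[ℂ] Matrix q q ℂ} (hS : IsPTP S) (hΨ : S ∘ₗ Φ = Ψ)
    {p : K → ℝ} {ρ : K → Matrix a a ℂ} (h : IsTestEnsemble p ρ) :
    (IsOrthogonalEnsemble ρ →
      offDiag (chargeChange Φ XA XA') p ρ / coherenceBound I ρ ≤ recoveryError Ψ p ρ) ∧
    offDiag (chargeChange Φ XA XA') p ρ ^ 2 / coherenceBound I ρ ^ 2 ≤ recoveryError Ψ p ρ ∧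
    (coherenceBound I ρ = 0 → offDiag (chargeChange Φ XA XA') p ρ = 0) := by
  subst hΨ
  have hδ := I.coherenceBound_nonneg ρ
  -- A recovery R after Ψ is the recovery R ∘ S after Φ, with the same error.
  have herr : ∀ R : Matrix q q ℂ →ₗ[ℂ] Matrix a a ℂ,
      errorOf (S ∘ₗ Φ) p ρ R = errorOf Φ p ρ (R ∘ₗ S) := fun R => rfl
  have herr0 : ∀ R : Matrix q q ℂ →ₗ[ℂ] Matrix a a ℂ, 0 ≤ errorOf (S ∘ₗ Φ) p ρ R :=
    fun R => Real.sqrt_nonneg _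
  refine ⟨fun ho => le_recoveryError fun R hR => ?_, le_recoveryError fun R hR => ?_,
    fun h0 => ?_⟩
  · refine div_le_of_le_mul₀ hδ (herr0 R) ?_
    rw [mul_comm, herr]
    exact (I.tradeoff hXA hXA' (hR.isPTP.comp hS) h).2 ho
  · refine div_le_of_le_mul₀ (sq_nonneg _) (herr0 R) ?_
    rw [mul_comm, herr]
    exact (I.tradeoff hXA hXA' (hR.isPTP.comp hS) h).1
  -- With Δ = 0 the bound for any single recovery already forces 𝒞 = 0.
  · have h1 := (I.tradeoff hXA hXA'
      (isChannel_prepare (b := a') (Classical.arbitrary a)).isPTP h).1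
    rw [h0, zero_pow two_ne_zero, zero_mul] at h1
    exact pow_eq_zero_iff two_ne_zero |>.1 (le_antisymm h1 (sq_nonneg _))

/-! ### Symmetric realizations from charge-preserving Kraus families -/

/-- A Kraus family `K` of `Φ` and a Hermitian environment charge `X_E` such that
`(X_{A'} ⊗ 1 + 1 ⊗ X_E) W = W X_A` for the Stinespring isometry `W` built from `K`. -/
structure SymmetricKraus {a a' e : Type*} [Fintype a] [DecidableEq a] [Fintype a'] [Fintype e]
    (Φ : Matrix a a ℂ →ₗ[ℂ] Matrix a' a' ℂ) (XA : Matrix a a ℂ) (XA' : Matrix a' a' ℂ)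
    (XE : Matrix e e ℂ) (K : e → Matrix a' a ℂ) : Prop where
  hermitian_XE : XE.IsHermitian
  apply_eq : ∀ M, Φ M = ∑ x, K x * M * (K x)ᴴ
  sum_eq_one : ∑ x, (K x)ᴴ * K x = 1
  intertwine : ∀ x, XA' * K x + ∑ y, XE x y • K y = K x * XA

/-- The charge `A ⊗ 1 + 1 ⊗ B` of a composite system. -/
def jointCharge {a b : Type*} [DecidableEq a] [DecidableEq b] (A : Matrix a a ℂ)
    (B : Matrix b b ℂ) : Matrix (a × b) (a × b) ℂ :=
  A ⊗ₖ (1 : Matrix b b ℂ) + (1 : Matrix a a ℂ) ⊗ₖ B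

theorem isHermitian_jointCharge {a b : Type*} [DecidableEq a] [DecidableEq b]
    {A : Matrix a a ℂ} {B : Matrix b b ℂ} (hA : A.IsHermitian) (hB : B.IsHermitian) :
    (jointCharge A B).IsHermitian :=
  (isHermitian_kronecker hA isHermitian_one).add (isHermitian_kronecker isHermitian_one hB)

theorem jointCharge_mulVec_apply {a b : Type*} [Fintype a] [DecidableEq a] [Fintype b]
    [DecidableEq b] (A : Matrix a a ℂ) (B : Matrix b b ℂ) (f : a × b → ℂ) (x : a) (y : b) :
    ∑ s, jointCharge A B (x, y) s * f s = ∑ x', A x x' * f (x', y) + ∑ y', B y y' * f (x, y') := by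
  simp only [jointCharge, Matrix.add_apply, add_mul, Finset.sum_add_distrib]
  congr 1
  · simp [Fintype.sum_prod_type, Matrix.one_apply]
  · rw [Fintype.sum_prod_type, Finset.sum_eq_single x]
    · simp
    · intro x' _ hx'
      simp [Matrix.one_apply_ne hx'.symm]
    · simp

theorem jointCharge_submatrix {a a' b b' : Type*} [DecidableEq a] [DecidableEq b]
    [DecidableEq a'] [DecidableEq b'] (A : Matrix a a ℂ) (B : Matrix b b ℂ)
    (f : a' ≃ a) (g : b' ≃ b) :
    (jointCharge A B).submatrix (Prod.map f g) (Prod.map f g)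
      = jointCharge (A.submatrix f f) (B.submatrix g g) := by
  ext ⟨x, y⟩ ⟨x', y'⟩
  simp [jointCharge, Matrix.one_apply, f.injective.eq_iff, g.injective.eq_iff]

theorem jointCharge_assoc {a b c : Type*} [DecidableEq a] [DecidableEq b] [DecidableEq c]
    (A : Matrix a a ℂ) (B : Matrix b b ℂ) (C : Matrix c c ℂ) (x x' : a) (y y' : b) (z z' : c) :
    jointCharge A (jointCharge B C) (x, (y, z)) (x', (y', z'))
      = jointCharge B (jointCharge A C) (y, (x, z)) (y', (x', z')) := by
  simp only [jointCharge, Matrix.add_apply, kronecker_apply, Matrix.one_apply, Prod.mk.injEq]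
  split_ifs <;> (simp_all; try ring)

theorem isHermitian_real_smul_one {n : Type*} [DecidableEq n] (x : ℝ) :
    ((x : ℂ) • (1 : Matrix n n ℂ)).IsHermitian := by
  rw [IsHermitian, conjTranspose_smul, conjTranspose_one, Complex.star_def, Complex.conj_ofReal]

/-- The charge of the auxiliary system `E ⊕ 1`. -/
def auxCharge {e : Type*} [DecidableEq e] (XE : Matrix e e ℂ) (x y : ℝ) :
    Matrix (e ⊕ Unit) (e ⊕ Unit) ℂ :=
  Matrix.fromBlocks (XE - (x : ℂ) • 1) 0 0 (-(y : ℂ) • 1)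

theorem isHermitian_auxCharge {e : Type*} [DecidableEq e] {XE : Matrix e e ℂ}
    (hXE : XE.IsHermitian) (x y : ℝ) : (auxCharge XE x y).IsHermitian := by
  refine Matrix.IsHermitian.fromBlocks (hXE.sub (isHermitian_real_smul_one x)) (by simp) ?_
  have := isHermitian_real_smul_one (n := Unit) (-y)
  rwa [Complex.ofReal_neg] at this

/-! ### Unitary dilation by a charge-preserving reflection -/

section Dilation

variable {a a' e : Type*} [Fintype a] [DecidableEq a] [Fintype a'] [DecidableEq a'] [Fintype e]
  [DecidableEq e]

variable (a e) in
/-- The isometry `ψ ↦ ψ ⊗ (q ⊗ 0)` adjoining the initial state of the bath `A' ⊗ (E ⊕ 1)`. -/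
def initialIsometry (q : a' → ℂ) : Matrix (a × (a' × (e ⊕ Unit))) a ℂ :=
  Matrix.of fun s i => if s.1 = i then q s.2.1 * Sum.elim (fun _ => 0) (fun _ => 1) s.2.2 else 0

/-- The Stinespring isometry, with the environment embedded as `j ⊗ E`. -/
def finalIsometry (j : a → ℂ) (K : e → Matrix a' a ℂ) :
    Matrix (a × (a' × (e ⊕ Unit))) a ℂ :=
  Matrix.of fun s i => j s.1 * Sum.elim (fun x => K x s.2.1 i) (fun _ => 0) s.2.2

/-- The initial state vector of the bath. -/
def bathVec (e : Type*) {a' : Type*} (q : a' → ℂ) : a' × (e ⊕ Unit) → ℂ :=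
  fun s => q s.1 * Sum.elim (fun _ => 0) (fun _ => 1) s.2

variable {q : a' → ℂ} {j : a → ℂ} {K : e → Matrix a' a ℂ}

theorem initial_conjTranspose_mul_initial (hq : IsUnitVec q) :
    (initialIsometry a e q)ᴴ * initialIsometry a e q = 1 := by
  ext i i'
  have hq' : ∑ x, star (q x) * q x = 1 := hq
  simp only [Matrix.mul_apply, conjTranspose_apply, initialIsometry, Matrix.of_apply,
    Fintype.sum_prod_type, Fintype.sum_sum_type, Matrix.one_apply]
  rw [Finset.sum_eq_single i]
  · by_cases h : i = i'
    · subst h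
      simpa using hq'
    · simp [h]
  · intro x _ hx
    simp [hx]
  · simp

theorem final_conjTranspose_mul_final (hj : IsUnitVec j) (K : e → Matrix a' a ℂ) :
    (finalIsometry j K)ᴴ * finalIsometry j K = ∑ x, (K x)ᴴ * K x := by
  have hj' : ∑ x, star (j x) * j x = 1 := hj
  ext i i'
  simp only [Matrix.mul_apply, conjTranspose_apply, finalIsometry, Matrix.of_apply,
    Fintype.sum_prod_type, Fintype.sum_sum_type, Matrix.sum_apply, Sum.elim_inl, Sum.elim_inr,
    mul_zero, Finset.sum_const_zero, add_zero]
  have h : ∀ l r x, star (j l * K x r i) * (j l * K x r i')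
      = star (j l) * j l * (star (K x r i) * K x r i') := fun l r x => by
    rw [star_mul']; ring
  simp only [h, ← Finset.mul_sum]
  rw [← Finset.sum_mul, hj', one_mul, Finset.sum_comm]

/-- The initial vectors occupy the extra level of E ⊕ 1, the final ones the summand E. This
orthogonality is the purpose of the extra level. -/
theorem initial_conjTranspose_mul_final :
    (initialIsometry a e q)ᴴ * finalIsometry j K = 0 := by
  ext i i'
  simp [Matrix.mul_apply, initialIsometry, finalIsometry, Fintype.sum_prod_type]

/-- The charge -y of the extra level cancels the charge y of q, so only X_A remains. -/
theorem jointCharge_mul_initial {XA : Matrix a a ℂ} {XA' : Matrix a' a' ℂ} {XE : Matrix e e ℂ}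
    {x y : ℝ} (hq : XA' *ᵥ q = (y : ℂ) • q) :
    jointCharge XA (jointCharge XA' (auxCharge XE x y)) * initialIsometry a e q
      = initialIsometry a e q * XA := by
  ext ⟨l, r, w⟩ i
  have hq' : ∀ r, ∑ r', XA' r r' * q r' = y * q r := fun r => congrFun hq r
  rw [Matrix.mul_apply, jointCharge_mulVec_apply, jointCharge_mulVec_apply, Matrix.mul_apply]
  rcases w with w | w
  · simp [initialIsometry, auxCharge]
  · by_cases h : l = i
    · subst h
      simp [initialIsometry, auxCharge, hq']
      ring
    · simp [initialIsometry, auxCharge, h]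
      ring

/-- The shift by -x on E cancels the charge x of j; what remains is the balance satisfied by the
Kraus operators. -/
theorem jointCharge_mul_final {XA : Matrix a a ℂ} {XA' : Matrix a' a' ℂ} {XE : Matrix e e ℂ}
    {x y : ℝ} (hj : XA *ᵥ j = (x : ℂ) • j)
    (hK : ∀ x, XA' * K x + ∑ y, XE x y • K y = K x * XA) :
    jointCharge XA (jointCharge XA' (auxCharge XE x y)) * finalIsometry j K
      = finalIsometry j K * XA := by
  ext ⟨l, r, w⟩ i
  have hj' : ∀ r, ∑ r', XA r r' * j r' = x * j r := fun r => congrFun hj r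
  rw [Matrix.mul_apply, jointCharge_mulVec_apply, jointCharge_mulVec_apply, Matrix.mul_apply]
  rcases w with w | w
  · have hK' := congrFun (congrFun (hK w) r) i
    simp only [Matrix.add_apply, Matrix.mul_apply, Matrix.sum_apply, Matrix.smul_apply,
      smul_eq_mul] at hK'
    simp only [finalIsometry, auxCharge, Matrix.of_apply, Sum.elim_inl, Fintype.sum_sum_type,
      Sum.elim_inr, mul_zero, Finset.sum_const_zero, add_zero, Matrix.fromBlocks_apply₁₁,
      Matrix.sub_apply, Matrix.smul_apply, Matrix.one_apply, smul_eq_mul, sub_mul,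
      Finset.sum_sub_distrib]
    simp only [mul_ite, mul_one, mul_zero, ite_mul, zero_mul, Finset.sum_ite_eq, Finset.mem_univ,
      if_true]
    simp only [← mul_assoc, ← Finset.sum_mul, hj']
    simp only [mul_comm _ (j l), mul_assoc, ← Finset.mul_sum, ← hK']
    ring
  · simp [finalIsometry, auxCharge]

theorem final_mul_mul_final_apply (M : Matrix a a ℂ) (l l' : a) (r r' : a') (w w' : e ⊕ Unit) :
    (finalIsometry j K * M * (finalIsometry j K)ᴴ) (l, (r, w)) (l', (r', w'))
      = j l * star (j l') *
        Sum.elim (fun x => Sum.elim (fun x' => (K x * M * (K x')ᴴ) r r') (fun _ => 0) w')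
          (fun _ => 0) w := by
  simp only [Matrix.mul_apply, conjTranspose_apply, finalIsometry, Matrix.of_apply]
  rcases w with w | w <;> rcases w' with w' | w' <;>
    simp only [Sum.elim_inl, Sum.elim_inr, mul_zero, zero_mul, star_zero, Finset.sum_const_zero]
  simp only [star_mul', Finset.mul_sum, Finset.sum_mul]
  exact Finset.sum_congr rfl fun _ _ => Finset.sum_congr rfl fun _ _ => by ring

variable (a a' e) in
/-- The reordering of the three subsystems. -/
def reorder : a' × (a × (e ⊕ Unit)) ≃ a × (a' × (e ⊕ Unit)) where
  toFun s := (s.2.1, (s.1, s.2.2))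
  invFun s := (s.2.1, (s.1, s.2.2))
  left_inv _ := rfl
  right_inv _ := rfl

theorem traceSnd_final (hj : IsUnitVec j) (M : Matrix a a ℂ) :
    traceSnd ((finalIsometry j K * M * (finalIsometry j K)ᴴ).submatrix (reorder a a' e)
      (reorder a a' e)) = ∑ x, K x * M * (K x)ᴴ := by
  have hj' : ∑ x, star (j x) * j x = 1 := hj
  ext r r'
  simp only [traceSnd, Matrix.of_apply, Matrix.submatrix_apply, reorder, Equiv.coe_fn_mk,
    final_mul_mul_final_apply, Fintype.sum_prod_type, Fintype.sum_sum_type, Sum.elim_inl,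
    Sum.elim_inr, mul_zero, Finset.sum_const_zero, add_zero, Matrix.sum_apply]
  simp only [← Finset.mul_sum, ← Finset.sum_mul, mul_comm (j _), hj', one_mul]

/-- The reflection exchanging the ranges of the two isometries. -/
def exchange (q : a' → ℂ) (j : a → ℂ) (K : e → Matrix a' a ℂ) :
    Matrix (a × (a' × (e ⊕ Unit))) (a × (a' × (e ⊕ Unit))) ℂ :=
  1 - (finalIsometry j K - initialIsometry a e q) *
    (finalIsometry j K - initialIsometry a e q)ᴴ

theorem exchange_conjTranspose : (exchange q j K)ᴴ = exchange q j K := by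
  simp [exchange]

theorem final_conjTranspose_mul_initial :
    (finalIsometry j K)ᴴ * initialIsometry a e q = 0 := by
  have h := congrArg conjTranspose (initial_conjTranspose_mul_final (q := q) (j := j) (K := K))
  simpa [conjTranspose_mul] using h

/-- The difference D of two isometries with orthogonal ranges satisfies D†D = 2, so DD†/2 is a
projection and 1 - DD† a reflection. -/
theorem exchange_mul_self (hq : IsUnitVec q) (hj : IsUnitVec j) (hK : ∑ x, (K x)ᴴ * K x = 1) :
    exchange q j K * exchange q j K = 1 := by
  have h1 := initial_conjTranspose_mul_initial (a := a) (e := e) hq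
  have h2 := (final_conjTranspose_mul_final hj K).trans hK
  have h3 := initial_conjTranspose_mul_final (q := q) (j := j) (K := K)
  have h4 := final_conjTranspose_mul_initial (q := q) (j := j) (K := K)
  rw [exchange]
  set D := finalIsometry j K - initialIsometry a e q with hD
  have hDD : Dᴴ * D = 1 + 1 := by
    rw [hD, conjTranspose_sub, Matrix.sub_mul, Matrix.mul_sub, Matrix.mul_sub, h1, h2, h3, h4]
    simp
  have : D * Dᴴ * (D * Dᴴ) = 2 • (D * Dᴴ) := by
    rw [Matrix.mul_assoc, ← Matrix.mul_assoc Dᴴ, hDD, two_smul, Matrix.add_mul, Matrix.mul_add,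
      Matrix.one_mul]
  rw [Matrix.sub_mul, Matrix.mul_sub, Matrix.mul_sub, this]
  simp only [Matrix.one_mul, Matrix.mul_one, two_smul]
  abel

theorem exchange_mul_initial (hq : IsUnitVec q) :
    exchange q j K * initialIsometry a e q = finalIsometry j K := by
  have h : (finalIsometry j K - initialIsometry a e q)ᴴ * initialIsometry a e q = -1 := by
    rw [conjTranspose_sub, Matrix.sub_mul, initial_conjTranspose_mul_initial hq,
      final_conjTranspose_mul_initial, zero_sub]
  rw [exchange, Matrix.sub_mul 1, Matrix.one_mul, Matrix.mul_assoc, h]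
  simp

/-- Both isometries intertwine the total charge with the same X_A, hence so does their difference D,
and DD† commutes with the total charge. -/
theorem exchange_commute {XA : Matrix a a ℂ} {XA' : Matrix a' a' ℂ} {XE : Matrix e e ℂ}
    (hXA : XA.IsHermitian) (hXA' : XA'.IsHermitian) (hXE : XE.IsHermitian)
    {x y : ℝ} (hj : XA *ᵥ j = (x : ℂ) • j) (hq : XA' *ᵥ q = (y : ℂ) • q)
    (hK : ∀ x, XA' * K x + ∑ y, XE x y • K y = K x * XA) :
    jointCharge XA (jointCharge XA' (auxCharge XE x y)) * exchange q j K
      = exchange q j K * jointCharge XA (jointCharge XA' (auxCharge XE x y)) := by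
  have h1 := jointCharge_mul_initial (a := a) (XA := XA) (XE := XE) (x := x) hq
  have h2 := jointCharge_mul_final (y := y) hj hK
  have hG : (jointCharge XA (jointCharge XA' (auxCharge XE x y))).IsHermitian :=
    isHermitian_jointCharge hXA (isHermitian_jointCharge hXA' (isHermitian_auxCharge hXE x y))
  rw [exchange]
  set G := jointCharge XA (jointCharge XA' (auxCharge XE x y))
  set D := finalIsometry j K - initialIsometry a e q with hD
  have hGD : G * D = D * XA := by rw [hD, Matrix.mul_sub, h1, h2, Matrix.sub_mul]
  have hDG : Dᴴ * G = XA * Dᴴ := by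
    have := congrArg conjTranspose hGD
    rwa [conjTranspose_mul, conjTranspose_mul, hG.eq, hXA.eq] at this
  rw [Matrix.mul_sub G, Matrix.sub_mul 1, Matrix.mul_one, Matrix.one_mul, ← Matrix.mul_assoc, hGD,
    Matrix.mul_assoc, Matrix.mul_assoc, hDG]

theorem kronecker_proj_bathVec (M : Matrix a a ℂ) :
    M ⊗ₖ proj (bathVec e q) = initialIsometry a e q * M * (initialIsometry a e q)ᴴ := by
  ext ⟨l, s⟩ ⟨l', s'⟩
  simp [Matrix.mul_apply, initialIsometry, proj, vecMulVec_apply, bathVec,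
    apply_ite (starRingEnd ℂ)]
  ring

theorem isUnitVec_bathVec (hq : IsUnitVec q) : IsUnitVec (bathVec e q) := by
  have hq' : ∑ x, star (q x) * q x = 1 := hq
  simp only [IsUnitVec, dotProduct, Fintype.sum_prod_type, Fintype.sum_sum_type]
  simpa [bathVec] using hq'

theorem jointCharge_mulVec_bathVec {XA' : Matrix a' a' ℂ} {XE : Matrix e e ℂ} {x y : ℝ}
    (hq : XA' *ᵥ q = (y : ℂ) • q) :
    jointCharge XA' (auxCharge XE x y) *ᵥ bathVec e q = 0 := by
  have hq' : ∀ r, ∑ r', XA' r r' * q r' = y * q r := fun r => congrFun hq r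
  ext ⟨r, w⟩
  rw [mulVec, dotProduct, jointCharge_mulVec_apply]
  rcases w with w | w
  · simp [bathVec, auxCharge]
  · simp [bathVec, auxCharge, hq']

/-- The symmetric realization obtained from a charge-preserving Kraus family. -/
def SymmetricKraus.realization {Φ : Matrix a a ℂ →ₗ[ℂ] Matrix a' a' ℂ} {XA : Matrix a a ℂ}
    {XA' : Matrix a' a' ℂ} {XE : Matrix e e ℂ} (h : SymmetricKraus Φ XA XA' XE K)
    (hXA : XA.IsHermitian) (hXA' : XA'.IsHermitian) {x y : ℝ} (hj : IsUnitEigenvec XA x j)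
    (hq : IsUnitEigenvec XA' y q) :
    SymmetricRealization Φ XA XA' (a' × (e ⊕ Unit)) (a × (e ⊕ Unit)) where
  U := (exchange q j K).submatrix (reorder a a' e) (Equiv.refl _)
  ρB := proj (bathVec e q)
  XB := jointCharge XA' (auxCharge XE x y)
  XB' := jointCharge XA (auxCharge XE x y)
  unitary_left := by
    rw [conjTranspose_submatrix, submatrix_mul_equiv, exchange_conjTranspose,
      exchange_mul_self hq.1 hj.1 h.sum_eq_one, submatrix_one_equiv]
  unitary_right := by
    rw [conjTranspose_submatrix, submatrix_mul_equiv, exchange_conjTranspose,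
      exchange_mul_self hq.1 hj.1 h.sum_eq_one, submatrix_one_equiv]
  isState := isState_proj (isUnitVec_bathVec hq.1)
  hermitian_XB := isHermitian_jointCharge hXA' (isHermitian_auxCharge h.hermitian_XE x y)
  hermitian_XB' := isHermitian_jointCharge hXA (isHermitian_auxCharge h.hermitian_XE x y)
  realizes M := by
    have e1 : (exchange q j K * (M ⊗ₖ proj (bathVec e q)) * exchange q j K)
        = finalIsometry j K * M * (finalIsometry j K)ᴴ := by
      rw [kronecker_proj_bathVec, ← exchange_mul_initial (j := j) (K := K) hq.1, conjTranspose_mul,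
        exchange_conjTranspose]
      simp only [Matrix.mul_assoc]
    have e2 : ((exchange q j K).submatrix (reorder a a' e) (Equiv.refl _))
          * (M ⊗ₖ proj (bathVec e q))
          * ((exchange q j K).submatrix (reorder a a' e) (Equiv.refl _))ᴴ
        = (exchange q j K * (M ⊗ₖ proj (bathVec e q)) * exchange q j K).submatrix
            (reorder a a' e) (reorder a a' e) := by
      rw [conjTranspose_submatrix, exchange_conjTranspose]
      rfl
    rw [e2, e1, traceSnd_final hj.1, h.apply_eq]
  conservation := by
    have e1 : jointCharge XA' (jointCharge XA (auxCharge XE x y))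
        = (jointCharge XA (jointCharge XA' (auxCharge XE x y))).submatrix (reorder a a' e)
            (reorder a a' e) := by
      ext ⟨r, l, w⟩ ⟨r', l', w'⟩
      exact jointCharge_assoc _ _ _ _ _ _ _ _ _
    change jointCharge XA (jointCharge XA' (auxCharge XE x y)) = _ *
      jointCharge XA' (jointCharge XA (auxCharge XE x y)) * _
    rw [e1, conjTranspose_submatrix, submatrix_mul_equiv, submatrix_mul_equiv,
      exchange_conjTranspose, Matrix.mul_assoc,
      exchange_commute hXA hXA' h.hermitian_XE hj.2 hq.2 h.intertwine, ← Matrix.mul_assoc,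
      exchange_mul_self hq.1 hj.1 h.sum_eq_one, Matrix.one_mul]
    rfl
  incoherent := by
    -- The bath vector has charge exactly 0, so both products vanish.
    have h0 := jointCharge_mulVec_bathVec (XE := XE) (x := x) hq.2
    have hH := isHermitian_jointCharge hXA' (isHermitian_auxCharge h.hermitian_XE x y)
    have h1 : star (bathVec e q) ᵥ* jointCharge XA' (auxCharge XE x y)
        = star (jointCharge XA' (auxCharge XE x y) *ᵥ bathVec e q) := by
      rw [star_mulVec, hH.eq]
    rw [mul_proj, proj_mul, h1, h0]
    simp

end Dilation

/-! ### The coherence bound of a realization from a Kraus family -/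

section CoherenceBound

variable {a a' e : Type*} [Fintype a] [DecidableEq a] [Fintype a'] [DecidableEq a'] [Fintype e]
  [DecidableEq e]

/-- The family `x ↦ ∑ y, C x y • K y`. -/
def mix (C : Matrix e e ℂ) (K : e → Matrix a' a ℂ) (x : e) : Matrix a' a ℂ := ∑ y, C x y • K y

theorem sum_mix_conjTranspose_mul_mix (C : Matrix e e ℂ) (K : e → Matrix a' a ℂ) :
    ∑ x, (mix C K x)ᴴ * mix C K x = ∑ y, ∑ y', (Cᴴ * C) y y' • ((K y)ᴴ * K y') := by
  have h : ∀ x, (mix C K x)ᴴ * mix C K x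
      = ∑ y, ∑ y', (star (C x y) * C x y') • ((K y)ᴴ * K y') := fun x => by
    simp only [mix, conjTranspose_sum, conjTranspose_smul, Matrix.sum_mul, Matrix.mul_sum,
      Matrix.smul_mul, Matrix.mul_smul]
    rw [Finset.sum_comm]
    simp only [Finset.smul_sum, smul_smul, mul_comm]
  simp only [h]
  rw [Finset.sum_comm]
  refine Finset.sum_congr rfl fun y _ => ?_
  rw [Finset.sum_comm]
  refine Finset.sum_congr rfl fun y' _ => ?_
  rw [Matrix.mul_apply, Finset.sum_smul]
  rfl

/-- Factoring c - C†C as BB† exhibits the difference as the sum for the family mixed by B†. An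
operator bound on the environment becomes one on the system. -/
theorem posSemidef_sub_sum_mix {C : Matrix e e ℂ} {c : ℂ} (K : e → Matrix a' a ℂ)
    (hC : (c • (1 : Matrix e e ℂ) - Cᴴ * C).PosSemidef) :
    (c • ∑ x, (K x)ᴴ * K x - ∑ x, (mix C K x)ᴴ * mix C K x).PosSemidef := by
  obtain ⟨B, hB⟩ := exists_eq_mul_conjTranspose hC
  have h1 := sum_mix_conjTranspose_mul_mix Bᴴ K
  rw [conjTranspose_conjTranspose, ← hB] at h1
  have h2 : c • ∑ x, (K x)ᴴ * K x - ∑ x, (mix C K x)ᴴ * mix C K x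
      = ∑ x, (mix Bᴴ K x)ᴴ * mix Bᴴ K x := by
    rw [h1, sum_mix_conjTranspose_mul_mix]
    simp only [Matrix.sub_apply, Matrix.smul_apply, Matrix.one_apply, smul_eq_mul, mul_ite,
      mul_one, mul_zero, sub_smul, Finset.sum_sub_distrib, ite_smul, zero_smul,
      Finset.sum_ite_eq, Finset.mem_univ, if_true, Finset.smul_sum]
  rw [h2]
  exact posSemidef_sum _ fun x _ => posSemidef_conjTranspose_mul_self _

/-- On final vectors the charge of j cancels against the shift, so the output bath charge acts as
X_E on the Kraus label alone. -/
theorem one_kronecker_mul_final {XA : Matrix a a ℂ} {XE : Matrix e e ℂ} {x y : ℝ} {j : a → ℂ}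
    (hj : XA *ᵥ j = (x : ℂ) • j) (K : e → Matrix a' a ℂ) :
    ((1 : Matrix a' a' ℂ) ⊗ₖ jointCharge XA (auxCharge XE x y)) *
        (finalIsometry j K).submatrix (reorder a a' e) (Equiv.refl _)
      = (finalIsometry j (mix XE K)).submatrix (reorder a a' e) (Equiv.refl _) := by
  have h0 : (1 : Matrix a' a' ℂ) ⊗ₖ jointCharge XA (auxCharge XE x y)
      = jointCharge 0 (jointCharge XA (auxCharge XE x y)) := by
    simp [jointCharge]
  have hj' : ∀ r, ∑ r', XA r r' * j r' = x * j r := fun r => congrFun hj r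
  rw [h0]
  ext ⟨r, l, w⟩ i
  rw [Matrix.mul_apply, jointCharge_mulVec_apply, jointCharge_mulVec_apply]
  simp only [Matrix.zero_apply, zero_mul, Finset.sum_const_zero, zero_add, Matrix.submatrix_apply,
    reorder, Equiv.coe_fn_mk, Equiv.refl_apply, finalIsometry, Matrix.of_apply]
  rcases w with w | w
  · simp only [auxCharge, Sum.elim_inl, Fintype.sum_sum_type,
      Sum.elim_inr, mul_zero, Finset.sum_const_zero, add_zero, Matrix.fromBlocks_apply₁₁,
      Matrix.sub_apply, Matrix.smul_apply, Matrix.one_apply, smul_eq_mul, sub_mul,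
      Finset.sum_sub_distrib]
    simp only [mul_ite, mul_one, mul_zero, ite_mul, zero_mul, Finset.sum_ite_eq, Finset.mem_univ,
      if_true]
    simp only [← mul_assoc, ← Finset.sum_mul, hj', mix, Matrix.sum_apply, Matrix.smul_apply,
      smul_eq_mul]
    simp only [mul_comm _ (j l), mul_assoc, ← Finset.mul_sum]
    ring
  · simp [auxCharge]

/-- The initial bath charge kills the initial vectors, so the loss there is the environment charge
X_E after U. Its second moment about c is at most δ², and the Fisher information at most four times
that. -/
theorem SymmetricKraus.coherenceBound_le {K : e → Matrix a' a ℂ} {q : a' → ℂ} {j : a → ℂ}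
    {Φ : Matrix a a ℂ →ₗ[ℂ] Matrix a' a' ℂ} {XA : Matrix a a ℂ}
    {XA' : Matrix a' a' ℂ} {XE : Matrix e e ℂ} (h : SymmetricKraus Φ XA XA' XE K)
    (hXA : XA.IsHermitian) (hXA' : XA'.IsHermitian) {x y : ℝ} (hj : IsUnitEigenvec XA x j)
    (hq : IsUnitEigenvec XA' y q) {c δ : ℝ} (hδ : 0 ≤ δ)
    (hc : (((δ ^ 2 : ℝ) : ℂ) • (1 : Matrix e e ℂ)
      - (XE - (c : ℂ) • 1) * (XE - (c : ℂ) • 1)).PosSemidef)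
    {κ : Type*} (ρ : κ → Matrix a a ℂ) :
    coherenceBound (h.realization hXA hXA' hj hq) ρ ≤ 2 * δ := by
  set I := h.realization hXA hXA' hj hq with hI
  refine Real.sSup_le ?_ (by positivity)
  rintro _ ⟨σ, hσ, -, rfl⟩
  refine Real.sqrt_le_iff.2 ⟨by positivity, ?_⟩
  have hN := I.isHermitian_loss hXA hXA'
  have hps : (σ ⊗ₖ I.ρB).PosSemidef := hσ.1.kronecker I.isState.1
  refine (qfi_le hps hN c).trans ?_
  set T := initialIsometry a e q with hT
  set N' := I.loss - (c : ℂ) • (1 : Matrix (a × (a' × (e ⊕ Unit))) (a × (a' × (e ⊕ Unit))) ℂ)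
    with hN'
  have hN'H : N'.IsHermitian := hN.sub (isHermitian_real_smul_one c)
  set C := XE - (c : ℂ) • (1 : Matrix e e ℂ) with hC
  have hCH : Cᴴ = C := (h.hermitian_XE.sub (isHermitian_real_smul_one c)).eq
  have hUT : I.U * T = (finalIsometry j K).submatrix (reorder a a' e) (Equiv.refl _) := by
    rw [← exchange_mul_initial (q := q) hq.1]
    rfl
  have hBT : ((1 : Matrix a a ℂ) ⊗ₖ I.XB) * T = 0 := by
    have h0 : (1 : Matrix a a ℂ) ⊗ₖ I.XB
        = jointCharge 0 (jointCharge XA' (auxCharge XE x y)) := by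
      change (1 : Matrix a a ℂ) ⊗ₖ jointCharge XA' (auxCharge XE x y) = _
      simp [jointCharge]
    rw [h0, jointCharge_mul_initial (XA := (0 : Matrix a a ℂ)) hq.2, Matrix.mul_zero]
  have hNT : N' * T
      = I.Uᴴ * (finalIsometry j (mix C K)).submatrix (reorder a a' e) (Equiv.refl _) := by
    have hmix : finalIsometry j (mix C K)
        = finalIsometry j (mix XE K) - (c : ℂ) • finalIsometry j K := by
      ext ⟨l, r, w⟩ i
      rcases w with w | w
      · simp [finalIsometry, mix, hC, Matrix.sum_apply, Matrix.one_apply, sub_mul,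
          Finset.sum_sub_distrib, mul_sub]
        ring
      · simp [finalIsometry]
    have e1 : T = I.Uᴴ * (finalIsometry j K).submatrix (reorder a a' e) (Equiv.refl _) := by
      rw [← hUT, ← Matrix.mul_assoc, I.unitary_left, Matrix.one_mul]
    have e2 : I.loss * T
        = I.Uᴴ * (finalIsometry j (mix XE K)).submatrix (reorder a a' e) (Equiv.refl _) := by
      rw [I.loss_eq, Matrix.sub_mul, hBT, sub_zero, Matrix.mul_assoc, hUT, Matrix.mul_assoc]
      congr 1
      exact one_kronecker_mul_final hj.2 K
    rw [hN', Matrix.sub_mul, e2, Matrix.smul_mul, Matrix.one_mul]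
    nth_rw 1 [e1]
    rw [← Matrix.mul_smul, ← Matrix.mul_sub, hmix]
    rfl
  have htr : ((σ ⊗ₖ I.ρB) * (N' * N')).trace
      = (σ * ∑ x, (mix C K x)ᴴ * mix C K x).trace := by
    have e1 : σ ⊗ₖ I.ρB = T * σ * Tᴴ := kronecker_proj_bathVec σ
    have e2 : (N' * T)ᴴ * (N' * T) = ∑ x, (mix C K x)ᴴ * mix C K x := by
      rw [hNT, conjTranspose_mul, conjTranspose_conjTranspose, Matrix.mul_assoc,
        ← Matrix.mul_assoc I.U, I.unitary_right, Matrix.one_mul, conjTranspose_submatrix,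
        submatrix_mul_equiv, final_conjTranspose_mul_final hj.1]
      rfl
    rw [e1, ← e2, conjTranspose_mul, hN'H.eq, Matrix.mul_assoc, Matrix.mul_assoc,
      Matrix.trace_mul_comm]
    simp only [Matrix.mul_assoc]
  rw [htr]
  have hle := posSemidef_sub_sum_mix (C := C) K (by rw [hCH]; exact hc)
  have := trace_mul_mono hσ.1 hle
  rw [h.sum_eq_one, Matrix.mul_smul, Matrix.mul_one, trace_smul, hσ.2, smul_eq_mul, mul_one,
    Complex.ofReal_re] at this
  nlinarith

end CoherenceBound

/-! ### Existence of symmetric realizations -/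

/-- Relabelling the bases of the bath. -/
def SymmetricRealization.reindex {a a' b b' c c' : Type*} [Fintype a] [DecidableEq a]
    [Fintype a'] [DecidableEq a'] [Fintype b] [DecidableEq b] [Fintype b'] [DecidableEq b']
    [Fintype c] [DecidableEq c] [Fintype c'] [DecidableEq c']
    {Φ : Matrix a a ℂ →ₗ[ℂ] Matrix a' a' ℂ} {XA : Matrix a a ℂ} {XA' : Matrix a' a' ℂ}
    (I : SymmetricRealization Φ XA XA' b b') (f : c ≃ b) (f' : c' ≃ b') :
    SymmetricRealization Φ XA XA' c c' where
  U := I.U.submatrix ((Equiv.refl a').prodCongr f') ((Equiv.refl a).prodCongr f)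
  ρB := I.ρB.submatrix f f
  XB := I.XB.submatrix f f
  XB' := I.XB'.submatrix f' f'
  unitary_left := by
    rw [conjTranspose_submatrix, submatrix_mul_equiv, I.unitary_left, submatrix_one_equiv]
  unitary_right := by
    rw [conjTranspose_submatrix, submatrix_mul_equiv, I.unitary_right, submatrix_one_equiv]
  isState := ⟨I.isState.1.submatrix f, by
    rw [← I.isState.2, Matrix.trace, Matrix.trace, ← Equiv.sum_comp f]; rfl⟩
  hermitian_XB := I.hermitian_XB.submatrix f
  hermitian_XB' := I.hermitian_XB'.submatrix f'
  realizes M := by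
    have h : M ⊗ₖ I.ρB.submatrix f f = (M ⊗ₖ I.ρB).submatrix ((Equiv.refl a).prodCongr f)
        ((Equiv.refl a).prodCongr f) := rfl
    rw [h, conjTranspose_submatrix, submatrix_mul_equiv, submatrix_mul_equiv, I.realizes]
    ext i j
    simp only [traceSnd, Matrix.of_apply, Matrix.submatrix_apply]
    rw [← Equiv.sum_comp f']
    rfl
  conservation := by
    have h := jointCharge_submatrix XA I.XB (Equiv.refl a) f
    have h' := jointCharge_submatrix XA' I.XB' (Equiv.refl a') f'
    have hc := congrArg (fun M => M.submatrix ((Equiv.refl a).prodCongr f)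
      ((Equiv.refl a).prodCongr f)) I.conservation
    change jointCharge (XA.submatrix (Equiv.refl a) (Equiv.refl a)) (I.XB.submatrix f f)
      = _ * jointCharge (XA'.submatrix (Equiv.refl a') (Equiv.refl a')) (I.XB'.submatrix f' f') * _
    rw [← h, ← h']
    refine hc.trans ?_
    rw [conjTranspose_submatrix]
    have e : (jointCharge XA' I.XB').submatrix (Prod.map (Equiv.refl a') f')
        (Prod.map (Equiv.refl a') f') = (jointCharge XA' I.XB').submatrix
          ((Equiv.refl a').prodCongr f') ((Equiv.refl a').prodCongr f') := rfl
    rw [e, submatrix_mul_equiv, submatrix_mul_equiv]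
    rfl
  incoherent := by
    rw [submatrix_mul_equiv, submatrix_mul_equiv, I.incoherent]

theorem SymmetricRealization.exists_fin {a a' b b' : Type*} [Fintype a] [DecidableEq a]
    [Fintype a'] [DecidableEq a'] [Fintype b] [DecidableEq b] [Fintype b'] [DecidableEq b']
    {Φ : Matrix a a ℂ →ₗ[ℂ] Matrix a' a' ℂ} {XA : Matrix a a ℂ} {XA' : Matrix a' a' ℂ}
    (I : SymmetricRealization Φ XA XA' b b') :
    ∃ m n : ℕ, Nonempty (SymmetricRealization Φ XA XA' (Fin m) (Fin n)) :=
  ⟨_, _, ⟨I.reindex (Fintype.equivFin b).symm (Fintype.equivFin b').symm⟩⟩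

theorem exists_isUnitEigenvec {a : Type*} [Fintype a] [DecidableEq a] [Nonempty a]
    {X : Matrix a a ℂ} (hX : X.IsHermitian) : ∃ x v, IsUnitEigenvec X x v :=
  ⟨_, _, isUnitVec_eigenvectorBasis hX (Classical.arbitrary a), mulVec_eigenvectorBasis' hX _⟩

theorem SymmetricKraus.exists_realization {a a' e : Type*} [Fintype a] [DecidableEq a]
    [Nonempty a] [Fintype a'] [DecidableEq a'] [Nonempty a'] [Fintype e] [DecidableEq e]
    {K : e → Matrix a' a ℂ} {Φ : Matrix a a ℂ →ₗ[ℂ] Matrix a' a' ℂ} {XA : Matrix a a ℂ}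
    {XA' : Matrix a' a' ℂ} {XE : Matrix e e ℂ} (h : SymmetricKraus Φ XA XA' XE K)
    (hXA : XA.IsHermitian) (hXA' : XA'.IsHermitian) :
    ∃ m n : ℕ, Nonempty (SymmetricRealization Φ XA XA' (Fin m) (Fin n)) := by
  obtain ⟨x, j, hj⟩ := exists_isUnitEigenvec hXA
  obtain ⟨y, q, hq⟩ := exists_isUnitEigenvec hXA'
  exact (h.realization hXA hXA' hj hq).exists_fin

/-! ### Covariant maps -/

/-- The derivative of the covariance condition. -/
def IsInfinitesimallyCovariant {a b : Type*} [Fintype a] [Fintype b]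
    (Φ : Matrix a a ℂ →ₗ[ℂ] Matrix b b ℂ) (XA : Matrix a a ℂ) (XA' : Matrix b b ℂ) : Prop :=
  ∀ M, Φ (XA * M - M * XA) = XA' * Φ M - Φ M * XA'

theorem IsInfinitesimallyCovariant.comp {a b c : Type*} [Fintype a] [Fintype b] [Fintype c]
    {Φ : Matrix a a ℂ →ₗ[ℂ] Matrix b b ℂ} {Ψ : Matrix b b ℂ →ₗ[ℂ] Matrix c c ℂ}
    {XA : Matrix a a ℂ} {XB : Matrix b b ℂ} {XC : Matrix c c ℂ}
    (hΨ : IsInfinitesimallyCovariant Ψ XB XC) (hΦ : IsInfinitesimallyCovariant Φ XA XB) :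
    IsInfinitesimallyCovariant (Ψ ∘ₗ Φ) XA XC := fun M => by
  rw [LinearMap.comp_apply, hΦ, hΨ, LinearMap.comp_apply]

open scoped Matrix.Norms.Operator in
theorem hasDerivAt_conj_exp {a : Type*} [Fintype a] [DecidableEq a] (X M : Matrix a a ℂ) :
    HasDerivAt (fun θ : ℝ => NormedSpace.exp ((θ * Complex.I) • X) * M *
      NormedSpace.exp (-(θ * Complex.I) • X)) (Complex.I • (X * M - M * X)) 0 := by
  have h1 := hasDerivAt_exp_smul_const (𝕂 := ℝ) (Complex.I • X) (0 : ℝ)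
  have h2 := hasDerivAt_exp_smul_const (𝕂 := ℝ) (-(Complex.I • X)) (0 : ℝ)
  have h := (h1.mul_const M).mul h2
  have e1 : ∀ θ : ℝ, θ • (Complex.I • X) = (θ * Complex.I) • X := fun θ => by
    ext i j; simp [mul_assoc]
  have e2 : ∀ θ : ℝ, θ • (-(Complex.I • X)) = (-(θ * Complex.I)) • X := fun θ => by
    ext i j; simp [mul_assoc]
  simp only [zero_smul, NormedSpace.exp_zero, Matrix.one_mul, Matrix.mul_one] at h
  have hf : (fun θ : ℝ => NormedSpace.exp ((θ * Complex.I) • X) * M *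
      NormedSpace.exp (-(θ * Complex.I) • X)) = (fun θ : ℝ =>
        NormedSpace.exp (θ • (Complex.I • X)) * M) * fun θ : ℝ =>
          NormedSpace.exp (θ • (-(Complex.I • X))) := by
    funext θ
    simp only [Pi.mul_apply, e1, e2]
  have hd : Complex.I • (X * M - M * X) = Complex.I • X * M + M * (-(Complex.I • X)) := by
    rw [smul_sub, Matrix.smul_mul, Matrix.mul_neg, Matrix.mul_smul, sub_eq_add_neg]
  rw [hf, hd]
  exact h

open scoped Matrix.Norms.Operator in
-- Differentiate both sides at θ = 0 and cancel the factor i.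
theorem IsCovariant.infinitesimal {a b : Type*} [Fintype a] [DecidableEq a] [Fintype b]
    [DecidableEq b] {Φ : Matrix a a ℂ →ₗ[ℂ] Matrix b b ℂ} {XA : Matrix a a ℂ}
    {XA' : Matrix b b ℂ} (h : IsCovariant Φ XA XA') : IsInfinitesimallyCovariant Φ XA XA' := by
  intro M
  have h1 := hasDerivAt_conj_exp XA M
  have h2 := hasDerivAt_conj_exp XA' (Φ M)
  have h3 := (LinearMap.toContinuousLinearMap (Φ.restrictScalars ℝ)).hasFDerivAt.comp_hasDerivAt
    (0 : ℝ) h1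
  have h4 := h3.unique (h2.congr_of_eventuallyEq (Filter.Eventually.of_forall fun θ => h θ M))
  have h5 : Φ (Complex.I • (XA * M - M * XA)) = Complex.I • (XA' * Φ M - Φ M * XA') := h4
  rw [map_smul] at h5
  exact smul_right_injective _ Complex.I_ne_zero h5

/-! ### Covariant Kraus families from the Choi matrix -/

section Choi

variable {a a' : Type*} [Fintype a] [DecidableEq a] [Fintype a'] [DecidableEq a']

/-- The Choi matrix. -/
def choi (Φ : Matrix a a ℂ →ₗ[ℂ] Matrix a' a' ℂ) : Matrix (a × a') (a × a') ℂ :=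
  Matrix.of fun s t => Φ (Matrix.single s.1 t.1 1) s.2 t.2

theorem apply_eq_sum_choi (Φ : Matrix a a ℂ →ₗ[ℂ] Matrix a' a' ℂ) (M : Matrix a a ℂ) (r r' : a') :
    Φ M r r' = ∑ i, ∑ j, M i j * choi Φ (i, r) (j, r') := by
  conv_lhs => rw [Matrix.matrix_eq_sum_single M]
  simp only [map_sum, Matrix.sum_apply]
  refine Finset.sum_congr rfl fun i _ => Finset.sum_congr rfl fun j _ => ?_
  have h : (Matrix.single i j (M i j) : Matrix a a ℂ) = M i j • Matrix.single i j 1 := by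
    rw [Matrix.smul_single, smul_eq_mul, mul_one]
  rw [h, map_smul, Matrix.smul_apply, smul_eq_mul]
  rfl

/-- Up to relabelling, this Choi matrix is the amplified channel applied to the projector of the
unnormalised vector Σ |i⟩ ⊗ V|i⟩. -/
theorem posSemidef_choi_comp_encode {p : Type*} [Fintype p] [DecidableEq p]
    {Ψ : Matrix p p ℂ →ₗ[ℂ] Matrix a' a' ℂ} (hΨ : IsChannel Ψ) (V : Matrix p a ℂ) :
    (choi (Ψ ∘ₗ encode V)).PosSemidef := by
  set f := Fintype.equivFin a
  have h := hΨ.completelyPositive (Fintype.card a)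
    (proj fun s : Fin (Fintype.card a) × p => V s.2 (f.symm s.1)) (posSemidef_proj _)
  have e : choi (Ψ ∘ₗ encode V) = (amplify Ψ (Fintype.card a)
      (proj fun s : Fin (Fintype.card a) × p => V s.2 (f.symm s.1))).submatrix
        (Prod.map f id) (Prod.map f id) := by
    ext ⟨i, r⟩ ⟨j, r'⟩
    simp only [choi, amplify, Matrix.of_apply, LinearMap.comp_apply, Matrix.submatrix_apply,
      Prod.map_apply, id]
    have he : encode V (Matrix.single i j 1) = Matrix.of fun x y =>
        proj (fun s : Fin (Fintype.card a) × p => V s.2 (f.symm s.1)) (f i, x) (f j, y) := by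
      ext x y
      simp [encode, proj, vecMulVec_apply, Matrix.mul_apply, Matrix.single_apply, ite_and,
        Finset.sum_ite_eq]
    rw [he]
  rw [e]
  exact h.submatrix _

/-- Infinitesimal covariance evaluated on matrix units; the input side acquires a transpose and a
sign. -/
theorem choi_commute {Φ : Matrix a a ℂ →ₗ[ℂ] Matrix a' a' ℂ} {XA : Matrix a a ℂ}
    {XA' : Matrix a' a' ℂ} (h : IsInfinitesimallyCovariant Φ XA XA') :
    Commute (choi Φ) (jointCharge (-XAᵀ) XA') := by
  ext ⟨i, r⟩ ⟨j, r'⟩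
  have h1 := congrFun (congrFun (h (Matrix.single i j 1)) r) r'
  have e1 : XA * Matrix.single i j 1 = ∑ i', XA i' i • Matrix.single i' j (1 : ℂ) := by
    ext x y
    simp [Matrix.mul_apply, Matrix.sum_apply, Matrix.single_apply, ite_and]
  have e2 : Matrix.single i j 1 * XA = ∑ j', XA j j' • Matrix.single i j' (1 : ℂ) := by
    ext x y
    simp [Matrix.mul_apply, Matrix.sum_apply, Matrix.single_apply, ite_and]
  rw [e1, e2, map_sub, map_sum, map_sum] at h1
  simp only [map_smul, Matrix.sub_apply, Matrix.sum_apply, Matrix.smul_apply, smul_eq_mul,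
    Matrix.mul_apply] at h1
  have g1 : (jointCharge (-XAᵀ) XA' * choi Φ) (i, r) (j, r')
      = -∑ i', XA i' i * choi Φ (i', r) (j, r') + ∑ x, XA' r x * choi Φ (i, x) (j, r') := by
    rw [Matrix.mul_apply, jointCharge_mulVec_apply]
    simp
  have g2 : (choi Φ * jointCharge (-XAᵀ) XA') (i, r) (j, r')
      = -∑ j', XA j j' * choi Φ (i, r) (j', r') + ∑ x, choi Φ (i, r) (j, x) * XA' x r' := by
    have ht : ∀ s t, jointCharge (-XAᵀ) XA' s t = jointCharge (-XA) XA'ᵀ t s := fun s t => by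
      simp [jointCharge, Matrix.one_apply, eq_comm]
    rw [Matrix.mul_apply]
    simp only [ht, mul_comm (choi Φ (i, r) _)]
    rw [jointCharge_mulVec_apply]
    simp
  rw [g1, g2]
  simp only [choi, Matrix.of_apply]
  linear_combination h1

/-- The columns of the square root s of the Choi matrix are Kraus operators. Since s is a function
of the Choi matrix it commutes with the charge G, and Gs = sG read column by column is the
intertwining relation with environment charge -Gᵀ. -/
theorem exists_symmetricKraus {Φ : Matrix a a ℂ →ₗ[ℂ] Matrix a' a' ℂ} {XA : Matrix a a ℂ}
    {XA' : Matrix a' a' ℂ} (hXA : XA.IsHermitian) (hXA' : XA'.IsHermitian)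
    (hC : (choi Φ).PosSemidef) (hT : ∀ M, (Φ M).trace = M.trace)
    (h : IsInfinitesimallyCovariant Φ XA XA') :
    ∃ (XE : Matrix (a × a') (a × a') ℂ) (K : a × a' → Matrix a' a ℂ),
      SymmetricKraus Φ XA XA' XE K := by
  set G := jointCharge (-XAᵀ) XA' with hG
  set s := cfc Real.sqrt (choi Φ) with hs
  have hss : s * s = choi Φ := cfc_sqrt_mul_self hC
  have hsH : s.IsHermitian := isHermitian_cfc _ _
  have hGs : G * s = s * G := by
    open scoped Matrix.Norms.L2Operator in
    exact ((choi_commute h).cfc_real Real.sqrt).eq.symm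
  have hGH : G.IsHermitian := isHermitian_jointCharge hXA.transpose.neg hXA'
  set K : a × a' → Matrix a' a ℂ := fun x => Matrix.of fun r i => s (i, r) x with hK
  have happ : ∀ M, Φ M = ∑ x, K x * M * (K x)ᴴ := by
    intro M
    ext r r'
    rw [apply_eq_sum_choi, Matrix.sum_apply]
    simp only [← hss, Matrix.mul_apply, conjTranspose_apply, hK, Matrix.of_apply, Finset.mul_sum,
      Finset.sum_mul]
    have e : ∀ i j x, M i j * (s (i, r) x * s x (j, r')) = s (i, r) x * M i j * star (s (j, r') x) :=
      fun i j x => by rw [hsH.apply]; ring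
    simp only [e]
    rw [Finset.sum_comm]
    simp_rw [Finset.sum_comm (s := Finset.univ (α := a)) (t := Finset.univ (α := a × a'))]
  refine ⟨-Gᵀ, K, hGH.transpose.neg, happ, ?_, fun x => ?_⟩
  · rw [Matrix.ext_iff_trace_mul_right]
    intro M
    rw [Matrix.one_mul, ← hT M, Matrix.sum_mul, trace_sum, happ M, trace_sum]
    refine Finset.sum_congr rfl fun x _ => ?_
    rw [Matrix.mul_assoc, Matrix.trace_mul_comm]
  · ext r i
    have h1 := congrFun (congrFun hGs (i, r)) x
    rw [Matrix.mul_apply, jointCharge_mulVec_apply, Matrix.mul_apply] at h1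
    simp only [Matrix.add_apply, Matrix.mul_apply, Matrix.sum_apply, Matrix.smul_apply,
      Matrix.neg_apply, Matrix.transpose_apply, smul_eq_mul, hK, Matrix.of_apply, neg_mul,
      Finset.sum_neg_distrib] at h1 ⊢
    simp only [mul_comm (G _ x), mul_comm (s (_, r) x)]
    linear_combination h1

theorem exists_realization_of_covariant [Nonempty a] {Φ : Matrix a a ℂ →ₗ[ℂ] Matrix a' a' ℂ}
    {XA : Matrix a a ℂ} {XA' : Matrix a' a' ℂ} (hXA : XA.IsHermitian) (hXA' : XA'.IsHermitian)
    (hC : (choi Φ).PosSemidef) (hT : ∀ M, (Φ M).trace = M.trace)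
    (h : IsInfinitesimallyCovariant Φ XA XA') :
    ∃ m n : ℕ, Nonempty (SymmetricRealization Φ XA XA' (Fin m) (Fin n)) := by
  -- Trace preservation excludes an empty output space.
  have : Nonempty a' := by
    by_contra hne
    rw [not_nonempty_iff] at hne
    have h1 := hT (Matrix.single (Classical.arbitrary a) (Classical.arbitrary a) 1)
    rw [Matrix.trace_single_eq_same] at h1
    simp [Matrix.trace] at h1
  obtain ⟨XE, K, hK⟩ := exists_symmetricKraus hXA hXA' hC hT h
  exact hK.exists_realization hXA hXA'

end Choi

/-! ### Resetting a subsystem whose label is recorded in a memory -/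

section Reset

variable {N : ℕ} {p : Fin N → Type*} [∀ i, Fintype (p i)] [∀ i, DecidableEq (p i)]

/-- Exchanging the `n`-th coordinate with an additional coordinate. -/
theorem sum_sum_update (n : Fin N) (F : p n → (∀ j, p j) → ℂ) :
    ∑ x : ∀ j, p j, ∑ z, F (x n) (Function.update x n z) = ∑ x, ∑ z, F z x := by
  rw [← Fintype.sum_prod_type', ← Fintype.sum_prod_type']
  have hinv : Function.Involutive
      (fun s : (∀ j, p j) × p n => (Function.update s.1 n s.2, s.1 n)) := fun s => by simp
  refine Fintype.sum_equiv hinv.toPerm _ _ fun s => ?_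
  simp

theorem sum_localOp_mul (n : Fin N) (A : Matrix (p n) (p n) ℂ) (f : (∀ j, p j) → ℂ)
    (x : ∀ j, p j) :
    ∑ y, localOp n A x y * f y = ∑ w, A (x n) w * f (Function.update x n w) := by
  have h : ∀ y, localOp n A x y * f y
      = ∑ w, if Function.update x n w = y then A (x n) w * f y else 0 := by
    intro y
    by_cases hy : ∀ j, j ≠ n → x j = y j
    · rw [Finset.sum_eq_single (y n)]
      · have : Function.update x n (y n) = y := by
          funext j
          by_cases hj : j = n
          · subst hj; simp
          · rw [Function.update_of_ne hj, hy j hj]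
        simp only [localOp, Matrix.of_apply, if_pos hy, this, if_true]
      · intro w _ hw
        rw [if_neg]
        rintro rfl
        simp at hw
      · simp
    · rw [Finset.sum_eq_zero]
      · simp only [localOp, Matrix.of_apply, if_neg hy, zero_mul]
      · intro w _
        rw [if_neg]
        rintro rfl
        exact hy fun j hj => by rw [Function.update_of_ne hj]
  simp only [h]
  rw [Finset.sum_comm]
  simp

theorem isHermitian_localOp (n : Fin N) {A : Matrix (p n) (p n) ℂ} (hA : A.IsHermitian) :
    (localOp n A).IsHermitian := by
  ext x y
  simp only [conjTranspose_apply, localOp, Matrix.of_apply]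
  simp only [eq_comm (a := y _)]
  split_ifs
  · exact hA.apply _ _
  · simp

theorem isHermitian_totalCharge {X : ∀ i, Matrix (p i) (p i) ℂ} (hX : ∀ i, (X i).IsHermitian) :
    (totalCharge X).IsHermitian := by
  rw [IsHermitian, totalCharge, conjTranspose_sum]
  exact Finset.sum_congr rfl fun i _ => isHermitian_localOp i (hX i)

/-- Reading the memory and resetting the indicated subsystem to `τ`. -/
def reset (τ : ∀ i, p i → ℂ) :
    Matrix (Fin N × (∀ j, p j)) (Fin N × (∀ j, p j)) ℂ →ₗ[ℂ]
      Matrix (Fin N × (∀ j, p j)) (Fin N × (∀ j, p j)) ℂ where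
  toFun M := Matrix.of fun u v => if u.1 = v.1 then
      (τ u.1 (u.2 u.1) * star (τ u.1 (v.2 u.1))) *
        ∑ z : p u.1, M (u.1, Function.update u.2 u.1 z) (u.1, Function.update v.2 u.1 z)
    else 0
  map_add' M M' := by
    ext u v
    by_cases h : u.1 = v.1 <;> simp [h, Finset.sum_add_distrib, mul_add]
  map_smul' c M := by
    ext u v
    by_cases h : u.1 = v.1 <;> simp [h, ← Finset.mul_sum, mul_left_comm]

/-- The Kraus operators of `reset τ`. -/
def resetKraus (τ : ∀ i, p i → ℂ) (e : Σ i, p i) :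
    Matrix (Fin N × (∀ j, p j)) (Fin N × (∀ j, p j)) ℂ :=
  Matrix.of fun u v => if u.1 = e.1 ∧ (e.1, Function.update u.2 e.1 e.2) = v then
    τ e.1 (u.2 e.1) else 0

theorem resetKraus_mul_apply {d : Type*} (τ : ∀ i, p i → ℂ) (e : Σ i, p i)
    (W : Matrix (Fin N × (∀ j, p j)) d ℂ) (m : Fin N) (x : ∀ j, p j) (i : d) :
    (resetKraus τ e * W) (m, x) i
      = if m = e.1 then τ e.1 (x e.1) * W (e.1, Function.update x e.1 e.2) i else 0 := by
  by_cases hm : m = e.1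
  · simp [Matrix.mul_apply, resetKraus, hm]
  · simp [Matrix.mul_apply, resetKraus, hm]

theorem reset_eq_sum (τ : ∀ i, p i → ℂ)
    (M : Matrix (Fin N × (∀ j, p j)) (Fin N × (∀ j, p j)) ℂ) :
    reset τ M = ∑ e, resetKraus τ e * M * (resetKraus τ e)ᴴ := by
  ext ⟨m, x⟩ ⟨m', y⟩
  have h : ∀ e : Σ i, p i, (resetKraus τ e * M * (resetKraus τ e)ᴴ) (m, x) (m', y)
      = if m = e.1 ∧ m' = e.1 then τ e.1 (x e.1) * star (τ e.1 (y e.1)) *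
        M (e.1, Function.update x e.1 e.2) (e.1, Function.update y e.1 e.2) else 0 := by
    intro e
    rw [Matrix.mul_assoc, resetKraus_mul_apply]
    have h2 : ∀ s, (M * (resetKraus τ e)ᴴ) s (m', y)
        = star ((resetKraus τ e * Mᴴ) (m', y) s) := fun s => by
      rw [← conjTranspose_apply, conjTranspose_mul, conjTranspose_conjTranspose]
    rw [h2, resetKraus_mul_apply]
    by_cases h1 : m = e.1 <;> by_cases h3 : m' = e.1
    · simp [h1, h3]; ring
    · simp [h1, h3]
    · simp [h1, h3]
    · simp [h1, h3]
  rw [Matrix.sum_apply]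
  simp only [h]
  rw [Fintype.sum_sigma, Finset.sum_eq_single m]
  · by_cases hm : m = m'
    · subst hm
      simp [reset, Finset.mul_sum]
    · simp [reset, hm, Ne.symm hm]
  · intro n _ hn
    simp [Ne.symm hn]
  · simp

theorem trace_reset {τ : ∀ i, p i → ℂ} (hτ : ∀ i, IsUnitVec (τ i))
    (M : Matrix (Fin N × (∀ j, p j)) (Fin N × (∀ j, p j)) ℂ) : (reset τ M).trace = M.trace := by
  simp only [Matrix.trace, Matrix.diag_apply, Fintype.sum_prod_type]
  refine Finset.sum_congr rfl fun n _ => ?_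
  have h := sum_sum_update n fun z x => τ n z * star (τ n z) * M (n, x) (n, x)
  have hu : ∑ z, τ n z * star (τ n z) = 1 := by
    rw [← hτ n]
    simp [dotProduct, mul_comm]
  simp only [← Finset.mul_sum, ← Finset.sum_mul, hu, one_mul] at h
  rw [← h]
  simp [reset]

theorem isPTP_reset {τ : ∀ i, p i → ℂ} (hτ : ∀ i, IsUnitVec (τ i)) : IsPTP (reset τ) := by
  refine ⟨fun M hM => ?_, trace_reset hτ⟩
  rw [reset_eq_sum]
  exact Matrix.posSemidef_sum _ fun e _ => hM.mul_mul_conjTranspose_same _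

theorem reset_apply_same (τ : ∀ i, p i → ℂ)
    (M : Matrix (Fin N × (∀ j, p j)) (Fin N × (∀ j, p j)) ℂ) (m : Fin N) (x y : ∀ j, p j) :
    reset τ M (m, x) (m, y) = τ m (x m) * star (τ m (y m)) *
      ∑ z, M (m, Function.update x m z) (m, Function.update y m z) := by
  simp [reset]

theorem reset_apply_ne (τ : ∀ i, p i → ℂ)
    (M : Matrix (Fin N × (∀ j, p j)) (Fin N × (∀ j, p j)) ℂ) {m m' : Fin N} (h : m ≠ m')
    (x y : ∀ j, p j) : reset τ M (m, x) (m', y) = 0 := by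
  simp [reset, h]

/-- The memory still points to the same site, and the second reset discards whatever unit vector the
first one wrote there. -/
theorem reset_comp_reset (τ : ∀ i, p i → ℂ) {g : ∀ i, p i → ℂ} (hg : ∀ i, IsUnitVec (g i)) :
    reset τ ∘ₗ reset g = reset τ := by
  refine LinearMap.ext fun M => ?_
  ext ⟨m, x⟩ ⟨m', y⟩
  have hu : ∑ z, g m z * star (g m z) = 1 := by
    rw [← hg m]
    simp [dotProduct, mul_comm]
  by_cases h : m = m'
  · subst h
    simp only [LinearMap.comp_apply, reset_apply_same, Function.update_self,
      Function.update_idem]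
    rw [← Finset.sum_mul, hu, one_mul]
  · rw [LinearMap.comp_apply, reset_apply_ne _ _ h, reset_apply_ne _ _ h]

/-- The code `V` together with a memory in a uniform superposition. -/
def withMemory {d : Type*} (V : Matrix (∀ j, p j) d ℂ) : Matrix (Fin N × (∀ j, p j)) d ℂ :=
  Matrix.of fun u i => ((1 / √N : ℝ) : ℂ) * V u.2 i

/-- The reset removes all coherence between memory states, so a uniform superposition of locations
serves as the uniform mixture. -/
theorem erasure_comp_encode {d : Type*} [Fintype d] (τ : ∀ i, p i → ℂ)
    (V : Matrix (∀ j, p j) d ℂ) :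
    erasure τ ∘ₗ encode V = reset τ ∘ₗ encode (withMemory V) := by
  refine LinearMap.ext fun M => ?_
  ext ⟨m, x⟩ ⟨m', y⟩
  have hW : ∀ u v, (withMemory V * M * (withMemory V)ᴴ) u v
      = (1 / (N : ℂ)) * (V * M * Vᴴ) u.2 v.2 := by
    intro u v
    have hN : ((1 / √N : ℝ) : ℂ) * ((1 / √N : ℝ) : ℂ) = 1 / (N : ℂ) := by
      rw [← Complex.ofReal_mul, div_mul_div_comm, Real.mul_self_sqrt (Nat.cast_nonneg N)]
      simp
    simp only [Matrix.mul_apply, conjTranspose_apply, withMemory, Matrix.of_apply, star_mul',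
      Complex.star_def, Complex.conj_ofReal, ← hN, Finset.mul_sum, Finset.sum_mul]
    refine Finset.sum_congr rfl fun i _ => Finset.sum_congr rfl fun j _ => ?_
    ring
  by_cases h : m = m'
  · subst h
    simp only [LinearMap.comp_apply, reset, erasure, encode, LinearMap.coe_mk, AddHom.coe_mk,
      Matrix.of_apply, if_true, hW, ← Finset.mul_sum]
    ring
  · simp [reset, erasure, h]

theorem conjTranspose_withMemory_mul_self {d : Type*} [DecidableEq d] (hN : 0 < N)
    {V : Matrix (∀ j, p j) d ℂ} (hV : Vᴴ * V = 1) : (withMemory V)ᴴ * withMemory V = 1 := by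
  rw [← hV]
  ext i j
  have hN' : (N : ℂ) ≠ 0 := by exact_mod_cast hN.ne'
  have hN2 : ((1 / √N : ℝ) : ℂ) * ((1 / √N : ℝ) : ℂ) = 1 / (N : ℂ) := by
    rw [← Complex.ofReal_mul, div_mul_div_comm, Real.mul_self_sqrt (Nat.cast_nonneg N)]
    simp
  simp only [Matrix.mul_apply, conjTranspose_apply, withMemory, Matrix.of_apply, star_mul',
    Complex.star_def, Complex.conj_ofReal, Fintype.sum_prod_type]
  simp only [Finset.sum_const, Finset.card_univ, Fintype.card_fin, nsmul_eq_mul, Finset.mul_sum]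
  refine Finset.sum_congr rfl fun x _ => ?_
  linear_combination (N : ℂ) * (starRingEnd ℂ) (V x i) * V x j * hN2
    + (starRingEnd ℂ) (V x i) * V x j * (mul_one_div_cancel hN')

theorem trace_encode {d q : Type*} [Fintype d] [DecidableEq d] [Fintype q]
    {W : Matrix q d ℂ} (hW : Wᴴ * W = 1) (M : Matrix d d ℂ) : (encode W M).trace = M.trace := by
  change (W * M * Wᴴ).trace = _
  rw [Matrix.trace_mul_comm, ← Matrix.mul_assoc, hW, Matrix.one_mul]

/-- Conjugation determines a generator only up to a scalar: B = V†X_qV - X commutes with every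
matrix, hence is scalar, and it is real because B is Hermitian. -/
theorem IsInfinitesimallyCovariant.exists_mul_encode {d q : Type*} [Fintype d] [DecidableEq d]
    [Nonempty d] [Fintype q] {V : Matrix q d ℂ} (hV : Vᴴ * V = 1) {X : Matrix d d ℂ}
    {Xq : Matrix q q ℂ} (hX : X.IsHermitian) (hXq : Xq.IsHermitian)
    (h : IsInfinitesimallyCovariant (encode V) X Xq) :
    ∃ c : ℝ, Xq * V = V * (X + (c : ℂ) • 1) := by
  set B := Vᴴ * Xq * V - X with hB
  have h1 : ∀ M : Matrix d d ℂ, (Xq * V - V * X) * M = V * M * B := by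
    intro M
    have h2 : V * (X * M - M * X) * Vᴴ = Xq * (V * M * Vᴴ) - (V * M * Vᴴ) * Xq := h M
    have h3 := congrArg (· * V) h2
    simp only [Matrix.sub_mul, Matrix.mul_sub, Matrix.mul_assoc, hV, Matrix.mul_one] at h3
    simp only [hB, Matrix.sub_mul, Matrix.mul_sub, Matrix.mul_assoc]
    rw [sub_eq_sub_iff_add_eq_add] at h3 ⊢
    rw [← h3, add_comm]
  have h2 : Xq * V - V * X = V * B := by simpa using h1 1
  have h3 : ∀ M : Matrix d d ℂ, B * M = M * B := by
    intro M
    have h4 : Vᴴ * ((Xq * V - V * X) * M) = Vᴴ * (V * M * B) := by rw [h1]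
    rw [h2] at h4
    simpa only [← Matrix.mul_assoc, hV, Matrix.one_mul] using h4
  obtain ⟨c, hc⟩ : ∃ c : ℂ, B = c • 1 := by
    obtain ⟨c, hc⟩ := Matrix.mem_range_scalar_of_commute_single (M := B)
      (fun i j _ => (h3 _).symm)
    exact ⟨c, by rw [← hc, Matrix.scalar_apply, Matrix.smul_one_eq_diagonal]⟩
  have hBH : B.IsHermitian := (isHermitian_conjTranspose_mul_mul V hXq).sub hX
  have hcr : ((c.re : ℝ) : ℂ) = c := by
    let i : d := Classical.arbitrary d
    have := hBH.apply i i
    rw [hc] at this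
    simp only [Matrix.smul_apply, Matrix.one_apply_eq, smul_eq_mul, mul_one] at this
    exact Complex.conj_eq_iff_re.1 this
  refine ⟨c.re, ?_⟩
  rw [hcr, ← hc, Matrix.mul_add, ← h2]
  abel

end Reset

/-! ### Erasure resetting to eigenvectors -/

section Erasure

variable {l : Type*} [Fintype l] [DecidableEq l] {N : ℕ} {p : Fin N → Type*}
  [∀ i, Fintype (p i)] [∀ i, DecidableEq (p i)]

/-- The charge of the environment of the erasure channel. -/
def erasureCharge (XP : ∀ i, Matrix (p i) (p i) ℂ) (w : Fin N → ℝ) (c : ℝ) :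
    Matrix (Σ i, p i) (Σ i, p i) ℂ :=
  blockDiagonal' fun n => XP n - ((w n + c : ℝ) : ℂ) • 1

theorem isHermitian_erasureCharge {XP : ∀ i, Matrix (p i) (p i) ℂ}
    (hXP : ∀ i, (XP i).IsHermitian) (w : Fin N → ℝ) (c : ℝ) :
    (erasureCharge XP w c).IsHermitian := by
  rw [IsHermitian, erasureCharge, blockDiagonal'_conjTranspose]
  congr 1
  funext n
  exact ((hXP n).sub (isHermitian_real_smul_one _)).eq

theorem sum_erasureCharge_smul (XP : ∀ i, Matrix (p i) (p i) ℂ) (w : Fin N → ℝ) (c : ℝ) (n : Fin N)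
    (z : p n) {E : Type*} [AddCommGroup E] [Module ℂ E] (f : (Σ i, p i) → E) :
    ∑ y, erasureCharge XP w c ⟨n, z⟩ y • f y
      = ∑ z', XP n z z' • f ⟨n, z'⟩ - ((w n + c : ℝ) : ℂ) • f ⟨n, z⟩ := by
  rw [Fintype.sum_sigma, Finset.sum_eq_single n]
  · simp only [erasureCharge, blockDiagonal'_apply_eq, Matrix.sub_apply, Matrix.smul_apply,
      smul_eq_mul, sub_smul, Finset.sum_sub_distrib, Matrix.one_apply, mul_ite, mul_one, mul_zero,
      ite_smul, zero_smul, Finset.sum_ite_eq, Finset.mem_univ, if_true]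
  · intro m _ hm
    refine Finset.sum_eq_zero fun y _ => ?_
    rw [erasureCharge, blockDiagonal'_apply_ne _ _ _ (Ne.symm hm), zero_smul]
  · simp

theorem sum_totalCharge_mul (X : ∀ i, Matrix (p i) (p i) ℂ) (f : (∀ j, p j) → ℂ)
    (x : ∀ j, p j) :
    ∑ y, totalCharge X x y * f y = ∑ j, ∑ w, X j (x j) w * f (Function.update x j w) := by
  simp only [totalCharge, Matrix.sum_apply, Finset.sum_mul]
  rw [Finset.sum_comm]
  simp only [sum_localOp_mul]

/-- Charge bookkeeping: the operator labelled (n, z) removes the basis state z from site n and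
writes an eigenvector of charge w n. The environment must carry X_{P_n} - w n, and a further -c
compensates the offset of the code. -/
theorem symmetricKraus_erasure (hN : 0 < N) {XL : Matrix l l ℂ}
    {XP : ∀ i, Matrix (p i) (p i) ℂ} (hXP : ∀ i, (XP i).IsHermitian)
    {V : Matrix (∀ i, p i) l ℂ} (hV : Vᴴ * V = 1) {c : ℝ}
    (hc : totalCharge XP * V = V * (XL + (c : ℂ) • 1)) {w : Fin N → ℝ} {g : ∀ i, p i → ℂ}
    (hg : ∀ i, IsUnitEigenvec (XP i) (w i) (g i)) :
    SymmetricKraus (erasure g ∘ₗ encode V) XL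
      ((1 : Matrix (Fin N) (Fin N) ℂ) ⊗ₖ totalCharge XP) (erasureCharge XP w c)
      (fun e => resetKraus g e * withMemory V) := by
  have happ : ∀ M, (erasure g ∘ₗ encode V) M = ∑ e, (resetKraus g e * withMemory V) * M *
      (resetKraus g e * withMemory V)ᴴ := by
    intro M
    rw [erasure_comp_encode, LinearMap.comp_apply, reset_eq_sum]
    refine Finset.sum_congr rfl fun e _ => ?_
    simp only [encode, LinearMap.coe_mk, AddHom.coe_mk, conjTranspose_mul, Matrix.mul_assoc]
  refine ⟨isHermitian_erasureCharge hXP w c, happ, ?_, ?_⟩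
  · rw [Matrix.ext_iff_trace_mul_right]
    intro M
    have hT : ((erasure g ∘ₗ encode V) M).trace = M.trace := by
      rw [erasure_comp_encode, LinearMap.comp_apply, trace_reset fun i => (hg i).1,
        trace_encode (conjTranspose_withMemory_mul_self hN hV)]
    rw [Matrix.one_mul, ← hT, happ M, Matrix.sum_mul, trace_sum, trace_sum]
    refine Finset.sum_congr rfl fun x _ => ?_
    rw [Matrix.mul_assoc, Matrix.trace_mul_comm]
  · rintro ⟨n, z⟩
    rw [sum_erasureCharge_smul]
    ext ⟨m, x⟩ i
    have hW : ∀ (k : Fin N) (y : ∀ j, p j), withMemory V (k, y) i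
        = ((1 / √N : ℝ) : ℂ) * V y i := fun _ _ => rfl
    have h1 : (((1 : Matrix (Fin N) (Fin N) ℂ) ⊗ₖ totalCharge XP) *
        (resetKraus g ⟨n, z⟩ * withMemory V)) (m, x) i
        = ∑ y, totalCharge XP x y * (resetKraus g ⟨n, z⟩ * withMemory V) (m, y) i := by
      rw [Matrix.mul_apply, Fintype.sum_prod_type, Finset.sum_eq_single m]
      · simp
      · intro k _ hk
        simp [Matrix.one_apply_ne (Ne.symm hk)]
      · simp
    simp only [Matrix.add_apply, Matrix.sub_apply, Matrix.sum_apply, Matrix.smul_apply, smul_eq_mul]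
    rw [h1, Matrix.mul_assoc]
    simp only [resetKraus_mul_apply]
    by_cases hm : m = n
    swap
    · simp [hm]
    subst hm
    simp only [if_true, hW]
    set u := Function.update x m z with hu
    set s : ℂ := ((1 / √N : ℝ) : ℂ)
    have hV1 : ∑ y, totalCharge XP u y * V y i = (V * XL) u i + c * V u i := by
      have := congrFun (congrFun hc u) i
      rw [Matrix.mul_apply] at this
      rw [this, Matrix.mul_add, Matrix.add_apply, Matrix.mul_smul, Matrix.mul_one,
        Matrix.smul_apply, smul_eq_mul]
    have hV2 : (withMemory V * XL) (m, u) i = s * (V * XL) u i := by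
      simp only [Matrix.mul_apply, withMemory, Matrix.of_apply, Finset.mul_sum, mul_assoc, s]
    have hgm : ∑ z', XP m (x m) z' * g m z' = w m * g m (x m) := congrFun (hg m).2 (x m)
    rw [sum_totalCharge_mul] at hV1 ⊢
    rw [hV2]
    rw [← Finset.add_sum_erase _ _ (Finset.mem_univ m)] at hV1 ⊢
    -- Charges at the other sites commute with the reset of site m.
    have hne : ∀ j ∈ Finset.univ.erase m, ∑ w', XP j (x j) w' *
        (g m (Function.update x j w' m) *
          (s * V (Function.update (Function.update x j w') m z) i))
        = g m (x m) * s * ∑ w', XP j (u j) w' * V (Function.update u j w') i := by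
      intro j hj
      have hj' : j ≠ m := Finset.ne_of_mem_erase hj
      rw [Finset.mul_sum]
      refine Finset.sum_congr rfl fun w' _ => ?_
      rw [Function.update_of_ne hj'.symm, hu, Function.update_of_ne hj',
        Function.update_comm hj'.symm]
      ring
    rw [Finset.sum_congr rfl hne, ← Finset.mul_sum]
    have h0 : ∑ w', XP m (x m) w' * (g m (Function.update x m w' m) *
        (s * V (Function.update (Function.update x m w') m z) i))
        = w m * g m (x m) * (s * V u i) := by
      rw [← hgm, Finset.sum_mul]
      refine Finset.sum_congr rfl fun w' _ => ?_
      rw [Function.update_self, Function.update_idem]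
      ring
    have h3 : ∑ w', XP m (u m) w' * V (Function.update u m w') i
        = ∑ w', XP m z w' * V (Function.update x m w') i := by
      simp [hu]
    have h4 : ∑ w', XP m z w' * (g m (x m) * (s * V (Function.update x m w') i))
        = g m (x m) * s * ∑ w', XP m z w' * V (Function.update x m w') i := by
      rw [Finset.mul_sum]
      exact Finset.sum_congr rfl fun w' _ => by ring
    rw [h0, h4]
    rw [h3] at hV1
    push_cast
    linear_combination g m (x m) * s * hV1

/-- Multiplying the intertwining relation by K_x† and summing shows that Y is the environment charge
in the Heisenberg picture. -/
theorem SymmetricKraus.chargeChange_eq {a a' e : Type*} [Fintype a] [DecidableEq a] [Fintype a']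
    [Fintype e] {Φ : Matrix a a ℂ →ₗ[ℂ] Matrix a' a' ℂ} {XA : Matrix a a ℂ} {XA' : Matrix a' a' ℂ}
    {XE : Matrix e e ℂ} {K : e → Matrix a' a ℂ} (h : SymmetricKraus Φ XA XA' XE K) :
    chargeChange Φ XA XA' = ∑ x, ∑ y, XE x y • ((K x)ᴴ * K y) := by
  have hd : dual Φ XA' = ∑ x, (K x)ᴴ * (XA' * K x) := by
    rw [Matrix.ext_iff_trace_mul_right]
    intro M
    rw [trace_dual_mul, h.apply_eq, Matrix.mul_sum, Matrix.sum_mul, trace_sum, trace_sum]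
    refine Finset.sum_congr rfl fun x _ => ?_
    rw [← Matrix.mul_assoc, Matrix.trace_mul_comm]
    simp only [Matrix.mul_assoc]
  have hx : ∀ x, (K x)ᴴ * (XA' * K x) = (K x)ᴴ * K x * XA - ∑ y, XE x y • ((K x)ᴴ * K y) := by
    intro x
    rw [eq_sub_of_add_eq (h.intertwine x), Matrix.mul_sub, Matrix.mul_sum, ← Matrix.mul_assoc]
    simp only [Matrix.mul_smul]
  rw [chargeChange, hd]
  simp only [hx]
  rw [Finset.sum_sub_distrib, ← Finset.sum_mul, h.sum_eq_one, Matrix.one_mul]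
  abel

/-- Each site is lost with probability 1/N, so the environment collects 1/N of the total physical
charge up to constants. Compressed by V this is X_L/N plus a constant. -/
theorem chargeChange_erasure (hN : 0 < N) {XL : Matrix l l ℂ}
    {XP : ∀ i, Matrix (p i) (p i) ℂ} (hXP : ∀ i, (XP i).IsHermitian)
    {V : Matrix (∀ i, p i) l ℂ} (hV : Vᴴ * V = 1) {c : ℝ}
    (hc : totalCharge XP * V = V * (XL + (c : ℂ) • 1)) {w : Fin N → ℝ} {g : ∀ i, p i → ℂ}
    (hg : ∀ i, IsUnitEigenvec (XP i) (w i) (g i)) :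
    ∃ κ : ℂ, chargeChange (erasure g ∘ₗ encode V) XL
      ((1 : Matrix (Fin N) (Fin N) ℂ) ⊗ₖ totalCharge XP) = (1 / (N : ℂ)) • XL + κ • 1 := by
  have hN2 : ((1 / √N : ℝ) : ℂ) * ((1 / √N : ℝ) : ℂ) = 1 / (N : ℂ) := by
    rw [← Complex.ofReal_mul, div_mul_div_comm, Real.mul_self_sqrt (Nat.cast_nonneg N)]
    simp
  have hu : ∀ n, ∑ z, g n z * star (g n z) = 1 := fun n => by
    rw [← (hg n).1]
    simp [dotProduct, mul_comm]
  have hK : ∀ (n : Fin N) (z z' : p n) (i j : l),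
      ((resetKraus g ⟨n, z⟩ * withMemory V)ᴴ * (resetKraus g ⟨n, z'⟩ * withMemory V)) i j
        = (1 / (N : ℂ)) * ∑ x, g n (x n) * star (g n (x n)) *
          (star (V (Function.update x n z) i) * V (Function.update x n z') j) := by
    intro n z z' i j
    rw [Matrix.mul_apply, Fintype.sum_prod_type, Finset.sum_eq_single n, Finset.mul_sum]
    · refine Finset.sum_congr rfl fun x _ => ?_
      simp only [conjTranspose_apply, resetKraus_mul_apply, if_true, withMemory, Matrix.of_apply,
        star_mul', Complex.star_def, Complex.conj_ofReal, ← hN2]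
      ring
    · intro m _ hm
      simp [conjTranspose_apply, resetKraus_mul_apply, hm]
    · simp
  have hone : ∀ n, ∑ z, ((resetKraus g ⟨n, z⟩ * withMemory V)ᴴ *
      (resetKraus g ⟨n, z⟩ * withMemory V)) = (1 / (N : ℂ)) • 1 := by
    intro n
    ext i j
    have h := sum_sum_update n fun z x => g n z * star (g n z) * (star (V x i) * V x j)
    simp only [← Finset.sum_mul, hu, one_mul] at h
    rw [Matrix.sum_apply, Matrix.smul_apply, ← hV, Matrix.mul_apply]
    simp only [hK, ← Finset.mul_sum, conjTranspose_apply, smul_eq_mul]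
    rw [Finset.sum_comm, h]
  have hX : ∀ n, ∑ z, ∑ z', XP n z z' • ((resetKraus g ⟨n, z⟩ * withMemory V)ᴴ *
      (resetKraus g ⟨n, z'⟩ * withMemory V)) = (1 / (N : ℂ)) • (Vᴴ * (localOp n (XP n) * V)) := by
    intro n
    ext i j
    have h := sum_sum_update n fun z x => g n z * star (g n z) *
      (star (V x i) * (localOp n (XP n) * V) x j)
    simp only [← Finset.sum_mul, hu, one_mul] at h
    rw [Matrix.smul_apply, Matrix.mul_apply]
    simp only [conjTranspose_apply]
    rw [← h]
    simp only [Matrix.sum_apply, Matrix.smul_apply, hK, smul_eq_mul, Finset.mul_sum,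
      Matrix.mul_apply, sum_localOp_mul, Function.update_self, Function.update_idem]
    rw [Finset.sum_congr rfl fun z _ => Finset.sum_comm, Finset.sum_comm]
    refine Finset.sum_congr rfl fun x _ => Finset.sum_congr rfl fun z _ =>
      Finset.sum_congr rfl fun z' _ => ?_
    ring
  refine ⟨(1 / (N : ℂ)) * (c - ∑ n, ((w n + c : ℝ) : ℂ)), ?_⟩
  rw [(symmetricKraus_erasure hN hXP hV hc hg).chargeChange_eq, Fintype.sum_sigma]
  simp only [sum_erasureCharge_smul, Finset.sum_sub_distrib, ← Finset.smul_sum, hone, hX]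
  have hs : ∑ n, Vᴴ * (localOp n (XP n) * V) = XL + (c : ℂ) • 1 := by
    rw [← Matrix.mul_sum, ← Matrix.sum_mul]
    change Vᴴ * (totalCharge XP * V) = _
    rw [hc, ← Matrix.mul_assoc, hV, Matrix.one_mul]
  rw [hs, ← Finset.sum_smul, smul_add, smul_smul, smul_smul, add_sub_assoc, ← sub_smul]
  congr 2
  ring

end Erasure

/-! ### Extreme eigenvalues -/

section Spread

variable {n : Type*} [Fintype n] [DecidableEq n]

theorem minEig_le (X : Matrix n n ℂ) {x : ℝ} (hx : x ∈ spectrum ℝ X) : minEig X ≤ x :=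
  csInf_le X.finite_real_spectrum.bddBelow hx

theorem le_maxEig (X : Matrix n n ℂ) {x : ℝ} (hx : x ∈ spectrum ℝ X) : x ≤ maxEig X :=
  le_csSup X.finite_real_spectrum.bddAbove hx

theorem exists_isUnitEigenvec_minEig [Nonempty n] {X : Matrix n n ℂ} (hX : X.IsHermitian) :
    ∃ v, IsUnitEigenvec X (minEig X) v := by
  have hne : (spectrum ℝ X).Nonempty := by
    rw [hX.spectrum_real_eq_range_eigenvalues]
    exact Set.range_nonempty _
  have hmem := hne.csInf_mem X.finite_real_spectrum
  rw [hX.spectrum_real_eq_range_eigenvalues] at hmem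
  obtain ⟨i, hi⟩ := hmem
  refine ⟨_, isUnitVec_eigenvectorBasis hX i, ?_⟩
  rw [mulVec_eigenvectorBasis' hX i, minEig, hX.spectrum_real_eq_range_eigenvalues, ← hi]

theorem spread_nonneg [Nonempty n] {X : Matrix n n ℂ} (hX : X.IsHermitian) : 0 ≤ spread X := by
  have hmem : hX.eigenvalues (Classical.arbitrary n) ∈ spectrum ℝ X := by
    rw [hX.spectrum_real_eq_range_eigenvalues]
    exact Set.mem_range_self _
  exact sub_nonneg.2 ((minEig_le X hmem).trans (le_maxEig X hmem))

theorem posSemidef_sub_sq_of_spread_le {X : Matrix n n ℂ} (hX : X.IsHermitian) {δ : ℝ}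
    (hδ : spread X ≤ δ) :
    (((δ ^ 2 : ℝ) : ℂ) • (1 : Matrix n n ℂ)
      - (X - (minEig X : ℂ) • 1) * (X - (minEig X : ℂ) • 1)).PosSemidef := by
  have hc : ∀ r : ℝ, cfc (fun _ : ℝ => r) X = (r : ℂ) • (1 : Matrix n n ℂ) := fun r => by
    have h := cfc_const (R := ℝ) r X hX
    rw [Algebra.algebraMap_eq_smul_one] at h
    exact h
  have h1 : X - (minEig X : ℂ) • 1 = cfc (fun x : ℝ => x - minEig X) X := by
    rw [cfc_sub (fun x : ℝ => x) (fun _ => minEig X) X (continuousOn_spectrum _ _)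
      (continuousOn_spectrum _ _), cfc_self hX, hc]
  rw [h1, cfc_mul_cfc, ← hc, ← cfc_sub _ _ X (continuousOn_spectrum _ _)
    (continuousOn_spectrum _ _)]
  refine posSemidef_cfc _ fun x hx => ?_
  have h2 := minEig_le X hx
  have h3 := le_maxEig X hx
  have h4 : x - minEig X ≤ δ := by unfold spread at hδ; linarith
  nlinarith

theorem posSemidef_blockDiagonal' {ι : Type*} [Fintype ι] [DecidableEq ι] {m : ι → Type*}
    [∀ i, Fintype (m i)] [∀ i, DecidableEq (m i)] {D : ∀ i, Matrix (m i) (m i) ℂ}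
    (hD : ∀ i, (D i).PosSemidef) : (blockDiagonal' D).PosSemidef := by
  choose C hC using fun i => exists_eq_mul_conjTranspose (hD i)
  have : blockDiagonal' D = blockDiagonal' C * (blockDiagonal' C)ᴴ := by
    rw [blockDiagonal'_conjTranspose, ← blockDiagonal'_mul]
    congr 1
    funext i
    exact hC i
  rw [this]
  exact posSemidef_self_mul_conjTranspose _

end Spread

/-! ### Orthogonal superpositions of two eigenvectors -/

section Pair

variable {a : Type*} [Fintype a] [DecidableEq a]

theorem dotProduct_eq_zero_of_eigen {X : Matrix a a ℂ} (hX : X.IsHermitian) {x y : ℝ}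
    {u v : a → ℂ} (hu : X *ᵥ u = (x : ℂ) • u) (hv : X *ᵥ v = (y : ℂ) • v) (hxy : x ≠ y) :
    star u ⬝ᵥ v = 0 := by
  have h1 : star u ⬝ᵥ X *ᵥ v = (y : ℂ) * (star u ⬝ᵥ v) := by rw [hv, dotProduct_smul, smul_eq_mul]
  have h2 : star u ⬝ᵥ X *ᵥ v = (x : ℂ) * (star u ⬝ᵥ v) := by
    rw [dotProduct_mulVec]
    conv_lhs => rw [← hX.eq, ← star_mulVec, hu]
    rw [star_smul, Complex.star_def, Complex.conj_ofReal, smul_dotProduct, smul_eq_mul]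
  have h3 : ((x : ℂ) - y) * (star u ⬝ᵥ v) = 0 := by rw [sub_mul, ← h1, ← h2, sub_self]
  exact (mul_eq_zero.1 h3).resolve_left (sub_ne_zero.2 (by exact_mod_cast hxy))

theorem proj_mul_proj_eq_zero {u v : a → ℂ} (h : star u ⬝ᵥ v = 0) : proj u * proj v = 0 := by
  rw [proj, proj, vecMulVec_mul_vecMulVec, h, zero_smul, vecMulVec_zero]

theorem inv_sqrt_two_mul_self : ((1 / √2 : ℝ) : ℂ) * ((1 / √2 : ℝ) : ℂ) = 1 / 2 := by
  rw [← Complex.ofReal_mul, div_mul_div_comm, Real.mul_self_sqrt (by norm_num)]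
  norm_num

theorem star_pair_dotProduct (u v : a → ℂ) :
    star (((1 / √2 : ℝ) : ℂ) • u) ⬝ᵥ (((1 / √2 : ℝ) : ℂ) • v) = 1 / 2 * (star u ⬝ᵥ v) := by
  rw [star_smul, Complex.star_def, Complex.conj_ofReal, smul_dotProduct, dotProduct_smul,
    smul_smul, inv_sqrt_two_mul_self, smul_eq_mul]

/-- The two ordered pairs contribute equally, each with weight 1/4. -/
theorem offDiag_pair {Y : Matrix a a ℂ} (hY : Y.IsHermitian) {ψ : Fin 2 → a → ℂ}
    (h01 : star (ψ 0) ⬝ᵥ ψ 1 = 0) :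
    offDiag Y (fun _ => 1 / 2) (fun k => proj (ψ k)) ^ 2 = 1 / 2 * ‖star (ψ 1) ⬝ᵥ Y *ᵥ ψ 0‖ ^ 2 := by
  have h10 : star (ψ 1) ⬝ᵥ ψ 0 = 0 := by
    rw [star_dotProduct, h01, star_zero]
  have e1 := pos_neg_of_mul_eq_zero (posSemidef_proj (ψ 0)) (posSemidef_proj (ψ 1))
    (proj_mul_proj_eq_zero h01)
  have e2 := pos_neg_of_mul_eq_zero (posSemidef_proj (ψ 1)) (posSemidef_proj (ψ 0))
    (proj_mul_proj_eq_zero h10)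
  have hsymm : ‖star (ψ 0) ⬝ᵥ Y *ᵥ ψ 1‖ = ‖star (ψ 1) ⬝ᵥ Y *ᵥ ψ 0‖ := by
    rw [star_dotProduct, star_mulVec, hY.eq, norm_star, dotProduct_mulVec]
  have f0 : Finset.univ.filter (fun k' : Fin 2 => k' ≠ 0) = {1} := by decide
  have f1 : Finset.univ.filter (fun k' : Fin 2 => k' ≠ 1) = {0} := by decide
  rw [offDiag, Fin.sum_univ_two, f0, f1, Finset.sum_singleton, Finset.sum_singleton,
    e1.1, e1.2, e2.1, e2.2, trace_proj_mul_proj_mul hY, trace_proj_mul_proj_mul hY,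
    Complex.ofReal_re, Complex.ofReal_re, hsymm, Real.sq_sqrt (by positivity)]
  ring

end Pair

/-! ### The covariant erasure channel and its coherence bound -/

section ErasureBound

variable {l : Type*} [Fintype l] [DecidableEq l] {N : ℕ} {p : Fin N → Type*}
  [∀ i, Fintype (p i)] [∀ i, DecidableEq (p i)]

theorem nonempty_of_isUnitVec {a : Type*} [Fintype a] {v : a → ℂ} (hv : IsUnitVec v) :
    Nonempty a := by
  by_contra h
  rw [not_nonempty_iff] at h
  simp [IsUnitVec, dotProduct] at hv

theorem isHermitian_one_kronecker_totalCharge {XP : ∀ i, Matrix (p i) (p i) ℂ}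
    (hXP : ∀ i, (XP i).IsHermitian) :
    ((1 : Matrix (Fin N) (Fin N) ℂ) ⊗ₖ totalCharge XP).IsHermitian :=
  isHermitian_kronecker isHermitian_one (isHermitian_totalCharge hXP)

theorem reset_comp_erasure_comp_encode (τ : ∀ i, p i → ℂ) {g : ∀ i, p i → ℂ}
    (hg : ∀ i, IsUnitVec (g i)) (V : Matrix (∀ i, p i) l ℂ) :
    reset τ ∘ₗ (erasure g ∘ₗ encode V) = erasure τ ∘ₗ encode V := by
  rw [erasure_comp_encode, erasure_comp_encode, ← LinearMap.comp_assoc, reset_comp_reset τ hg]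

/-- The environment charge is block diagonal over the sites. Shifted by c, its blocks X_{P_n} minus
their least eigenvalue lie between 0 and the largest spread. -/
theorem exists_realization_erasure_coherenceBound_le [Nonempty l] (hN : 0 < N) {XL : Matrix l l ℂ}
    (hXL : XL.IsHermitian) {XP : ∀ i, Matrix (p i) (p i) ℂ} (hXP : ∀ i, (XP i).IsHermitian)
    {V : Matrix (∀ i, p i) l ℂ} (hV : Vᴴ * V = 1) {c : ℝ}
    (hc : totalCharge XP * V = V * (XL + (c : ℂ) • 1)) {g : ∀ i, p i → ℂ}
    (hg : ∀ i, IsUnitEigenvec (XP i) (minEig (XP i)) (g i)) {K : Type*} (ρ : K → Matrix l l ℂ) :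
    ∃ I : SymmetricRealization (erasure g ∘ₗ encode V) XL
        ((1 : Matrix (Fin N) (Fin N) ℂ) ⊗ₖ totalCharge XP)
        ((Fin N × ∀ i, p i) × ((Σ i, p i) ⊕ Unit)) (l × ((Σ i, p i) ⊕ Unit)),
      coherenceBound I ρ ≤ 2 * ⨆ i, spread (XP i) := by
  have := fun i => nonempty_of_isUnitVec (hg i).1
  have : Nonempty (Fin N) := ⟨⟨0, hN⟩⟩
  have hX' := isHermitian_one_kronecker_totalCharge hXP
  obtain ⟨x, j, hj⟩ := exists_isUnitEigenvec hXL
  obtain ⟨y, q, hq⟩ := exists_isUnitEigenvec hX'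
  have hS := symmetricKraus_erasure hN hXP hV hc hg
  refine ⟨hS.realization hXL hX' hj hq, ?_⟩
  have hle : ∀ i, spread (XP i) ≤ ⨆ i, spread (XP i) := fun i =>
    le_ciSup (Set.finite_range fun i => spread (XP i)).bddAbove i
  -- Centring at -c undoes the code offset in the environment charge.
  refine hS.coherenceBound_le hXL hX' hj hq (c := -c)
    ((spread_nonneg (hXP ⟨0, hN⟩)).trans (hle _)) ?_ ρ
  set δ := ⨆ i, spread (XP i)
  have e1 : erasureCharge XP (fun i => minEig (XP i)) c - ((-c : ℝ) : ℂ) • 1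
      = blockDiagonal' fun n => XP n - (minEig (XP n) : ℂ) • 1 := by
    rw [erasureCharge, ← blockDiagonal'_one, ← blockDiagonal'_smul, ← blockDiagonal'_sub]
    congr 1
    funext n
    change XP n - ((minEig (XP n) + c : ℝ) : ℂ) • (1 : Matrix (p n) (p n) ℂ)
      - ((-c : ℝ) : ℂ) • (1 : Matrix (p n) (p n) ℂ) = _
    rw [Complex.ofReal_add, Complex.ofReal_neg, add_smul, neg_smul]
    abel
  rw [e1, ← blockDiagonal'_mul, ← blockDiagonal'_one, ← blockDiagonal'_smul, ← blockDiagonal'_sub]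
  exact posSemidef_blockDiagonal' fun n => posSemidef_sub_sq_of_spread_le (hXP n) (hle n)

end ErasureBound

/-! ### The two-state ensemble and the explicit erasure bound -/

section Superposition

variable {l : Type*} [Fintype l] [DecidableEq l]

/-- The states `(u ± v)/√2`. -/
def superpositions (u v : l → ℂ) : Fin 2 → l → ℂ :=
  ![((1 / √2 : ℝ) : ℂ) • (u + v), ((1 / √2 : ℝ) : ℂ) • (u - v)]

theorem star_superpositions_dotProduct {u v : l → ℂ} (hu : IsUnitVec u) (hv : IsUnitVec v)
    (huv : star u ⬝ᵥ v = 0) :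
    star (superpositions u v 0) ⬝ᵥ superpositions u v 1 = 0 := by
  have hvu : star v ⬝ᵥ u = 0 := by rw [star_dotProduct, huv, star_zero]
  unfold IsUnitVec at hu hv
  change star (((1 / √2 : ℝ) : ℂ) • (u + v)) ⬝ᵥ (((1 / √2 : ℝ) : ℂ) • (u - v)) = 0
  rw [star_pair_dotProduct, star_add, add_dotProduct, dotProduct_sub, dotProduct_sub, hu, hv, huv,
    hvu]
  ring

theorem isUnitVec_superpositions {u v : l → ℂ} (hu : IsUnitVec u) (hv : IsUnitVec v)
    (huv : star u ⬝ᵥ v = 0) (k : Fin 2) : IsUnitVec (superpositions u v k) := by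
  have hvu : star v ⬝ᵥ u = 0 := by rw [star_dotProduct, huv, star_zero]
  unfold IsUnitVec at hu hv ⊢
  fin_cases k
  · change star (((1 / √2 : ℝ) : ℂ) • (u + v)) ⬝ᵥ (((1 / √2 : ℝ) : ℂ) • (u + v)) = 1
    rw [star_pair_dotProduct, star_add, add_dotProduct, dotProduct_add, dotProduct_add, hu, hv, huv,
      hvu]
    norm_num
  · change star (((1 / √2 : ℝ) : ℂ) • (u - v)) ⬝ᵥ (((1 / √2 : ℝ) : ℂ) • (u - v)) = 1
    rw [star_pair_dotProduct, star_sub, sub_dotProduct, dotProduct_sub, dotProduct_sub, hu, hv, huv,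
      hvu]
    norm_num

theorem isTestEnsemble_superpositions {u v : l → ℂ} (hu : IsUnitVec u) (hv : IsUnitVec v)
    (huv : star u ⬝ᵥ v = 0) :
    IsTestEnsemble (fun _ => 1 / 2) fun k => proj (superpositions u v k) :=
  ⟨fun _ => by norm_num, by norm_num [Fin.sum_univ_two],
    fun k => isState_proj (isUnitVec_superpositions hu hv huv k)⟩

theorem isOrthogonalEnsemble_superpositions {u v : l → ℂ} (hu : IsUnitVec u) (hv : IsUnitVec v)
    (huv : star u ⬝ᵥ v = 0) : IsOrthogonalEnsemble fun k => proj (superpositions u v k) := by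
  have h01 := star_superpositions_dotProduct hu hv huv
  have h10 : star (superpositions u v 1) ⬝ᵥ superpositions u v 0 = 0 := by
    rw [star_dotProduct, h01, star_zero]
  intro k k' hk
  refine fidelity_eq_zero_of_mul (posSemidef_proj _) (posSemidef_proj _) (proj_mul_proj_eq_zero ?_)
  fin_cases k <;> fin_cases k'
  · exact absurd rfl hk
  · exact h01
  · exact h10
  · exact absurd rfl hk

theorem superpositions_dotProduct_mulVec {u v : l → ℂ} (hu : IsUnitVec u) (hv : IsUnitVec v)
    (huv : star u ⬝ᵥ v = 0) {Y : Matrix l l ℂ} {y z : ℂ} (hYu : Y *ᵥ u = y • u)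
    (hYv : Y *ᵥ v = z • v) :
    star (superpositions u v 1) ⬝ᵥ Y *ᵥ superpositions u v 0 = 1 / 2 * (y - z) := by
  have hvu : star v ⬝ᵥ u = 0 := by rw [star_dotProduct, huv, star_zero]
  unfold IsUnitVec at hu hv
  change star (((1 / √2 : ℝ) : ℂ) • (u - v)) ⬝ᵥ Y *ᵥ (((1 / √2 : ℝ) : ℂ) • (u + v)) = _
  rw [mulVec_smul, star_pair_dotProduct, mulVec_add, hYu, hYv, star_sub, sub_dotProduct,
    dotProduct_add, dotProduct_add, dotProduct_smul, dotProduct_smul, dotProduct_smul,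
    dotProduct_smul, hu, hv, huv, hvu]
  simp only [smul_eq_mul]
  ring

end Superposition

section ErasureTwoStates

variable {l : Type*} [Fintype l] [DecidableEq l] [Nonempty l] {N : ℕ} {p : Fin N → Type*}
  [∀ i, Fintype (p i)] [∀ i, DecidableEq (p i)]

/-- The constant in Y cancels between the two eigenvectors, leaving the matrix element (x - y)/(2N);
the weight 1/2 of `offDiag_pair` adds the factor 1/√2. -/
theorem offDiag_erasure_superpositions (hN : 0 < N) {XL : Matrix l l ℂ}
    {XP : ∀ i, Matrix (p i) (p i) ℂ}
    (hXP : ∀ i, (XP i).IsHermitian)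
    {V : Matrix (∀ i, p i) l ℂ} (hV : Vᴴ * V = 1) {c : ℝ}
    (hc : totalCharge XP * V = V * (XL + (c : ℂ) • 1)) {w : Fin N → ℝ} {g : ∀ i, p i → ℂ}
    (hg : ∀ i, IsUnitEigenvec (XP i) (w i) (g i)) {x y : ℝ} {u v : l → ℂ}
    (hY : (chargeChange (erasure g ∘ₗ encode V) XL
      ((1 : Matrix (Fin N) (Fin N) ℂ) ⊗ₖ totalCharge XP)).IsHermitian)
    (hu : IsUnitEigenvec XL x u) (hv : IsUnitEigenvec XL y v) (huv : star u ⬝ᵥ v = 0)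
    (hyx : y ≤ x) :
    offDiag (chargeChange (erasure g ∘ₗ encode V) XL
        ((1 : Matrix (Fin N) (Fin N) ℂ) ⊗ₖ totalCharge XP)) (fun _ => 1 / 2)
        (fun k => proj (superpositions u v k)) = (x - y) / (2 * √2 * N) := by
  obtain ⟨κ, hκ⟩ := chargeChange_erasure hN hXP hV hc hg
  have hsq := offDiag_pair hY (star_superpositions_dotProduct hu.1 hv.1 huv)
  have hYw : ∀ {z : ℝ} {f : l → ℂ}, IsUnitEigenvec XL z f →
      ((1 / (N : ℂ)) • XL + κ • 1) *ᵥ f = (1 / (N : ℂ) * z + κ) • f := fun {z f} hf => by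
    rw [add_mulVec, smul_mulVec, smul_mulVec, one_mulVec, hf.2, smul_smul, add_smul]
  have hval : star (superpositions u v 1) ⬝ᵥ chargeChange (erasure g ∘ₗ encode V) XL
      ((1 : Matrix (Fin N) (Fin N) ℂ) ⊗ₖ totalCharge XP) *ᵥ superpositions u v 0
      = (((x - y) / (2 * N) : ℝ) : ℂ) := by
    rw [hκ, superpositions_dotProduct_mulVec hu.1 hv.1 huv (hYw hu) (hYw hv)]
    push_cast
    ring
  have hN' : (0 : ℝ) < N := by exact_mod_cast hN
  rw [hval, Complex.norm_real, Real.norm_eq_abs, sq_abs] at hsq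
  refine (pow_left_inj₀ (Real.sqrt_nonneg _)
    (div_nonneg (sub_nonneg.2 hyx) (by positivity)) two_ne_zero).1 ?_
  refine hsq.trans ?_
  rw [div_pow, div_pow, mul_pow, mul_pow, mul_pow, Real.sq_sqrt (by norm_num)]
  field_simp

theorem le_recoveryError_erasure_superpositions (hN : 0 < N) {XL : Matrix l l ℂ}
    (hXL : XL.IsHermitian)
    {XP : ∀ i, Matrix (p i) (p i) ℂ} (hXP : ∀ i, (XP i).IsHermitian)
    {V : Matrix (∀ i, p i) l ℂ} (hV : Vᴴ * V = 1) {c : ℝ}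
    (hc : totalCharge XP * V = V * (XL + (c : ℂ) • 1)) (hs : 0 < spread XL) {τ : ∀ i, p i → ℂ}
    (hτ : ∀ i, IsUnitVec (τ i)) {u v : l → ℂ} (hu : IsUnitEigenvec XL (maxEig XL) u)
    (hv : IsUnitEigenvec XL (minEig XL) v) (huv : star u ⬝ᵥ v = 0) :
    spread XL / (spread XL + 4 * √2 * N * ⨆ i, spread (XP i))
      ≤ recoveryError (erasure τ ∘ₗ encode V) (fun _ => 1 / 2)
        fun k => proj (superpositions u v k) := by
  have := fun i => nonempty_of_isUnitVec (hτ i)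
  choose g hg using fun i => exists_isUnitEigenvec_minEig (hXP i)
  have hX' := isHermitian_one_kronecker_totalCharge hXP
  obtain ⟨I, hI⟩ := exists_realization_erasure_coherenceBound_le hN hXL hXP hV hc hg
    fun k => proj (superpositions u v k)
  obtain ⟨h1, -, h3⟩ := I.tradeoff_recoveryError hXL hX' (isPTP_reset hτ)
    (reset_comp_erasure_comp_encode τ (fun i => (hg i).1) V)
    (isTestEnsemble_superpositions hu.1 hv.1 huv)
  have h1 := h1 (isOrthogonalEnsemble_superpositions hu.1 hv.1 huv)
  rw [offDiag_erasure_superpositions hN hXP hV hc hg (I.isHermitian_chargeChange hXL hX') hu hv huv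
    (sub_nonneg.1 hs.le)] at h1 h3
  change spread XL / _ / _ ≤ _ at h1
  change _ → spread XL / _ = 0 at h3
  set δ := ⨆ i, spread (XP i)
  have hN' : (0 : ℝ) < N := by exact_mod_cast hN
  -- Division by Δ = 0 would make the bound vacuous; it is excluded because 𝒞 > 0 here.
  have hΔ : 0 < coherenceBound I fun k => proj (superpositions u v k) := by
    refine lt_of_le_of_ne (I.coherenceBound_nonneg _) fun h => ?_
    have : 0 < spread XL / (2 * √2 * N) := by positivity
    exact this.ne' (h3 h.symm)
  refine le_trans ?_ h1
  have hδ : 0 < δ := by linarith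
  -- The extra term in the denominator only weakens the bound; the rest is 𝒞/(2δ).
  calc spread XL / (spread XL + 4 * √2 * N * δ) ≤ spread XL / (4 * √2 * N * δ) := by
        gcongr; linarith
    _ = spread XL / (2 * √2 * N) / (2 * δ) := by
        rw [div_div]; congr 1; ring
    _ ≤ _ := by gcongr

end ErasureTwoStates

end

end CovCode

theorem mainTheorem9
    {l : Type*} [Fintype l] [DecidableEq l] [Nonempty l]
    {N : ℕ} (hN : 0 < N)
    {p : Fin N → Type*} [∀ i, Fintype (p i)] [∀ i, DecidableEq (p i)]
    -- conserved quantities on the logical system and on the subsystems of the physical system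
    (XL : Matrix l l ℂ) (hXL : XL.IsHermitian)
    (XP : ∀ i, Matrix (p i) (p i) ℂ) (hXP : ∀ i, (XP i).IsHermitian)
    -- the isometric covariant code
    (V : Matrix (∀ i, p i) l ℂ) (hV : Vᴴ * V = 1)
    (hcov : IsCovariant (encode V) XL (totalCharge XP)) :
    -- arbitrary covariant noise
    (∀ (q : Type*) [Fintype q] [DecidableEq q] (Xq : Matrix q q ℂ)
        (Noise : Matrix (∀ i, p i) (∀ i, p i) ℂ →ₗ[ℂ] Matrix q q ℂ),
        Xq.IsHermitian → IsChannel Noise → IsCovariant Noise (totalCharge XP) Xq →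
      (∃ m n : ℕ, Nonempty
        (SymmetricRealization (Noise ∘ₗ encode V) XL Xq (Fin m) (Fin n))) ∧
      ∀ (b b' : Type*) [Fintype b] [DecidableEq b] [Fintype b'] [DecidableEq b']
        (I : SymmetricRealization (Noise ∘ₗ encode V) XL Xq b b')
        (K : Type*) [Fintype K] [DecidableEq K] (prob : K → ℝ) (ρ : K → Matrix l l ℂ),
        IsTestEnsemble prob ρ →
        let C := offDiag (chargeChange (Noise ∘ₗ encode V) XL Xq) prob ρ
        let Δ := coherenceBound I ρ
        let ε := recoveryError (Noise ∘ₗ encode V) prob ρ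
        (IsOrthogonalEnsemble ρ → C / Δ ≤ ε) ∧ C ^ 2 / Δ ^ 2 ≤ ε ∧ (Δ = 0 → C = 0)) ∧
    -- erasure noise with known location; `C` and `Δ` are those of the covariant erasure noise
    -- that resets the lost subsystem to a ground eigenvector
    (∀ τ : ∀ i, p i → ℂ, (∀ i, IsUnitVec (τ i)) →
      ∀ g : ∀ i, p i → ℂ, (∀ i, IsUnitEigenvec (XP i) (minEig (XP i)) (g i)) →
      (∃ m n : ℕ, Nonempty (SymmetricRealization (erasure g ∘ₗ encode V) XL
        ((1 : Matrix (Fin N) (Fin N) ℂ) ⊗ₖ totalCharge XP) (Fin m) (Fin n))) ∧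
      ∀ (b b' : Type*) [Fintype b] [DecidableEq b] [Fintype b'] [DecidableEq b']
        (I : SymmetricRealization (erasure g ∘ₗ encode V) XL
          ((1 : Matrix (Fin N) (Fin N) ℂ) ⊗ₖ totalCharge XP) b b')
        (K : Type*) [Fintype K] [DecidableEq K] (prob : K → ℝ) (ρ : K → Matrix l l ℂ),
        IsTestEnsemble prob ρ →
        let C := offDiag (chargeChange (erasure g ∘ₗ encode V) XL
          ((1 : Matrix (Fin N) (Fin N) ℂ) ⊗ₖ totalCharge XP)) prob ρ
        let Δ := coherenceBound I ρ
        let ε := recoveryError (erasure τ ∘ₗ encode V) prob ρ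
        (IsOrthogonalEnsemble ρ → C / Δ ≤ ε) ∧ C ^ 2 / Δ ^ 2 ≤ ε ∧ (Δ = 0 → C = 0)) ∧
    -- the two-state ensemble built from extreme eigenvectors of `XL`
    (0 < spread XL →
      ∀ τ : ∀ i, p i → ℂ, (∀ i, IsUnitVec (τ i)) →
      ∀ jmax jmin : l → ℂ, IsUnitEigenvec XL (maxEig XL) jmax →
        IsUnitEigenvec XL (minEig XL) jmin →
      let prob : Fin 2 → ℝ := fun _ => 1 / 2
      let ψ : Fin 2 → l → ℂ :=
        ![((1 / √2 : ℝ) : ℂ) • (jmax + jmin), ((1 / √2 : ℝ) : ℂ) • (jmax - jmin)]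
      let ρ : Fin 2 → Matrix l l ℂ := fun k => proj (ψ k)
      IsTestEnsemble prob ρ ∧ IsOrthogonalEnsemble ρ ∧
      spread XL / (spread XL + 4 * √2 * N * ⨆ i, spread (XP i))
        ≤ recoveryError (erasure τ ∘ₗ encode V) prob ρ) := by
  -- The offset c of the code enters only the two erasure claims.
  obtain ⟨c, hc⟩ := hcov.infinitesimal.exists_mul_encode hV hXL (isHermitian_totalCharge hXP)
  refine ⟨?_, ?_, ?_⟩
  · intro q _ _ Xq Noise hXq hNoise hNcov
    refine ⟨exists_realization_of_covariant hXL hXq (posSemidef_choi_comp_encode hNoise V)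
      (fun M => (hNoise.tracePreserving _).trans (trace_encode hV M))
      (hNcov.infinitesimal.comp hcov.infinitesimal), ?_⟩
    intro b b' _ _ _ _ I K _ _ prob ρ h
    exact I.tradeoff_recoveryError hXL hXq (S := LinearMap.id) ⟨fun _ h => h, fun _ => rfl⟩
      (LinearMap.id_comp _) h
  · intro τ hτ g hg
    have := fun i => nonempty_of_isUnitVec (hτ i)
    have : Nonempty (Fin N) := ⟨⟨0, hN⟩⟩
    have hX' := isHermitian_one_kronecker_totalCharge hXP
    refine ⟨(symmetricKraus_erasure hN hXP hV hc hg).exists_realization hXL hX', ?_⟩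
    intro b b' _ _ _ _ I K _ _ prob ρ h
    -- Resetting to τ is the positive map that carries the covariant erasure to the given one.
    exact I.tradeoff_recoveryError hXL hX' (isPTP_reset hτ)
      (reset_comp_erasure_comp_encode τ (fun i => (hg i).1) V) h
  · intro hs τ hτ jmax jmin hmax hmin
    have horth := dotProduct_eq_zero_of_eigen hXL hmax.2 hmin.2 (sub_pos.1 hs).ne'
    exact ⟨isTestEnsemble_superpositions hmax.1 hmin.1 horth,
      isOrthogonalEnsemble_superpositions hmax.1 hmin.1 horth,
      le_recoveryError_erasure_superpositions hN hXL hXP hV hc hs hτ hmax hmin horth⟩
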